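/- **Conventions.** Tensor products of $C^*$-algebras are minimal, $C^*(G)$ is the full group $C^*$-algebra of a discrete group $G$, $\lambda$ is its left regular representation on $\ell^2(G)$, and $\delta_G:C^*(G)\to C^*(G)\otimes C^*(G)$ is the comultiplication $g\mapsto g\otimes g$. If $X,Y$ are subspaces of a $C^*$-algebra, $XY^*$ is the closed linear span of the products $xy^*$. The double dual $B^{**}$ is the enveloping von Neumann algebra of $B$. *Coactions.* A coaction of $G$ on a $C^*$-algebra $B$ is an injective nondegenerate $*$-homomorphism $\delta:B\to B\otimes C^*(G)$ with $(\delta\otimes\iota)\circ\delta=(\iota\otimes\delta_G)\circ\delta$. It is normal if $(\iota\otimes\lambda)\circ\delta$ is injective. Put $B_s=\{b\in B:\delta(b)=b\otimes s\}$ and $D_s=B_sB_s^*$ for $s\in G$; then $D_{s^{-1}}=B_s^*B_s$. Let $p_s\in B^{**}$ be the projection that is the identity of $D_s^{**}$, and let $$M(B_s)=\{m\in p_sB^{**}p_{s^{-1}}: D_sm\cup mD_{s^{-1}}\subset B_s\}.$$ $B_s$ and $D_s$ are left Hilbert $D_s$-modules with inner product $\langle x,y\rangle=xy^*$. *Partial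 actions.* A partial action $\alpha$ of $G$ on a $C^*$-algebra $A$ consists of closed ideals $E_s$ of $A$ and $*$-isomorphisms $\alpha_s:E_{s^{-1}}\to E_s$ ($s\in G$) such that $E_e=A$ and $\alpha_{st}$ extends $\alpha_s\circ\alpha_t$ (defined on $\alpha_t^{-1}(E_{s^{-1}})$) for all $s,t\in G$. If $A$ is represented faithfully and nondegenerately on a Hilbert space $H$, the reduced crossed product $A\times_{\alpha,r}G$ is the $C^*$-algebra on $H\otimes\ell^2(G)$ generated by the operators $$am_s:=\sum_{t\in G}\bar\alpha_{t^{-1}}(a)\otimes\chi_t\lambda_s\qquad(s\in G,\ a\in E_s),$$ where $\bar\alpha_{t^{-1}}:A\to M(E_{t^{-1}})$ is the canonical extension of $\alpha_{t^{-1}}:E_t\to E_{t^{-1}}$ and $\chi_t$ is the projection of $\ell^2(G)$ onto the span of the basis vector at $t$; up to isomorphism it does not depend on the representation. The normalised dual coaction $\hat\alpha^n$ is the unique coaction of $G$ on $A\times_{\alpha,r}G$ with $\hat\alpha^n(am_s)=am_s\otimes s$ for $s\in G$, $a\in E_s$. A partial action of the free group $\mathbb F_n$ with free generators $g_1,\dots,g_n$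 is multiplicative if $\alpha_{s_1\cdots s_k}=\alpha_{s_1}\circ\cdots\circ\alpha_{s_k}$ (with equal domains) for every reduced word $s_1\cdots s_k$ in the $g_i^{\pm1}$. **Theorem.** Let $\delta$ be a normal coaction of $\mathbb F_n$ on a $C^*$-algebra $B$. Then there is a multiplicative partial action $\alpha$ of $\mathbb F_n$ on a $C^*$-algebra $A$ such that $(B,\delta)$ is (equivariantly) isomorphic to $(A\times_{\alpha,r}\mathbb F_n,\hat\alpha^n)$ if and only if 1. $B$ is generated as a $C^*$-algebra by $B_e\cup B_{g_1}\cup\dots\cup B_{g_n}$, and 2. for each $s=g_1,\dots,g_n$ there is $m_s\in M(B_s)$ with $m_sm_s^*=p_s$ and $m_s^*m_s=p_{s^{-1}}$. Moreover, condition 2 can be replaced by 3. for each $s=g_1,\dots,g_n$ there is an isomorphism $\psi_s:B_s\to D_s$ of left Hilbert $D_s$-modules; indeed, for each single generator $s$, an $m_s$ as in 2 exists if and only if a $\psi_s$ as in 3 exists. -/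

import Mathlib

set_option linter.unusedSectionVars false

open scoped TensorProduct ComplexOrder InnerProductSpace ENNReal

universe u v

noncomputable section

/-- A `C*`-seminorm on a complex `*`-algebra. -/
structure CStarSeminorm (X : Type*) [NonUnitalRing X] [StarRing X] [Module ℂ X] extends
    Seminorm ℂ X where
  mul_le' : ∀ x y : X, toFun (x * y) ≤ toFun x * toFun y
  star_mul_self' : ∀ x : X, toFun (star x * x) = toFun x * toFun x

namespace CStarSeminorm

variable {X : Type*} [NonUnitalRing X] [StarRing X] [Module ℂ X]

theorem le_star (p : CStarSeminorm X) (x : X) : p.toSeminorm x ≤ p.toSeminorm (star x) := by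
  have h1 : p.toSeminorm (star x * x) = p.toSeminorm x * p.toSeminorm x := p.star_mul_self' x
  have h2 : p.toSeminorm (star x * x) ≤ p.toSeminorm (star x) * p.toSeminorm x :=
    p.mul_le' (star x) x
  by_contra h
  push Not at h
  have h3 : 0 ≤ p.toSeminorm (star x) := apply_nonneg _ _
  nlinarith

theorem map_star (p : CStarSeminorm X) (x : X) : p.toSeminorm (star x) = p.toSeminorm x :=
  le_antisymm (by simpa using p.le_star (star x)) (p.le_star x)

/-- The algebra `X`, seen as a seminormed algebra through `p`. -/
def Pre (_p : CStarSeminorm X) : Type _ := X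

variable (p : CStarSeminorm X)

/-- The identity map from `X` to its seminormed copy. -/
def toPre (x : X) : p.Pre := x

instance : NonUnitalRing p.Pre := inferInstanceAs (NonUnitalRing X)
instance : StarRing p.Pre := inferInstanceAs (StarRing X)
instance : Module ℂ p.Pre := inferInstanceAs (Module ℂ X)
instance [IsScalarTower ℂ X X] : IsScalarTower ℂ p.Pre p.Pre :=
  inferInstanceAs (IsScalarTower ℂ X X)
instance [SMulCommClass ℂ X X] : SMulCommClass ℂ p.Pre p.Pre :=
  inferInstanceAs (SMulCommClass ℂ X X)
instance [StarModule ℂ X] : StarModule ℂ p.Pre := inferInstanceAs (StarModule ℂ X)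

/-- The seminorm `p` on the copy `p.Pre`. -/
def preSeminorm : AddGroupSeminorm p.Pre where
  toFun x := p.toSeminorm x
  map_zero' := map_zero p.toSeminorm
  add_le' := map_add_le_add p.toSeminorm
  neg' := map_neg_eq_map p.toSeminorm

instance : SeminormedAddCommGroup p.Pre := p.preSeminorm.toSeminormedAddCommGroup

theorem norm_def (x : p.Pre) : ‖x‖ = p.toSeminorm x := rfl

instance : NormedSpace ℂ p.Pre where
  __ := (inferInstance : Module ℂ p.Pre)
  norm_smul_le c x := (map_smul_eq_mul p.toSeminorm c x).le

instance : NonUnitalSeminormedRing p.Pre where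
  __ := (inferInstance : NonUnitalRing p.Pre)
  __ := (inferInstance : SeminormedAddCommGroup p.Pre)
  norm_mul_le := p.mul_le'

instance : NormedStarGroup p.Pre where
  norm_star_le x := (p.map_star x).le

/-- The Hausdorff completion of `X` with respect to the `C*`-seminorm `p`. -/
def Completion (p : CStarSeminorm X) : Type _ := UniformSpace.Completion p.Pre

instance : NormedAddCommGroup p.Completion :=
  inferInstanceAs (NormedAddCommGroup (UniformSpace.Completion p.Pre))
instance : NormedSpace ℂ p.Completion :=
  inferInstanceAs (NormedSpace ℂ (UniformSpace.Completion p.Pre))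
instance : CompleteSpace p.Completion :=
  inferInstanceAs (CompleteSpace (UniformSpace.Completion p.Pre))

/-- The canonical map from `p.Pre` to the completion. -/
def coeL : p.Pre →L[ℂ] p.Completion := UniformSpace.Completion.toComplL

theorem norm_coeL (x : p.Pre) : ‖p.coeL x‖ = ‖x‖ := UniformSpace.Completion.norm_coe x

theorem denseRange_coeL : DenseRange p.coeL := UniformSpace.Completion.denseRange_coe

theorem isUniformInducing_coeL : IsUniformInducing p.coeL :=
  UniformSpace.Completion.isUniformInducing_coe _

@[elab_as_elim]
theorem induction_on {P : p.Completion → Prop} (x : p.Completion)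
    (hc : IsClosed {a | P a}) (h : ∀ a, P (p.coeL a)) : P x :=
  UniformSpace.Completion.induction_on x hc h

section Mul

variable [IsScalarTower ℂ X X] [SMulCommClass ℂ X X]

/-- Multiplication on the completion, as a bounded bilinear map. -/
def mulL : p.Completion →L[ℂ] p.Completion →L[ℂ] p.Completion :=
  ContinuousLinearMap.extend
    (LinearMap.mkContinuous
      { toFun := fun x => (p.coeL ∘L ContinuousLinearMap.mul ℂ p.Pre x).extend p.coeL
        map_add' := fun x y => by
          refine ContinuousLinearMap.extend_unique _ p.denseRange_coeL p.isUniformInducing_coeL _ ?_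
          ext z
          simp [ContinuousLinearMap.extend_eq _ p.denseRange_coeL p.isUniformInducing_coeL]
        map_smul' := fun c x => by
          refine ContinuousLinearMap.extend_unique _ p.denseRange_coeL p.isUniformInducing_coeL _ ?_
          ext z
          simp [ContinuousLinearMap.extend_eq _ p.denseRange_coeL p.isUniformInducing_coeL] }
      1 fun x => by
        refine ContinuousLinearMap.opNorm_le_bound _ (by positivity) fun y => ?_
        induction y using p.induction_on with
        | hc => exact isClosed_le (by fun_prop) (by fun_prop)
        | h z =>
        simp [ContinuousLinearMap.extend_eq _ p.denseRange_coeL p.isUniformInducing_coeL,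
          norm_coeL, norm_mul_le])
    p.coeL

theorem mulL_coe (x y : p.Pre) : p.mulL (p.coeL x) (p.coeL y) = p.coeL (x * y) := by
  simp [mulL, ContinuousLinearMap.extend_eq _ p.denseRange_coeL p.isUniformInducing_coeL]

instance : Mul p.Completion := ⟨fun x y => p.mulL x y⟩

theorem mul_def (x y : p.Completion) : x * y = p.mulL x y := rfl

theorem coe_mul (x y : p.Pre) : p.coeL (x * y) = p.coeL x * p.coeL y := (p.mulL_coe x y).symm

theorem continuous_mul' {Y : Type*} [TopologicalSpace Y] {f g : Y → p.Completion}
    (hf : Continuous f) (hg : Continuous g) : Continuous fun y => f y * g y := by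
  simp only [mul_def]; fun_prop

instance : NonUnitalRing p.Completion where
  __ := (inferInstance : AddCommGroup p.Completion)
  left_distrib _ _ _ := by simp [mul_def]
  right_distrib _ _ _ := by simp [mul_def]
  zero_mul _ := by simp [mul_def]
  mul_zero _ := by simp [mul_def]
  mul_assoc x y z := by
    induction x using p.induction_on with
    | hc =>
      exact isClosed_eq
        (p.continuous_mul' (p.continuous_mul' continuous_id continuous_const) continuous_const)
        (p.continuous_mul' continuous_id continuous_const)
    | h a =>
    induction y using p.induction_on with
    | hc =>
      exact isClosed_eq
        (p.continuous_mul' (p.continuous_mul' continuous_const continuous_id) continuous_const)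
        (p.continuous_mul' continuous_const (p.continuous_mul' continuous_id continuous_const))
    | h b =>
    induction z using p.induction_on with
    | hc =>
      exact isClosed_eq
        (p.continuous_mul' continuous_const continuous_id)
        (p.continuous_mul' continuous_const (p.continuous_mul' continuous_const continuous_id))
    | h c => simp only [← coe_mul, mul_assoc]

end Mul

theorem uniformContinuous_star_pre : UniformContinuous (star : p.Pre → p.Pre) :=
  (AddMonoidHomClass.isometry_of_norm (starAddEquiv : p.Pre ≃+ p.Pre) norm_star).uniformContinuous

instance : Star p.Completion := ⟨UniformSpace.Completion.map (star : p.Pre → p.Pre)⟩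

theorem coe_star (x : p.Pre) : p.coeL (star x) = star (p.coeL x) :=
  (UniformSpace.Completion.map_coe p.uniformContinuous_star_pre x).symm

theorem continuous_star' : Continuous (star : p.Completion → p.Completion) :=
  UniformSpace.Completion.continuous_map

section CStar

variable [IsScalarTower ℂ X X] [SMulCommClass ℂ X X] [StarModule ℂ X]

instance : StarRing p.Completion where
  star_involutive x := by
    induction x using p.induction_on with
    | hc =>
      exact isClosed_eq (p.continuous_star'.comp p.continuous_star') continuous_id
    | h a => simp only [← coe_star, star_star]
  star_mul x y := by
    induction x using p.induction_on with
    | hc =>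
      exact isClosed_eq
        (p.continuous_star'.comp (p.continuous_mul' continuous_id continuous_const))
        (p.continuous_mul' continuous_const p.continuous_star')
    | h a =>
    induction y using p.induction_on with
    | hc =>
      exact isClosed_eq
        (p.continuous_star'.comp (p.continuous_mul' continuous_const continuous_id))
        (p.continuous_mul' p.continuous_star' continuous_const)
    | h b => simp only [← coe_star, ← coe_mul, star_mul]
  star_add x y := by
    induction x using p.induction_on with
    | hc =>
      exact isClosed_eq (p.continuous_star'.comp (continuous_id.add continuous_const))
        (p.continuous_star'.add continuous_const)
    | h a =>
    induction y using p.induction_on with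
    | hc =>
      exact isClosed_eq (p.continuous_star'.comp (continuous_const.add continuous_id))
        (continuous_const.add p.continuous_star')
    | h b => simp only [← coe_star, ← map_add, star_add]

instance : NonUnitalNormedRing p.Completion where
  __ := (inferInstance : NonUnitalRing p.Completion)
  __ := (inferInstance : NormedAddCommGroup p.Completion)
  norm_mul_le x y := by
    induction x using p.induction_on with
    | hc =>
      exact isClosed_le (p.continuous_mul' continuous_id continuous_const).norm
        (continuous_norm.mul continuous_const)
    | h a =>
    induction y using p.induction_on with
    | hc =>
      exact isClosed_le (p.continuous_mul' continuous_const continuous_id).norm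
        (continuous_const.mul continuous_norm)
    | h b => simpa only [← coe_mul, norm_coeL] using norm_mul_le a b

instance : NonUnitalCStarAlgebra p.Completion where
  norm_mul_self_le x := by
    induction x using p.induction_on with
    | hc =>
      exact isClosed_le (continuous_norm.mul continuous_norm)
        (p.continuous_mul' p.continuous_star' continuous_id).norm
    | h a =>
      simp only [← coe_star, ← coe_mul, norm_coeL]
      exact (p.star_mul_self' a).ge
  smul_assoc c x y := by simp [smul_eq_mul, mul_def]
  smul_comm c x y := by simp [smul_eq_mul, mul_def]
  star_smul c x := by
    induction x using p.induction_on with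
    | hc =>
      exact isClosed_eq (p.continuous_star'.comp (continuous_const_smul c))
        ((continuous_const_smul (star c)).comp p.continuous_star')
    | h a => simp only [← map_smul, ← coe_star, star_smul]

/-- The canonical `*`-homomorphism from `X` to its completion. -/
def of : X →⋆ₙₐ[ℂ] p.Completion where
  toFun x := p.coeL (p.toPre x)
  map_smul' c x := map_smul p.coeL c (p.toPre x)
  map_zero' := map_zero p.coeL
  map_add' x y := map_add p.coeL (p.toPre x) (p.toPre y)
  map_mul' x y := p.coe_mul (p.toPre x) (p.toPre y)
  map_star' x := p.coe_star (p.toPre x)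

theorem norm_of (x : X) : ‖p.of x‖ = p.toSeminorm x := p.norm_coeL (p.toPre x)

theorem denseRange_of : DenseRange p.of := p.denseRange_coeL

variable {C : Type*} [NonUnitalCStarAlgebra C]

/-- The bounded linear extension to the completion underlying `CStarSeminorm.lift`. -/
def liftL (f : X →⋆ₙₐ[ℂ] C) (hf : ∀ x, ‖f x‖ ≤ p.toSeminorm x) : p.Completion →L[ℂ] C :=
  (LinearMap.mkContinuous
    ({ toFun := fun x => f x
       map_add' := fun x y => map_add f x y
       map_smul' := fun c x => map_smul f c x } : p.Pre →ₗ[ℂ] C) 1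
    fun x => by simpa [norm_def] using hf x).extend p.coeL

theorem liftL_coe (f : X →⋆ₙₐ[ℂ] C) (hf : ∀ x, ‖f x‖ ≤ p.toSeminorm x) (x : p.Pre) :
    p.liftL f hf (p.coeL x) = f x := by
  rw [liftL, ContinuousLinearMap.extend_eq _ p.denseRange_coeL p.isUniformInducing_coeL]
  rfl

/-- A `*`-homomorphism that is contractive for `p` extends to the completion. -/
def lift (f : X →⋆ₙₐ[ℂ] C) (hf : ∀ x, ‖f x‖ ≤ p.toSeminorm x) : p.Completion →⋆ₙₐ[ℂ] C where
  toFun := p.liftL f hf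
  map_smul' := map_smul (p.liftL f hf)
  map_zero' := map_zero (p.liftL f hf)
  map_add' := map_add (p.liftL f hf)
  map_mul' x y := by
    induction x using p.induction_on with
    | hc =>
      exact isClosed_eq (by fun_prop) (by fun_prop)
    | h a =>
    induction y using p.induction_on with
    | hc =>
      exact isClosed_eq (by fun_prop) (by fun_prop)
    | h b =>
      rw [← coe_mul, liftL_coe, liftL_coe, liftL_coe]
      exact map_mul f a b
  map_star' x := by
    induction x using p.induction_on with
    | hc =>
      exact isClosed_eq (by fun_prop) (by fun_prop)
    | h a =>
      rw [← coe_star, liftL_coe, liftL_coe]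
      exact StarHomClass.map_star f a

theorem lift_of (f : X →⋆ₙₐ[ℂ] C) (hf : ∀ x, ‖f x‖ ≤ p.toSeminorm x) (x : X) :
    p.lift f hf (p.of x) = f x := p.liftL_coe f hf x

end CStar

end CStarSeminorm

namespace CStarSeminorm

variable {X : Type*} [NonUnitalRing X] [StarRing X] [Module ℂ X]

/-- The pointwise supremum of a pointwise bounded family of `C*`-seminorms. -/
def iSup {ι : Type*} (q : ι → CStarSeminorm X)
    (hq : ∀ x, BddAbove (Set.range fun i => (q i).toSeminorm x)) : CStarSeminorm X where
  toFun x := ⨆ i, (q i).toSeminorm x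
  map_zero' := by simp
  add_le' x y := Real.iSup_le
    (fun i => (map_add_le_add (q i).toSeminorm x y).trans
      (add_le_add (le_ciSup (hq x) i) (le_ciSup (hq y) i)))
    (add_nonneg (Real.iSup_nonneg fun i => apply_nonneg _ _)
      (Real.iSup_nonneg fun i => apply_nonneg _ _))
  neg' x := by simp
  smul' c x := by
    simp only [map_smul_eq_mul]
    exact (Real.mul_iSup_of_nonneg (norm_nonneg c) _).symm
  mul_le' x y := Real.iSup_le
    (fun i => ((q i).mul_le' x y).trans
      (mul_le_mul (le_ciSup (hq x) i) (le_ciSup (hq y) i) (apply_nonneg (q i).toSeminorm y)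
        (Real.iSup_nonneg fun i => apply_nonneg _ _)))
    (mul_nonneg (Real.iSup_nonneg fun i => apply_nonneg _ _)
      (Real.iSup_nonneg fun i => apply_nonneg _ _))
  star_mul_self' x := by
    have h0 : 0 ≤ ⨆ i, (q i).toSeminorm x := Real.iSup_nonneg fun i => apply_nonneg _ _
    apply le_antisymm
    · refine Real.iSup_le (fun i => ?_) (mul_nonneg h0 h0)
      have h1 := le_ciSup (hq x) i
      have h2 : (q i).toSeminorm (star x * x) = _ := (q i).star_mul_self' x
      rw [h2]
      exact mul_le_mul h1 h1 (apply_nonneg (q i).toSeminorm x) h0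
    · have hM : 0 ≤ ⨆ i, (q i).toSeminorm (star x * x) :=
        Real.iSup_nonneg fun i => apply_nonneg _ _
      have h1 : ⨆ i, (q i).toSeminorm x ≤ √(⨆ i, (q i).toSeminorm (star x * x)) := by
        refine Real.iSup_le (fun i => Real.le_sqrt_of_sq_le ?_) (Real.sqrt_nonneg _)
        have h2 : (q i).toSeminorm (star x * x) = _ := (q i).star_mul_self' x
        rw [sq]
        exact h2.ge.trans (le_ciSup (hq (star x * x)) i)
      calc _ ≤ √(⨆ i, (q i).toSeminorm (star x * x)) * √(⨆ i, (q i).toSeminorm (star x * x)) :=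
            mul_le_mul h1 h1 h0 (Real.sqrt_nonneg _)
        _ = _ := Real.mul_self_sqrt hM

theorem le_iSup {ι : Type*} (q : ι → CStarSeminorm X)
    (hq : ∀ x, BddAbove (Set.range fun i => (q i).toSeminorm x)) (i : ι) (x : X) :
    (q i).toSeminorm x ≤ (iSup q hq).toSeminorm x := le_ciSup (hq x) i

theorem iSup_le {ι : Type*} (q : ι → CStarSeminorm X)
    (hq : ∀ x, BddAbove (Set.range fun i => (q i).toSeminorm x)) (x : X) {r : ℝ} (hr : 0 ≤ r)
    (h : ∀ i, (q i).toSeminorm x ≤ r) : (iSup q hq).toSeminorm x ≤ r := Real.iSup_le h hr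

/-- The `C*`-seminorm obtained by pulling back the norm along a `*`-homomorphism. -/
def ofHom {C : Type*} [NonUnitalCStarAlgebra C] (f : X →⋆ₙₐ[ℂ] C) : CStarSeminorm X where
  toFun x := ‖f x‖
  map_zero' := by simp
  add_le' x y := by simpa using norm_add_le (f x) (f y)
  neg' x := by simp
  smul' c x := by simp [norm_smul]
  mul_le' x y := by simpa using norm_mul_le (f x) (f y)
  star_mul_self' x := by
    rw [map_mul, StarHomClass.map_star, CStarRing.norm_star_mul_self]

end CStarSeminorm

/-! ### The full group `C*`-algebra -/

section GroupAlgebra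

variable {G : Type*} [Group G]

/-- The involution `(∑ c_g g)* = ∑ conj (c_g) g⁻¹` of the complex group algebra. -/
instance : Star (MonoidAlgebra ℂ G) where
  star f := .ofCoeff ((f.coeff.mapRange star (star_zero ℂ)).equivMapDomain (Equiv.inv G))

theorem MonoidAlgebra.star_coeff (f : MonoidAlgebra ℂ G) (g : G) :
    (star f).coeff g = star (f.coeff g⁻¹) := rfl

theorem MonoidAlgebra.star_single' (g : G) (c : ℂ) :
    star (MonoidAlgebra.single g c : MonoidAlgebra ℂ G) = MonoidAlgebra.single g⁻¹ (star c) := by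
  change MonoidAlgebra.ofCoeff _ = _
  rw [MonoidAlgebra.coeff_single, Finsupp.mapRange_single, Finsupp.equivMapDomain_single]
  rfl

instance : StarRing (MonoidAlgebra ℂ G) where
  star_involutive f := by
    ext g
    simp [MonoidAlgebra.star_coeff]
  star_add f h := by
    ext g
    simp [MonoidAlgebra.star_coeff]
  star_mul f h := by
    have hadd : ∀ a b : MonoidAlgebra ℂ G, star (a + b) = star a + star b := fun a b => by
      ext g
      simp [MonoidAlgebra.star_coeff]
    have hzero : star (0 : MonoidAlgebra ℂ G) = 0 := by
      ext g
      simp [MonoidAlgebra.star_coeff]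
    induction f using MonoidAlgebra.induction_linear with
    | zero => simp [hzero]
    | add a b ha hb => simp [hadd, add_mul, mul_add, ha, hb]
    | single g c =>
      induction h using MonoidAlgebra.induction_linear with
      | zero => simp [hzero]
      | add a b ha hb => simp [hadd, add_mul, mul_add, ha, hb]
      | single g' c' =>
        simp only [MonoidAlgebra.single_mul_single, MonoidAlgebra.star_single', mul_inv_rev,
          star_mul]

instance : StarModule ℂ (MonoidAlgebra ℂ G) where
  star_smul c f := by
    ext g
    simp [MonoidAlgebra.star_coeff]

theorem CStarSeminorm.single_le_one (q : CStarSeminorm (MonoidAlgebra ℂ G)) (g : G) :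
    q.toSeminorm (MonoidAlgebra.single g 1) ≤ 1 := by
  have key : ∀ x : MonoidAlgebra ℂ G, star x * x = 1 → q.toSeminorm x * q.toSeminorm x =
      q.toSeminorm 1 := fun x hx => by
    rw [← hx]; exact (q.star_mul_self' x).symm
  have h1 := key 1 (by
    rw [MonoidAlgebra.one_def, MonoidAlgebra.star_single', MonoidAlgebra.single_mul_single]; simp)
  have h2 := key (MonoidAlgebra.single g 1) (by
    rw [MonoidAlgebra.one_def, MonoidAlgebra.star_single', MonoidAlgebra.single_mul_single]; simp)
  have h3 : 0 ≤ q.toSeminorm 1 := apply_nonneg _ _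
  have h4 : q.toSeminorm 1 ≤ 1 := by nlinarith
  nlinarith

variable (G) in
/-- The largest `C*`-seminorm on the group algebra `ℂ[G]`. -/
def groupMaxSeminorm : CStarSeminorm (MonoidAlgebra ℂ G) :=
  CStarSeminorm.iSup (fun q : CStarSeminorm (MonoidAlgebra ℂ G) => q) fun x => by
    induction x using MonoidAlgebra.induction_linear with
    | zero => exact ⟨0, by rintro _ ⟨q, rfl⟩; simp⟩
    | add a b ha hb =>
      obtain ⟨r, hr⟩ := ha
      obtain ⟨t, ht⟩ := hb
      refine ⟨r + t, ?_⟩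
      rintro _ ⟨q, rfl⟩
      exact (map_add_le_add q.toSeminorm a b).trans (add_le_add (hr ⟨q, rfl⟩) (ht ⟨q, rfl⟩))
    | single g c =>
      refine ⟨‖c‖, ?_⟩
      rintro _ ⟨q, rfl⟩
      have : MonoidAlgebra.single g c = c • (MonoidAlgebra.single g 1 : MonoidAlgebra ℂ G) := by
        simp
      simp only [this, map_smul_eq_mul]
      exact mul_le_of_le_one_right (norm_nonneg c) (q.single_le_one g)

variable (G) in
/-- The full group `C*`-algebra `C*(G)` of a discrete group: the completion of `ℂ[G]` in its
largest `C*`-seminorm. -/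
def GroupCStar : Type _ := (groupMaxSeminorm G).Completion

instance : NonUnitalCStarAlgebra (GroupCStar G) :=
  inferInstanceAs (NonUnitalCStarAlgebra (groupMaxSeminorm G).Completion)

namespace GroupCStar

variable (G) in
/-- The canonical map `ℂ[G] → C*(G)`, with dense range. -/
def incl : MonoidAlgebra ℂ G →⋆ₙₐ[ℂ] GroupCStar G := (groupMaxSeminorm G).of

theorem norm_incl (x : MonoidAlgebra ℂ G) : ‖incl G x‖ = (groupMaxSeminorm G).toSeminorm x :=
  (groupMaxSeminorm G).norm_of x

theorem denseRange_incl : DenseRange (incl G) := (groupMaxSeminorm G).denseRange_of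

/-- The canonical image of the group element `g` in `C*(G)`. -/
def elt (g : G) : GroupCStar G := incl G (MonoidAlgebra.single g 1)

theorem elt_mul (g h : G) : elt (g * h) = elt g * elt h := by
  rw [elt, elt, elt, ← map_mul, MonoidAlgebra.single_mul_single, one_mul]

theorem star_elt (g : G) : star (elt g) = elt g⁻¹ := by
  rw [elt, elt, ← StarHomClass.map_star, MonoidAlgebra.star_single', star_one]

/-- The linear extension of a map `u` on `G` to the group algebra. -/
def algLin {C : Type*} [NonUnitalCStarAlgebra C] (u : G → C) : MonoidAlgebra ℂ G →ₗ[ℂ] C where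
  toFun f := f.coeff.sum fun g c => c • u g
  map_smul' a f := by
    rw [MonoidAlgebra.coeff_smul, Finsupp.sum_smul_index (by simp)]
    simp [Finsupp.smul_sum, smul_smul]
  map_add' f h := by
    rw [MonoidAlgebra.coeff_add, Finsupp.sum_add_index' (by simp) (by simp [add_smul])]

theorem algLin_single {C : Type*} [NonUnitalCStarAlgebra C] (u : G → C) (g : G) (c : ℂ) :
    algLin u (MonoidAlgebra.single g c) = c • u g := by
  simp [algLin]

/-- A map `u` from `G` to a `C*`-algebra with `u (g h) = u g * u h` and `u g⁻¹ = (u g)*`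
extends to a `*`-homomorphism of the group algebra. -/
def algHom {C : Type*} [NonUnitalCStarAlgebra C] (u : G → C) (hmul : ∀ g h, u (g * h) = u g * u h)
    (hstar : ∀ g, u g⁻¹ = star (u g)) : MonoidAlgebra ℂ G →⋆ₙₐ[ℂ] C where
  toFun := algLin u
  map_smul' := map_smul (algLin u)
  map_zero' := map_zero (algLin u)
  map_add' := map_add (algLin u)
  map_mul' f h := by
    induction f using MonoidAlgebra.induction_linear with
    | zero => simp
    | add a b ha hb => simp [add_mul, ha, hb]
    | single g c =>
      induction h using MonoidAlgebra.induction_linear with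
      | zero => simp
      | add a b ha hb => simp [mul_add, ha, hb]
      | single g' c' =>
        simp [MonoidAlgebra.single_mul_single, algLin_single, hmul, smul_mul_smul_comm]
  map_star' f := by
    induction f using MonoidAlgebra.induction_linear with
    | zero => simp
    | add a b ha hb => simp [ha, hb]
    | single g c => simp [MonoidAlgebra.star_single', algLin_single, hstar]

theorem norm_le_max {C : Type*} [NonUnitalCStarAlgebra C] (f : MonoidAlgebra ℂ G →⋆ₙₐ[ℂ] C)
    (x : MonoidAlgebra ℂ G) : ‖f x‖ ≤ (groupMaxSeminorm G).toSeminorm x :=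
  CStarSeminorm.le_iSup (fun q : CStarSeminorm (MonoidAlgebra ℂ G) => q) _
    (CStarSeminorm.ofHom f) x

/-- The `*`-homomorphism of `C*(G)` induced by such a map. -/
def lift {C : Type*} [NonUnitalCStarAlgebra C] (u : G → C) (hmul : ∀ g h, u (g * h) = u g * u h)
    (hstar : ∀ g, u g⁻¹ = star (u g)) : GroupCStar G →⋆ₙₐ[ℂ] C :=
  (groupMaxSeminorm G).lift (algHom u hmul hstar) (norm_le_max _)

theorem lift_elt {C : Type*} [NonUnitalCStarAlgebra C] (u : G → C)
    (hmul : ∀ g h, u (g * h) = u g * u h) (hstar : ∀ g, u g⁻¹ = star (u g)) (g : G) :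
    lift u hmul hstar (elt g) = u g := by
  refine ((groupMaxSeminorm G).lift_of (algHom u hmul hstar) (norm_le_max _) _).trans ?_
  exact (algLin_single u g 1).trans (one_smul _ _)

end GroupCStar

end GroupAlgebra

/-! ### The minimal (spatial) tensor product -/

section MinTensor

/-- A `*`-representation of a `C*`-algebra on a Hilbert space. -/
structure HilbertRep (B : Type u) [NonUnitalCStarAlgebra B] : Type (u + 1) where
  space : Type u
  [normedAddCommGroup : NormedAddCommGroup space]
  [innerProductSpace : InnerProductSpace ℂ space]
  [completeSpace : CompleteSpace space]
  hom : B →⋆ₙₐ[ℂ] (space →L[ℂ] space)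

attribute [instance] HilbertRep.normedAddCommGroup HilbertRep.innerProductSpace
  HilbertRep.completeSpace

/-- Composition of a representation with a `*`-homomorphism. -/
def HilbertRep.comp {B B' : Type u} [NonUnitalCStarAlgebra B] [NonUnitalCStarAlgebra B']
    (π : HilbertRep B') (φ : B →⋆ₙₐ[ℂ] B') : HilbertRep B where
  space := π.space
  hom := π.hom.comp φ

variable {B : Type u} [NonUnitalCStarAlgebra B] {C : Type v} [NonUnitalCStarAlgebra C]

/-- The bounded operators on an inner product space. -/
abbrev BddOp (E : Type*) [NormedAddCommGroup E] [InnerProductSpace ℂ E] : Type _ := E →L[ℂ] E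

/-- The `C*`-seminorm `x ↦ ‖T x‖` of a representation `T` of a `*`-algebra by bounded operators
on an inner product space, with `T x*` the formal adjoint of `T x`. -/
def CStarSeminorm.ofOperators {X : Type*} [NonUnitalRing X] [StarRing X] [Module ℂ X]
    {E : Type*} [NormedAddCommGroup E] [InnerProductSpace ℂ E] (T : X →ₗ[ℂ] BddOp E)
    (hmul : ∀ x y, T (x * y) = T x * T y)
    (hstar : ∀ x (ξ η : E), ⟪T (star x) ξ, η⟫_ℂ = ⟪ξ, T x η⟫_ℂ) : CStarSeminorm X where
  toFun x := ‖T x‖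
  map_zero' := by simp
  add_le' x y := by simpa using norm_add_le (T x) (T y)
  neg' x := by simp
  smul' c x := by simp [norm_smul]
  mul_le' x y := by
    rw [hmul]
    exact norm_mul_le _ _
  star_mul_self' x := by
    have key : ∀ y : X, ‖T y‖ * ‖T y‖ ≤ ‖T (star y * y)‖ := fun y => by
      have h1 : ‖T y‖ ≤ √‖T (star y * y)‖ := by
        refine ContinuousLinearMap.opNorm_le_bound _ (Real.sqrt_nonneg _) fun ξ => ?_
        refine le_of_sq_le_sq ?_ (by positivity)
        rw [mul_pow, Real.sq_sqrt (norm_nonneg _), ← inner_self_eq_norm_sq (𝕜 := ℂ),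
          ← hstar, ← mul_apply_eq_comp, ← hmul, sq, ← mul_assoc]
        exact (re_inner_le_norm _ _).trans
          (mul_le_mul_of_nonneg_right (ContinuousLinearMap.le_opNorm _ _) (norm_nonneg _))
      calc _ ≤ √‖T (star y * y)‖ * √‖T (star y * y)‖ :=
            mul_le_mul h1 h1 (norm_nonneg _) (Real.sqrt_nonneg _)
        _ = _ := Real.mul_self_sqrt (norm_nonneg _)
    have hle : ∀ y : X, ‖T y‖ ≤ ‖T (star y)‖ := fun y => by
      have h1 := key y
      rw [hmul] at h1
      have h2 := h1.trans (norm_mul_le _ _)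
      by_contra h
      push Not at h
      nlinarith [norm_nonneg (T (star y))]
    refine le_antisymm ?_ (key x)
    rw [hmul]
    refine (norm_mul_le _ _).trans (mul_le_mul_of_nonneg_right ?_ (norm_nonneg _))
    simpa using hle (star x)

/-- The operator `S ⊗ T` on the algebraic tensor product of two inner product spaces. -/
def tensorOp {H K : Type*} [NormedAddCommGroup H] [InnerProductSpace ℂ H] [NormedAddCommGroup K]
    [InnerProductSpace ℂ K] (S : H →L[ℂ] H) (T : K →L[ℂ] K) : BddOp (H ⊗[ℂ] K) :=
  TensorProduct.mapL S T

/-- For representations `π` of `B` and `ρ` of `C`, the operators `(π ⊗ ρ)(x)` on the algebraic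
tensor product of the two Hilbert spaces, a dense subspace of their Hilbert space tensor product;
`b ⊗ c` acts as `π b ⊗ ρ c`. -/
def tensorRep (π : HilbertRep B) (ρ : HilbertRep C) :
    B ⊗[ℂ] C →ₗ[ℂ] BddOp (π.space ⊗[ℂ] ρ.space) :=
  TensorProduct.lift (LinearMap.mk₂ ℂ (fun b c => tensorOp (π.hom b) (ρ.hom c))
    (fun b b' c => by rw [map_add]; exact TensorProduct.mapL_add_left _ _ _)
    (fun r b c => by rw [map_smul]; exact TensorProduct.mapL_smul_left _ _ _)
    (fun b c c' => by rw [map_add]; exact TensorProduct.mapL_add_right _ _ _)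
    (fun r b c => by rw [map_smul]; exact TensorProduct.mapL_smul_right _ _ _))

theorem tensorRep_tmul (π : HilbertRep B) (ρ : HilbertRep C) (b : B) (c : C) :
    tensorRep π ρ (b ⊗ₜ c) = tensorOp (π.hom b) (ρ.hom c) := rfl

theorem tensorRep_mul (π : HilbertRep B) (ρ : HilbertRep C) (x y : B ⊗[ℂ] C) :
    tensorRep π ρ (x * y) = tensorRep π ρ x * tensorRep π ρ y := by
  induction x with
  | zero => simp
  | add a b ha hb => simp [add_mul, ha, hb]
  | tmul b c =>
    induction y with
    | zero => simp
    | add a b ha hb => simp [mul_add, ha, hb]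
    | tmul b' c' =>
      rw [Algebra.TensorProduct.tmul_mul_tmul, tensorRep_tmul, tensorRep_tmul, tensorRep_tmul,
        map_mul, map_mul]
      exact TensorProduct.mapL_mul _ _ _ _

theorem tensorRep_star (π : HilbertRep B) (ρ : HilbertRep C) (x : B ⊗[ℂ] C)
    (ξ η : π.space ⊗[ℂ] ρ.space) :
    ⟪tensorRep π ρ (star x) ξ, η⟫_ℂ = ⟪ξ, tensorRep π ρ x η⟫_ℂ := by
  induction x with
  | zero => simp
  | add a b ha hb => simp [inner_add_left, inner_add_right, ha, hb]
  | tmul b c =>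
    induction ξ with
    | zero => simp
    | add a b ha hb => simp only [map_add, inner_add_left, ha, hb]
    | tmul h k =>
      induction η with
      | zero => simp
      | add a b ha hb => simp only [map_add, inner_add_right, ha, hb]
      | tmul h' k' =>
        simp [tensorRep_tmul, tensorOp, StarHomClass.map_star, ContinuousLinearMap.star_eq_adjoint,
          ContinuousLinearMap.adjoint_inner_left]

instance : StarRing (B ⊗[ℂ] C) where
  star_add := star_add
  star_mul x y := by
    induction x with
    | zero => simp
    | add a b ha hb => simp [add_mul, mul_add, ha, hb]
    | tmul b c =>
      induction y with
      | zero => simp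
      | add a b ha hb => simp [add_mul, mul_add, ha, hb]
      | tmul b' c' => simp

/-- The `C*`-seminorm `x ↦ ‖(π ⊗ ρ)(x)‖` on the algebraic tensor product. -/
def tensorRepSeminorm (π : HilbertRep B) (ρ : HilbertRep C) : CStarSeminorm (B ⊗[ℂ] C) :=
  CStarSeminorm.ofOperators (tensorRep π ρ) (tensorRep_mul π ρ) (tensorRep_star π ρ)

variable (B C) in
/-- The minimal `C*`-norm on the algebraic tensor product: the supremum of `‖(π ⊗ ρ)(x)‖` over
all representations `π` of `B` and `ρ` of `C`. -/
def minSeminorm : CStarSeminorm (B ⊗[ℂ] C) :=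
  CStarSeminorm.iSup (fun i : HilbertRep B × HilbertRep C => tensorRepSeminorm i.1 i.2) fun x => by
    induction x with
    | zero => exact ⟨0, by rintro _ ⟨q, rfl⟩; simp⟩
    | add a b ha hb =>
      obtain ⟨r, hr⟩ := ha
      obtain ⟨t, ht⟩ := hb
      refine ⟨r + t, ?_⟩
      rintro _ ⟨q, rfl⟩
      exact (map_add_le_add (tensorRepSeminorm q.1 q.2).toSeminorm a b).trans
        (add_le_add (hr ⟨q, rfl⟩) (ht ⟨q, rfl⟩))
    | tmul b c =>
      refine ⟨‖b‖ * ‖c‖, ?_⟩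
      rintro _ ⟨q, rfl⟩
      exact (TensorProduct.norm_mapL_le _ _).trans (mul_le_mul
        (NonUnitalStarAlgHom.norm_apply_le q.1.hom b) (NonUnitalStarAlgHom.norm_apply_le q.2.hom c)
        (norm_nonneg _) (norm_nonneg _))

variable (B C) in
/-- The minimal (spatial) tensor product `B ⊗ C` of two `C*`-algebras. -/
def MinTensor : Type _ := (minSeminorm B C).Completion

instance : NonUnitalCStarAlgebra (MinTensor B C) :=
  inferInstanceAs (NonUnitalCStarAlgebra (minSeminorm B C).Completion)

namespace MinTensor

variable (B C) in
/-- The canonical map from the algebraic tensor product, with dense range. -/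
def incl : B ⊗[ℂ] C →⋆ₙₐ[ℂ] MinTensor B C := (minSeminorm B C).of

theorem norm_incl (x : B ⊗[ℂ] C) : ‖incl B C x‖ = (minSeminorm B C).toSeminorm x :=
  (minSeminorm B C).norm_of x

theorem denseRange_incl : DenseRange (incl B C) := (minSeminorm B C).denseRange_of

/-- A `*`-homomorphism that is contractive for the minimal norm extends to `B ⊗ C`. -/
def lift {E : Type*} [NonUnitalCStarAlgebra E] (f : B ⊗[ℂ] C →⋆ₙₐ[ℂ] E)
    (hf : ∀ x, ‖f x‖ ≤ (minSeminorm B C).toSeminorm x) : MinTensor B C →⋆ₙₐ[ℂ] E :=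
  (minSeminorm B C).lift f hf

theorem lift_incl {E : Type*} [NonUnitalCStarAlgebra E] (f : B ⊗[ℂ] C →⋆ₙₐ[ℂ] E)
    (hf : ∀ x, ‖f x‖ ≤ (minSeminorm B C).toSeminorm x) (x : B ⊗[ℂ] C) :
    lift f hf (incl B C x) = f x := (minSeminorm B C).lift_of f hf x

/-- The elementary tensor `b ⊗ c`. -/
def tmul (b : B) (c : C) : MinTensor B C := incl B C (b ⊗ₜ c)

theorem tmul_mul_tmul (b b' : B) (c c' : C) :
    tmul b c * tmul b' c' = tmul (b * b') (c * c') := by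
  rw [tmul, tmul, tmul, ← map_mul, Algebra.TensorProduct.tmul_mul_tmul]

theorem star_tmul (b : B) (c : C) : star (tmul b c) = tmul (star b) (star c) := by
  rw [tmul, tmul, ← StarHomClass.map_star, TensorProduct.star_tmul]

theorem tmul_add_left (b b' : B) (c : C) : tmul (b + b') c = tmul b c + tmul b' c := by
  rw [tmul, TensorProduct.add_tmul, map_add]; rfl

theorem tmul_smul_left (r : ℂ) (b : B) (c : C) : tmul (r • b) c = r • tmul b c := by
  rw [tmul, ← TensorProduct.smul_tmul', map_smul]; rfl

theorem norm_tmul_le (b : B) (c : C) : ‖tmul b c‖ ≤ ‖b‖ * ‖c‖ := by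
  rw [tmul, norm_incl]
  refine CStarSeminorm.iSup_le _ _ _ (by positivity) fun q => ?_
  exact (TensorProduct.norm_mapL_le _ _).trans (mul_le_mul
    (NonUnitalStarAlgHom.norm_apply_le q.1.hom b) (NonUnitalStarAlgHom.norm_apply_le q.2.hom c)
    (norm_nonneg _) (norm_nonneg _))

variable {B' : Type u} [NonUnitalCStarAlgebra B'] {C' : Type v} [NonUnitalCStarAlgebra C']

/-- The algebraic tensor product of two `*`-homomorphisms. -/
def algMap (φ : B →⋆ₙₐ[ℂ] B') (ψ : C →⋆ₙₐ[ℂ] C') : B ⊗[ℂ] C →⋆ₙₐ[ℂ] B' ⊗[ℂ] C' where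
  toFun := TensorProduct.map (φ : B →ₗ[ℂ] B') (ψ : C →ₗ[ℂ] C')
  map_smul' := map_smul _
  map_zero' := map_zero _
  map_add' := map_add _
  map_mul' x y := by
    induction x with
    | zero => simp
    | add a b ha hb => simp [add_mul, ha, hb]
    | tmul b c =>
      induction y with
      | zero => simp
      | add a b ha hb => simp [mul_add, ha, hb]
      | tmul b' c' => simp
  map_star' x := by
    induction x with
    | zero => simp
    | add a b ha hb => simp [ha, hb]
    | tmul b c => simp [StarHomClass.map_star]

theorem tensorRep_algMap (φ : B →⋆ₙₐ[ℂ] B') (ψ : C →⋆ₙₐ[ℂ] C') (π : HilbertRep B')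
    (ρ : HilbertRep C') (x : B ⊗[ℂ] C) :
    tensorRep π ρ (algMap φ ψ x) = tensorRep (π.comp φ) (ρ.comp ψ) x := by
  induction x with
  | zero => rw [map_zero, map_zero, map_zero]; rfl
  | add a b ha hb => rw [map_add, map_add, map_add, ha, hb]; rfl
  | tmul b c => rfl

theorem norm_algMap_le (φ : B →⋆ₙₐ[ℂ] B') (ψ : C →⋆ₙₐ[ℂ] C') (x : B ⊗[ℂ] C) :
    ‖(incl B' C').comp (algMap φ ψ) x‖ ≤ (minSeminorm B C).toSeminorm x := by
  change ‖(incl B' C') (algMap φ ψ x)‖ ≤ _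
  rw [norm_incl]
  refine CStarSeminorm.iSup_le _ _ _ (apply_nonneg _ _) fun q => ?_
  change ‖tensorRep q.1 q.2 (algMap φ ψ x)‖ ≤ _
  rw [tensorRep_algMap]
  exact CStarSeminorm.le_iSup
    (fun i : HilbertRep B × HilbertRep C => tensorRepSeminorm i.1 i.2) _
    (q.1.comp φ, q.2.comp ψ) x

/-- The tensor product `φ ⊗ ψ` of two `*`-homomorphisms. -/
def map (φ : B →⋆ₙₐ[ℂ] B') (ψ : C →⋆ₙₐ[ℂ] C') : MinTensor B C →⋆ₙₐ[ℂ] MinTensor B' C' :=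
  lift ((incl B' C').comp (algMap φ ψ)) (norm_algMap_le φ ψ)

theorem map_tmul (φ : B →⋆ₙₐ[ℂ] B') (ψ : C →⋆ₙₐ[ℂ] C') (b : B) (c : C) :
    map φ ψ (tmul b c) = tmul (φ b) (ψ c) := by
  rw [map, tmul, lift_incl]; rfl

/-- The graph of the canonical isomorphism `(B ⊗ C) ⊗ D ≅ B ⊗ (C ⊗ D)`: the closed linear span
of the pairs `((b ⊗ c) ⊗ d, b ⊗ (c ⊗ d))`. -/
def assocGraph (B : Type u) [NonUnitalCStarAlgebra B] (C D : Type v) [NonUnitalCStarAlgebra C]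
    [NonUnitalCStarAlgebra D] :
    Submodule ℂ (MinTensor (MinTensor B C) D × MinTensor B (MinTensor C D)) :=
  (Submodule.span ℂ {z | ∃ (b : B) (c : C) (d : D),
    z = (tmul (tmul b c) d, tmul b (tmul c d))}).topologicalClosure

end MinTensor

end MinTensor

/-! ### Translations on `ℓ²(G, H)` and the regular representation of `C*(G)` -/

section Regular

variable {G : Type*} [Group G] {H : Type*} [NormedAddCommGroup H] [InnerProductSpace ℂ H]

/-- The left translation `(λ_s ξ)(t) = ξ (s⁻¹ t)` on `ℓ²(G, H)`. -/
def leftShift (H : Type*) [NormedAddCommGroup H] [InnerProductSpace ℂ H] (s : G) :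
    lp (fun _ : G => H) 2 →L[ℂ] lp (fun _ : G => H) 2 :=
  LinearMap.mkContinuous
    { toFun := fun ξ => ⟨fun t => ξ (s⁻¹ * t), by
        have h := (memℓp_gen_iff (by norm_num)).1 (lp.memℓp ξ)
        exact memℓp_gen (h.comp_injective (mul_right_injective s⁻¹))⟩
      map_add' := fun ξ η => by ext t; rfl
      map_smul' := fun c ξ => by ext t; rfl }
    1 fun ξ => by
      rw [one_mul, lp.norm_eq_tsum_rpow (by norm_num), lp.norm_eq_tsum_rpow (by norm_num)]
      exact le_of_eq (congrArg (fun r : ℝ => r ^ (1 / (2 : ℝ≥0∞).toReal))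
        ((Equiv.mulLeft s⁻¹).tsum_eq fun t => ‖ξ t‖ ^ (2 : ℝ≥0∞).toReal))

theorem leftShift_apply (s : G) (ξ : lp (fun _ : G => H) 2) (t : G) :
    leftShift H s ξ t = ξ (s⁻¹ * t) := rfl

theorem leftShift_mul (s t : G) : leftShift H (s * t) = leftShift H s * leftShift H t := by
  ext ξ r
  rw [mul_apply_eq_comp, leftShift_apply, leftShift_apply, leftShift_apply, mul_inv_rev, mul_assoc]

theorem leftShift_inv [CompleteSpace H] (s : G) : leftShift H s⁻¹ = star (leftShift H s) := by
  rw [ContinuousLinearMap.star_eq_adjoint, ContinuousLinearMap.eq_adjoint_iff]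
  intro ξ η
  rw [lp.inner_eq_tsum, lp.inner_eq_tsum]
  rw [← (Equiv.mulLeft s⁻¹).tsum_eq]
  refine tsum_congr fun t => ?_
  simp [leftShift_apply]

/-- The left regular representation `λ` of `C*(G)` on `ℓ²(G)`. -/
def GroupCStar.regular (G : Type*) [Group G] :
    GroupCStar G →⋆ₙₐ[ℂ] (lp (fun _ : G => ℂ) 2 →L[ℂ] lp (fun _ : G => ℂ) 2) :=
  GroupCStar.lift (leftShift ℂ) leftShift_mul leftShift_inv

/-- The comultiplication `δ_G : C*(G) → C*(G) ⊗ C*(G)`, determined by `g ↦ g ⊗ g`. -/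
def GroupCStar.comul (G : Type*) [Group G] :
    GroupCStar G →⋆ₙₐ[ℂ] MinTensor (GroupCStar G) (GroupCStar G) :=
  GroupCStar.lift (fun g => MinTensor.tmul (GroupCStar.elt g) (GroupCStar.elt g))
    (fun g h => by rw [MinTensor.tmul_mul_tmul, GroupCStar.elt_mul])
    (fun g => by rw [MinTensor.star_tmul, GroupCStar.star_elt])

end Regular

/-! ### Coactions -/

/-- A coaction of the discrete group `G` on the `C*`-algebra `B`: an injective nondegenerate
`*`-homomorphism `δ : B → B ⊗ C*(G)` with `(δ ⊗ ι) ∘ δ = (ι ⊗ δ_G) ∘ δ`, where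
`(B ⊗ C*(G)) ⊗ C*(G)` and `B ⊗ (C*(G) ⊗ C*(G))` are identified in the canonical way. -/
structure Coaction (G : Type) [Group G] (B : Type u) [NonUnitalCStarAlgebra B] where
  hom : B →⋆ₙₐ[ℂ] MinTensor B (GroupCStar G)
  injective : Function.Injective hom
  nondegenerate : (Submodule.span ℂ {z | ∃ (b : B) (x : MinTensor B (GroupCStar G)),
    z = hom b * x}).topologicalClosure = ⊤
  coassoc : ∀ b : B,
    (MinTensor.map hom (NonUnitalStarAlgHom.id ℂ (GroupCStar G)) (hom b),
      MinTensor.map (NonUnitalStarAlgHom.id ℂ B) (GroupCStar.comul G) (hom b)) ∈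
    MinTensor.assocGraph B (GroupCStar G) (GroupCStar G)

namespace Coaction

variable {G : Type} [Group G] {B : Type u} [NonUnitalCStarAlgebra B] (δ : Coaction G B)

/-- The coaction `δ` is normal if `(ι ⊗ λ) ∘ δ` is faithful. -/
def IsNormal : Prop :=
  Function.Injective fun b : B =>
    MinTensor.map (NonUnitalStarAlgHom.id ℂ B) (GroupCStar.regular G) (δ.hom b)

/-- The spectral subspace `B_s = {b | δ b = b ⊗ s}`. -/
def spectral (s : G) : Submodule ℂ B where
  carrier := {b | δ.hom b = MinTensor.tmul b (GroupCStar.elt s)}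
  zero_mem' := by
    have := MinTensor.tmul_smul_left (0 : ℂ) (0 : B) (GroupCStar.elt s)
    simp only [zero_smul] at this
    simp [this]
  add_mem' {b c} hb hc := by
    change δ.hom (b + c) = _
    rw [map_add, MinTensor.tmul_add_left, hb, hc]
  smul_mem' r b hb := by
    change δ.hom (r • b) = _
    rw [map_smul, MinTensor.tmul_smul_left, hb]

theorem mem_spectral {s : G} {b : B} :
    b ∈ δ.spectral s ↔ δ.hom b = MinTensor.tmul b (GroupCStar.elt s) := Iff.rfl

/-- `D_s = B_s B_s*`, the closed linear span of the products `b c*` with `b, c ∈ B_s`. -/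
def ideal (s : G) : Submodule ℂ B :=
  (Submodule.span ℂ {d | ∃ b ∈ δ.spectral s, ∃ c ∈ δ.spectral s, d = b * star c}).topologicalClosure

theorem isClosed_spectral (s : G) : IsClosed (δ.spectral s : Set B) := by
  have h1 : Continuous δ.hom := AddMonoidHomClass.continuous_of_bound δ.hom 1
    fun b => by simpa using NonUnitalStarAlgHom.norm_apply_le δ.hom b
  have h2 : Continuous fun b : B => MinTensor.tmul b (GroupCStar.elt s) := by
    refine (LinearMap.mkContinuous
      ({ toFun := fun b => MinTensor.tmul b (GroupCStar.elt s)
         map_add' := fun b c => MinTensor.tmul_add_left b c _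
         map_smul' := fun r b => MinTensor.tmul_smul_left r b _ } :
        B →ₗ[ℂ] MinTensor B (GroupCStar G)) ‖(GroupCStar.elt s : GroupCStar G)‖ fun b => ?_).continuous
    rw [mul_comm]
    exact MinTensor.norm_tmul_le b _
  exact isClosed_eq h1 h2

theorem ideal_mul_spectral {s : G} {d x : B} (hd : d ∈ δ.ideal s) (hx : x ∈ δ.spectral s) :
    d * x ∈ δ.spectral s := by
  have hcl : IsClosed {d : B | d * x ∈ δ.spectral s} :=
    (δ.isClosed_spectral s).preimage (continuous_id.mul continuous_const)
  refine closure_minimal ?_ hcl hd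
  intro d hd
  change d * x ∈ δ.spectral s
  induction hd using Submodule.span_induction with
  | mem d h =>
    obtain ⟨b, hb, c, hc, rfl⟩ := h
    rw [mem_spectral] at *
    rw [map_mul, map_mul, StarHomClass.map_star, hb, hc, hx, MinTensor.star_tmul,
      MinTensor.tmul_mul_tmul, MinTensor.tmul_mul_tmul, GroupCStar.star_elt,
      ← GroupCStar.elt_mul, ← GroupCStar.elt_mul]
    simp
  | zero => simp
  | add a b _ _ ha hb => rw [add_mul]; exact add_mem ha hb
  | smul r a _ ha => rw [smul_mul_assoc]; exact Submodule.smul_mem _ _ ha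

end Coaction

/-! ### The universal representation and the double dual -/

section Universal

variable (B : Type u) [NonUnitalCStarAlgebra B]

/-- The positive linear functionals on a `C*`-algebra with its usual order. -/
def PosFunctional : Type u :=
  letI := CStarAlgebra.spectralOrder B
  B →ₚ[ℂ] ℂ

variable {B}

/-- The GNS representation of a positive functional. -/
def PosFunctional.gns (f : PosFunctional B) : HilbertRep B :=
  letI := CStarAlgebra.spectralOrder B
  letI := CStarAlgebra.spectralOrderedRing B
  let g : B →ₚ[ℂ] ℂ := f
  { space := g.GNS
    hom := g.gnsNonUnitalStarAlgHom }

variable (B) in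
/-- The Hilbert space of the universal representation: the Hilbert space direct sum of the GNS
spaces of all positive functionals. -/
abbrev UnivSpace : Type u := lp (fun f : PosFunctional B => f.gns.space) 2

/-- The operator by which `b` acts in the universal representation. -/
def univOp (b : B) : UnivSpace B →L[ℂ] UnivSpace B :=
  lp.mapCLM 2 (fun f : PosFunctional B => f.gns.hom b) (norm_nonneg b)
    fun f => NonUnitalStarAlgHom.norm_apply_le f.gns.hom b

theorem univOp_apply (b : B) (ξ : UnivSpace B) (f : PosFunctional B) :
    univOp b ξ f = f.gns.hom b (ξ f) := rfl

variable (B) in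
/-- The universal representation of `B`, the direct sum of all its GNS representations. -/
def universalRep : HilbertRep B where
  space := UnivSpace B
  hom :=
    { toFun := univOp
      map_smul' := fun c b => by
        ext ξ f
        rw [univOp_apply, map_smul]; rfl
      map_zero' := by
        ext ξ f
        rw [univOp_apply, map_zero]; rfl
      map_add' := fun b c => by
        ext ξ f
        rw [univOp_apply, map_add]; rfl
      map_mul' := fun b c => by
        ext ξ f
        rw [univOp_apply, map_mul]; rfl
      map_star' := fun b => by
        rw [ContinuousLinearMap.star_eq_adjoint, ContinuousLinearMap.eq_adjoint_iff]
        intro ξ η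
        rw [lp.inner_eq_tsum, lp.inner_eq_tsum]
        refine tsum_congr fun f => ?_
        rw [univOp_apply, univOp_apply, StarHomClass.map_star,
          ContinuousLinearMap.star_eq_adjoint, ContinuousLinearMap.adjoint_inner_left] }

variable (B) in
/-- The double dual `B**`, realised as the enveloping von Neumann algebra of `B`: the bicommutant
of `B` in its universal representation. -/
def doubleDual : Set ((universalRep B).space →L[ℂ] (universalRep B).space) :=
  Set.centralizer (Set.centralizer (Set.range (universalRep B).hom))

/-- For a `C*`-subalgebra `D` of `B`, the identity of `D**`, seen as a projection in `B**`: it is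
the projection onto the closed linear span of the vectors `d ξ` with `d ∈ D`. -/
def unitProj (D : Submodule ℂ B) : (universalRep B).space →L[ℂ] (universalRep B).space :=
  (Submodule.span ℂ {η | ∃ d ∈ D, ∃ ξ : (universalRep B).space,
    η = (universalRep B).hom d ξ}).topologicalClosure.starProjection

end Universal

namespace Coaction

variable {G : Type} [Group G] {B : Type u} [NonUnitalCStarAlgebra B] (δ : Coaction G B)

/-- The projection `p_s ∈ B**`, the identity of `D_s**`. -/
def proj (s : G) : (universalRep B).space →L[ℂ] (universalRep B).space := unitProj (δ.ideal s)

/-- The multiplier bimodule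
`M(B_s) = {m ∈ p_s B** p_{s⁻¹} | D_s m ⊆ B_s and m D_{s⁻¹} ⊆ B_s}`. -/
def multipliers (s : G) : Set ((universalRep B).space →L[ℂ] (universalRep B).space) :=
  {m | (∃ x ∈ doubleDual B, m = δ.proj s * x * δ.proj s⁻¹) ∧
    (∀ d ∈ δ.ideal s, ∃ b ∈ δ.spectral s, (universalRep B).hom d * m = (universalRep B).hom b) ∧
    ∀ d ∈ δ.ideal s⁻¹, ∃ b ∈ δ.spectral s, m * (universalRep B).hom d = (universalRep B).hom b}

/-- There is `m ∈ M(B_s)` with `m m* = p_s` and `m* m = p_{s⁻¹}`. -/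
def HasUnitaryMultiplier (s : G) : Prop :=
  ∃ m ∈ δ.multipliers s, m * star m = δ.proj s ∧ star m * m = δ.proj s⁻¹

/-- There is an isomorphism `ψ : B_s → D_s` of left Hilbert `D_s`-modules, where the inner product
is `⟨x, y⟩ = x y*` on both sides. -/
def HasModuleIso (s : G) : Prop :=
  ∃ ψ : δ.spectral s ≃ₗ[ℂ] δ.ideal s,
    (∀ (d : δ.ideal s) (x : δ.spectral s),
      (ψ ⟨(d : B) * (x : B), δ.ideal_mul_spectral d.2 x.2⟩ : B) = (d : B) * (ψ x : B)) ∧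
    ∀ x y : δ.spectral s, (ψ x : B) * star (ψ y : B) = (x : B) * star (y : B)

end Coaction

/-! ### Extending representations of ideals -/

section IdealExtension

variable {A : Type*} [NonUnitalCStarAlgebra A] {H : Type*} [NormedAddCommGroup H]
  [InnerProductSpace ℂ H] [CompleteSpace H] (D : NonUnitalStarSubalgebra ℂ A)
  (hleft : ∀ a, ∀ d ∈ D, a * d ∈ D) (σ : D →⋆ₙₐ[ℂ] (H →L[ℂ] H))

/-- The map `d ⊗ h ↦ σ(d) h`. -/
def idealAct : D ⊗[ℂ] H →ₗ[ℂ] H :=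
  TensorProduct.lift (LinearMap.mk₂ ℂ (fun d h => σ d h)
    (fun d d' h => by rw [map_add]; rfl) (fun r d h => by rw [map_smul]; rfl)
    (fun d h h' => map_add _ _ _) (fun r d h => map_smul _ _ _))

/-- The map `d ⊗ h ↦ σ(a d) h`. -/
def idealActMul (a : A) : D ⊗[ℂ] H →ₗ[ℂ] H :=
  TensorProduct.lift (LinearMap.mk₂ ℂ (fun d h => σ ⟨a * d, hleft a d d.2⟩ h)
    (fun d d' h => by
      rw [← add_apply, ← map_add]
      congr 2
      exact Subtype.ext (mul_add a (d : A) d'))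
    (fun r d h => by
      rw [← smul_apply, ← map_smul]
      congr 2
      exact Subtype.ext (mul_smul_comm r a (d : A)))
    (fun d h h' => map_add _ _ _) (fun r d h => map_smul _ _ _))

theorem norm_idealActMul_le (hD : IsClosed (D : Set A)) (a : A) (x : D ⊗[ℂ] H) :
    ‖idealActMul D hleft σ a x‖ ≤ ‖a‖ * ‖idealAct D σ x‖ := by
  have := hD
  let := CStarAlgebra.spectralOrder D
  let := CStarAlgebra.spectralOrderedRing D
  have hl := CStarAlgebra.increasingApproximateUnit (A := D)
  have := hl.neBot
  have hσ : Continuous σ := AddMonoidHomClass.continuous_of_bound σ 1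
    fun b => by simpa using NonUnitalStarAlgHom.norm_apply_le σ b
  have hlim : Filter.Tendsto (fun e : D => σ ⟨a * e, hleft a e e.2⟩ (idealAct D σ x))
      (CStarAlgebra.approximateUnit D) (nhds (idealActMul D hleft σ a x)) := by
    induction x with
    | zero => simp
    | add y z hy hz => simpa only [map_add] using hy.add hz
    | tmul d h =>
      have h1 := hl.tendsto_mul_right d
      have h2 : Continuous fun e : D => σ ⟨a * e, hleft a e e.2⟩ h := by
        have : Continuous fun e : D => (⟨a * e, hleft a e e.2⟩ : D) :=
          Continuous.subtype_mk (continuous_const.mul continuous_subtype_val) _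
        exact (hσ.comp this).clm_apply continuous_const
      refine ((h2.tendsto d).comp h1).congr fun e => ?_
      change _ = σ ⟨a * e, hleft a e e.2⟩ (σ d h)
      rw [← mul_apply_eq_comp, ← map_mul]
      have h3 : (⟨a * (e * d : D), hleft a _ (e * d).2⟩ : D) = ⟨a * e, hleft a e e.2⟩ * d :=
        Subtype.ext (mul_assoc a (e : A) d).symm
      rw [← h3]
      rfl
  refine le_of_tendsto hlim.norm (hl.eventually_norm.mono fun e he => ?_)
  refine (ContinuousLinearMap.le_opNorm _ _).trans
    (mul_le_mul_of_nonneg_right ?_ (norm_nonneg _))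
  refine (NonUnitalStarAlgHom.norm_apply_le σ _).trans ?_
  refine (norm_mul_le a (e : A)).trans ?_
  exact mul_le_of_le_one_right (norm_nonneg a) he

/-- The essential subspace of `σ`, the closed linear span of the vectors `σ(d) h`. -/
def essentialSpace : Submodule ℂ H := (LinearMap.range (idealAct D σ)).topologicalClosure

instance : CompleteSpace (essentialSpace D σ) :=
  (Submodule.isClosed_topologicalClosure _).completeSpace_coe

/-- The map `d ⊗ h ↦ σ(d) h` into the essential subspace. -/
def idealActEss : D ⊗[ℂ] H →ₗ[ℂ] essentialSpace D σ :=
  (idealAct D σ).codRestrict _ fun x =>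
    Submodule.le_topologicalClosure _ (LinearMap.mem_range_self _ x)

theorem denseRange_idealActEss : DenseRange (idealActEss D σ) := by
  intro ⟨y, hy⟩
  rw [closure_subtype]
  have : (Subtype.val '' Set.range (idealActEss D σ)) = Set.range (idealAct D σ) := by
    rw [← Set.range_comp]; rfl
  rw [this]
  exact hy

/-- The canonical extension `σ̄` to `A` of a representation `σ` of a closed ideal `D` of `A`:
`σ̄(a) σ(d) h = σ(a d) h` for `d ∈ D`, and `σ̄(a)` vanishes on the orthogonal complement of the
essential subspace of `σ`. -/
def idealExt (a : A) : H →L[ℂ] H :=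
  (idealActMul D hleft σ a).extendOfNorm (idealActEss D σ) ∘L
    (essentialSpace D σ).orthogonalProjectionOnto

theorem idealExt_apply (hD : IsClosed (D : Set A)) (a : A) (d : D) (h : H) :
    idealExt D hleft σ a (σ d h) = σ ⟨a * d, hleft a d d.2⟩ h := by
  have h1 : (essentialSpace D σ).orthogonalProjectionOnto (σ d h) = idealActEss D σ (d ⊗ₜ h) :=
    (essentialSpace D σ).orthogonalProjectionOnto_mem_subspace_eq_self (idealActEss D σ (d ⊗ₜ h))
  rw [idealExt, ContinuousLinearMap.comp_apply, h1,
    LinearMap.extendOfNorm_eq (denseRange_idealActEss D σ)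
      ⟨‖a‖, norm_idealActMul_le D hleft σ hD a⟩]
  rfl

theorem norm_idealExt_le (hD : IsClosed (D : Set A)) (a : A) : ‖idealExt D hleft σ a‖ ≤ ‖a‖ := by
  refine ContinuousLinearMap.opNorm_le_bound _ (norm_nonneg a) fun x => ?_
  refine (LinearMap.norm_extendOfNorm_apply_le (denseRange_idealActEss D σ) ‖a‖
    (norm_idealActMul_le D hleft σ hD a) _).trans ?_
  exact mul_le_mul_of_nonneg_left (Submodule.norm_orthogonalProjectionOnto_apply_le _ x)
    (norm_nonneg a)

end IdealExtension

/-! ### Partial actions and their reduced crossed products -/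

section PartialAction

/-- A partial action of the discrete group `G` on the `C*`-algebra `A`: closed ideals `D_s` and
isomorphisms `α_s : D_{s⁻¹} → D_s` such that `D_e = A` and `α_{st}` extends `α_s α_t`. -/
structure PartialAction (G : Type) [Group G] (A : Type u) [NonUnitalCStarAlgebra A] where
  ideal : G → NonUnitalStarSubalgebra ℂ A
  isClosed : ∀ s, IsClosed (ideal s : Set A)
  mul_mem_left : ∀ s a, ∀ d ∈ ideal s, a * d ∈ ideal s
  mul_mem_right : ∀ s a, ∀ d ∈ ideal s, d * a ∈ ideal s
  equiv : ∀ s, ideal s⁻¹ ≃⋆ₐ[ℂ] ideal s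
  ideal_one : ideal 1 = ⊤
  extend : ∀ s t (x : ideal t⁻¹) (h : (equiv t x : A) ∈ ideal s⁻¹),
    ∃ h' : (x : A) ∈ ideal (s * t)⁻¹, (equiv (s * t) ⟨x, h'⟩ : A) = equiv s ⟨equiv t x, h⟩

namespace PartialAction

variable {G : Type} [Group G] {A : Type u} [NonUnitalCStarAlgebra A] (α : PartialAction G A)

/-- `α_s` as a partial map of `A` with domain `D_{s⁻¹}`. -/
def pmap (s : G) : A →. A := fun x => ⟨x ∈ α.ideal s⁻¹, fun h => (α.equiv s ⟨x, h⟩ : A)⟩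

/-- The representation `π ∘ α_{t⁻¹}` of `D_t`. -/
def twist (π : HilbertRep A) (t : G) : α.ideal t →⋆ₙₐ[ℂ] (π.space →L[ℂ] π.space) :=
  π.hom.comp ((NonUnitalStarSubalgebraClass.subtype (α.ideal t⁻¹)).comp
    ((α.equiv t).symm : α.ideal t →⋆ₙₐ[ℂ] α.ideal t⁻¹))

/-- The operator `∑_t ᾱ_{t⁻¹}(a) ⊗ χ_t λ_s` on `H ⊗ ℓ²(G) = ℓ²(G, H)`, that is
`ξ ↦ (t ↦ ᾱ_{t⁻¹}(a) ξ(s⁻¹ t))`. -/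
def regOp (π : HilbertRep A) (a : A) (s : G) :
    lp (fun _ : G => π.space) 2 →L[ℂ] lp (fun _ : G => π.space) 2 :=
  lp.mapCLM 2 (fun t => idealExt (α.ideal t) (α.mul_mem_left t) (α.twist π t) a) (norm_nonneg a)
    (fun t => norm_idealExt_le _ _ _ (α.isClosed t) a) ∘L leftShift π.space s

/-- The `C*`-algebra `C*(π^r, u^r)` of the regular representation induced by `π`, generated by
the operators `∑_t ᾱ_{t⁻¹}(a) ⊗ χ_t λ_s` with `a ∈ D_s`. -/
def regAlgebra (π : HilbertRep A) :
    NonUnitalStarSubalgebra ℂ (lp (fun _ : G => π.space) 2 →L[ℂ] lp (fun _ : G => π.space) 2) :=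
  (NonUnitalStarAlgebra.adjoin ℂ
    {T | ∃ (s : G), ∃ a ∈ α.ideal s, T = α.regOp π a s}).topologicalClosure

/-- The reduced crossed product `A ×_{α,r} G`, built on the universal representation of `A`
(a faithful and nondegenerate one). -/
def ReducedCrossedProduct : Type u := α.regAlgebra (universalRep A)

instance : NonUnitalCStarAlgebra α.ReducedCrossedProduct :=
  NonUnitalStarSubalgebra.nonUnitalCStarAlgebra (α.regAlgebra (universalRep A))
    (h_closed := NonUnitalStarSubalgebra.isClosed_topologicalClosure _)

/-- The canonical generator `a m_s` of the reduced crossed product, for `a ∈ D_s`. -/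
def gen (s : G) (a : α.ideal s) : α.ReducedCrossedProduct :=
  ⟨α.regOp (universalRep A) a s, NonUnitalStarSubalgebra.le_topologicalClosure _
    (NonUnitalStarAlgebra.subset_adjoin ℂ _ ⟨s, a, a.2, rfl⟩)⟩

/-- `ε` is the normalised dual coaction of `G` on the reduced crossed product, which is the unique
coaction with `a m_s ↦ a m_s ⊗ s` for `a ∈ D_s`. -/
def IsNormalisedDual (ε : Coaction G α.ReducedCrossedProduct) : Prop :=
  ∀ (s : G) (a : α.ideal s),
    ε.hom (α.gen s a) = MinTensor.tmul (α.gen s a) (GroupCStar.elt s)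

end PartialAction

/-- A partial action of the free group is multiplicative if `α_{s_1 ⋯ s_k} = α_{s_1} ∘ ⋯ ∘ α_{s_k}`,
as partial maps, for every reduced word `s_1 ⋯ s_k` in the generators and their inverses. -/
def PartialAction.IsMultiplicative {n : ℕ} {A : Type u} [NonUnitalCStarAlgebra A]
    (α : PartialAction (FreeGroup (Fin n)) A) : Prop :=
  ∀ w : List (Fin n × Bool), FreeGroup.IsReduced w →
    α.pmap (FreeGroup.mk w) =
      (w.map fun l => α.pmap (FreeGroup.mk [l])).foldr PFun.comp (PFun.id A)

/-- Two coactions of `G` are isomorphic if there is an equivariant `*`-isomorphism. -/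
def Coaction.IsIsomorphic {G : Type} [Group G] {B C : Type u} [NonUnitalCStarAlgebra B]
    [NonUnitalCStarAlgebra C] (δ : Coaction G B) (ε : Coaction G C) : Prop :=
  ∃ θ : B ≃⋆ₐ[ℂ] C, ∀ b : B,
    ε.hom (θ b) = MinTensor.map (θ : B →⋆ₙₐ[ℂ] C) (NonUnitalStarAlgHom.id ℂ (GroupCStar G))
      (δ.hom b)

/-- `(B, δ)` is isomorphic to `(A ×_{α,r} F_n, α̂ⁿ)` for some multiplicative partial action `α` of
the free group `F_n` on some `C*`-algebra `A`. -/
def Coaction.IsMultiplicativeDual {n : ℕ} {B : Type u} [NonUnitalCStarAlgebra B]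
    (δ : Coaction (FreeGroup (Fin n)) B) : Prop :=
  ∃ (A : Type u) (_ : NonUnitalCStarAlgebra A) (α : PartialAction (FreeGroup (Fin n)) A)
    (ε : Coaction (FreeGroup (Fin n)) α.ReducedCrossedProduct),
    α.IsMultiplicative ∧ α.IsNormalisedDual ε ∧ δ.IsIsomorphic ε

end PartialAction

/-- A subset generates the `C*`-algebra `B` if the only closed `*`-subalgebra containing it is
`B`. -/
def GeneratesCStar {B : Type*} [NonUnitalCStarAlgebra B] (S : Set B) : Prop :=
  (NonUnitalStarAlgebra.adjoin ℂ S).topologicalClosure = ⊤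

end

/-! A graded `C*`-algebra with a faithful conditional expectation onto its degree-`e` part is
determined by its homogeneous pieces. The reduced crossed product has such an expectation
(`eq_zero_of_diag_eq_zero`). So does a normal coaction whose spectral subspaces span a dense
subspace (`eq_zero_of_fourier_eq_zero`): the coefficients of `δ(x)` in the regular representation
are controlled by the diagonal coefficients of `δ(x*x)`, and these are all equal. The theorem thus
becomes a comparison of homogeneous pieces.

Necessity. For a dual coaction the spectral subspace `B_s` is exactly `E_s m_s`, because the Fourier
coefficient at `s` maps all of `B` into that closed subspace and fixes `B_s` (`exists_gen_of_mem`).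
Since `(a m_s)(b m_s)* = ab* m_e`, dropping `m_s` is an isomorphism of left Hilbert modules `B_s →
D_s`. If `α` is multiplicative and `lw` is a reduced word, then `a m_{lw}` is a limit of products
`(a m_l)(e m_w)` with `e` in `E_w`; induction on the length gives generation by `B_e` and the
generator subspaces (`generatesCStar`).

Conditions 2 and 3 are equivalent for each single `s`, over any group (`hasUnitaryMultiplier_iff`).
A multiplier `u` gives `ψ(x) = x u*`. Conversely `ψ` prescribes `u*` on the universal Hilbert space
by `u* d h = ψ⁻¹(d*)* h`. This is isometric because `ψ` preserves inner products, and it commutes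
with the commutant of `B`, so `u` lies in `B**`.

Sufficiency. Let `A = B_e`. Conjugation by the multiplier `u_i` is an isomorphism between the ideals
`D_s` for `s = g_i⁻¹` and `s = g_i`. Over a free group such partial automorphisms may be prescribed
freely on the generators: compose them along reduced words. Deleting a cancelling pair of letters
only enlarges a composition, so the result is a partial action, multiplicative by construction
(`ofBase`, `isMultiplicative_ofBase`). Let `u_w` be the product of the multipliers along `w`. Then
`u_w x = α_w(x) u_w`, and `y u_w` lies in `B_w` for `y` in the range of `α_w`; for such `y`,
deleting a cancelling pair in `w` does not change `y u_w`. Hence the pairs `(a u_s, a m_s)` span a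
`*`-algebra inside `B × (A ×_{α,r} F_n)`. The two expectations agree in norm on its closure, and
both are faithful, so the closure is the graph of an injective correspondence. It has dense
projections, in `B` because of the generation hypothesis, and is therefore the graph of a
`*`-isomorphism (`exists_starAlgEquiv`). Transporting `δ` along it gives a coaction with `a m_s ↦ a
m_s ⊗ s`, which is the normalised dual coaction. -/

noncomputable section

/-! ### Faithfulness of the universal representation -/

section Faithful

variable {B : Type u} [NonUnitalCStarAlgebra B]

/-- The positive cone is closed, convex and meets its negative only in `0`, so a real functional
separates it from `-b*b`. -/
theorem exists_posFunctional_ne_zero [PartialOrder B] [StarOrderedRing B] {b : B} (hb : b ≠ 0) :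
    ∃ f : B →ₚ[ℂ] ℂ, f (star b * b) ≠ 0 := by
  let K : ProperCone ℝ B :=
    { carrier := {x | 0 ≤ x}
      add_mem' := fun hx hy => add_nonneg hx hy
      zero_mem' := le_rfl
      smul_mem' := fun c x hx => smul_nonneg c.2 hx
      isClosed' := CStarAlgebra.isClosed_nonneg }
  have hK : ∀ x : B, x ∈ K ↔ 0 ≤ x := fun x => Iff.rfl
  have hnot : -(star b * b) ∉ K := by
    rw [hK]
    intro h
    have h1 : star b * b = 0 := le_antisymm (neg_nonneg.1 h) (star_mul_self_nonneg b)
    exact hb (CStarRing.star_mul_self_eq_zero_iff b |>.1 h1)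
  obtain ⟨φ, hφ, hφ0⟩ := K.hyperplane_separation_point hnot
  -- Adding the adjoint makes `ψ` vanish on `i` times self-adjoint elements. Its complexification
  -- `g` is then real on self-adjoint elements, where it is twice `φ`.
  let ψ : B →ₗ[ℝ] ℝ :=
    { toFun := fun x => φ x + φ (star x)
      map_add' := fun x y => by simp only [map_add, star_add]; ring
      map_smul' := fun c x => by
        have : star (c • x) = c • star x := by simp
        simp only [this, map_smul, smul_eq_mul, RingHom.id_apply]; ring }
  let g : B →ₗ[ℂ] ℂ := Module.Dual.extendRCLike ψ
  have hg : ∀ x : B, IsSelfAdjoint x → g x = ((2 * φ x : ℝ) : ℂ) := fun x hx => by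
    have h1 : g x = (ψ x : ℂ) - Complex.I * (ψ (Complex.I • x) : ℂ) := rfl
    have h2 : ψ (Complex.I • x) = 0 := by
      change φ _ + φ _ = 0
      rw [star_smul, hx.star_eq]
      simp
    have h3 : ψ x = 2 * φ x := by
      change φ _ + φ _ = _
      rw [hx.star_eq]; ring
    rw [h1, h2, h3]; simp
  let f : B →ₚ[ℂ] ℂ := PositiveLinearMap.mk₀ g fun x hx => by
    rw [hg x (IsSelfAdjoint.of_nonneg hx)]
    have := hφ x hx
    exact_mod_cast (by positivity : 0 ≤ 2 * φ x)
  refine ⟨f, ?_⟩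
  change g _ ≠ 0
  rw [hg _ (IsSelfAdjoint.star_mul_self b)]
  rw [map_neg] at hφ0
  exact_mod_cast (by linarith : (0:ℝ) < 2 * φ (star b * b)).ne'

/-- Without a unit there is no obvious cyclic vector, so `b` is tested on the GNS vector of `b*`.
Its image is the class of `bb*`, which is nonzero for a functional that does not vanish at
`(bb*)*(bb*)`. -/
theorem universalRep_injective : Function.Injective (universalRep B).hom := by
  rw [injective_iff_map_eq_zero]
  intro b hb
  classical
  by_contra hne
  let := CStarAlgebra.spectralOrder B
  let := CStarAlgebra.spectralOrderedRing B
  obtain ⟨f, hf⟩ := exists_posFunctional_ne_zero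
    (b := b * star b) (by rwa [Ne, CStarRing.mul_star_self_eq_zero_iff])
  let F : PosFunctional B := f
  have h1 : f.gnsNonUnitalStarAlgHom b = 0 := by
    ext ξ
    have h2 : univOp b (lp.single 2 F ξ) F = F.gns.hom b ξ :=
      congrArg (F.gns.hom b) (lp.single_apply_self (E := fun f : PosFunctional B => f.gns.space) 2 F ξ)
    have h3 : univOp b = 0 := hb
    rw [h3] at h2
    exact h2.symm
  have h2 := congrArg (fun T => T ((f.toPreGNS (star b) : f.PreGNS) : f.GNS)) h1
  simp only [PositiveLinearMap.gnsNonUnitalStarAlgHom_apply_coe] at h2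
  have h3 : f.leftMulMapPreGNS b (f.toPreGNS (star b)) = f.toPreGNS (b * star b) := rfl
  rw [h3] at h2
  have h4 := congrArg norm h2
  rw [UniformSpace.Completion.norm_coe] at h4
  have h5 := f.preGNS_norm_sq (f.toPreGNS (b * star b))
  rw [h4] at h5
  apply hf
  simpa using h5.symm

theorem norm_universalRep (b : B) : ‖(universalRep B).hom b‖ = ‖b‖ :=
  NonUnitalStarAlgHom.norm_map _ universalRep_injective b

end Faithful

/-! ### Approximate units -/

section ApproxUnit

variable {A : Type*} [NonUnitalCStarAlgebra A]

/-- An approximate unit `e` of `D` also works for `x`, which need not lie in `D`: `‖ex - x‖²` is the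
norm of `(ex - x)(ex - x)*`, and this involves `x` only through `xx*`. -/
theorem NonUnitalStarSubalgebra.mem_closure_mul_of_star_mem (D : NonUnitalStarSubalgebra ℂ A)
    (hD : IsClosed (D : Set A)) {x : A} (hx : x * star x ∈ D) :
    x ∈ closure {y | ∃ e ∈ D, y = e * x} := by
  have := hD
  let := CStarAlgebra.spectralOrder D
  let := CStarAlgebra.spectralOrderedRing D
  have hl := CStarAlgebra.increasingApproximateUnit (A := D)
  have := hl.neBot
  set l := CStarAlgebra.approximateUnit D
  have h1 : Filter.Tendsto (fun e : D => (e : A) * (x * star x)) l (nhds (x * star x)) :=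
    (continuous_subtype_val.tendsto _).comp (hl.tendsto_mul_right ⟨_, hx⟩)
  have h2 : Filter.Tendsto (fun e : D => ((e : A) * x - x) * star ((e : A) * x - x)) l (nhds 0) := by
    have hz : Filter.Tendsto (fun e : D => (e : A) * (x * star x) - x * star x) l (nhds 0) := by
      simpa using h1.sub_const (x * star x)
    have hb : ∀ᶠ e : D in l, ‖((e : A) * x - x) * star ((e : A) * x - x)‖ ≤
        ‖(e : A) * (x * star x) - x * star x‖ * 1 + ‖(e : A) * (x * star x) - x * star x‖ := by
      filter_upwards [hl.eventually_norm] with e he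
      have : ((e : A) * x - x) * star ((e : A) * x - x) =
          ((e : A) * (x * star x) - x * star x) * star (e : A)
            - ((e : A) * (x * star x) - x * star x) := by
        simp only [star_sub, star_mul]; noncomm_ring
      rw [this]
      refine (norm_sub_le _ _).trans (add_le_add ((norm_mul_le _ _).trans ?_) le_rfl)
      rw [norm_star]
      exact mul_le_mul_of_nonneg_left he (norm_nonneg _)
    refine squeeze_zero_norm' hb ?_
    simpa using (hz.norm.mul_const 1).add hz.norm
  have h3 : Filter.Tendsto (fun e : D => (e : A) * x) l (nhds x) := by
    rw [tendsto_iff_norm_sub_tendsto_zero]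
    have h4 := (Real.continuous_sqrt.tendsto _).comp h2.norm
    simp only [norm_zero, Real.sqrt_zero] at h4
    refine h4.congr fun e => ?_
    rw [Function.comp_apply, CStarRing.norm_self_mul_star, Real.sqrt_mul_self (norm_nonneg _)]
  exact mem_closure_of_tendsto h3 (Filter.Eventually.of_forall fun e => ⟨e, e.2, rfl⟩)

end ApproxUnit

/-! ### Matrix coefficients and slice maps on the minimal tensor product -/

namespace MinTensor

variable {B : Type u} [NonUnitalCStarAlgebra B] {C : Type v} [NonUnitalCStarAlgebra C]

theorem norm_tensorRep_le (π : HilbertRep B) (ρ : HilbertRep C) (x : B ⊗[ℂ] C) :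
    ‖tensorRep π ρ x‖ ≤ ‖incl B C x‖ := by
  rw [norm_incl]
  exact CStarSeminorm.le_iSup
    (fun i : HilbertRep B × HilbertRep C => tensorRepSeminorm i.1 i.2) _ (π, ρ) x

@[elab_as_elim]
theorem induction_on {P : MinTensor B C → Prop} (y : MinTensor B C) (hc : IsClosed {a | P a})
    (h : ∀ x, P (incl B C x)) : P y :=
  denseRange_incl.induction_on y hc h

/-- Two bounded linear maps on `B ⊗ C` agree if they agree on the elementary tensors. -/
theorem clm_ext {F : Type*} [NormedAddCommGroup F] [NormedSpace ℂ F]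
    {S T : MinTensor B C →L[ℂ] F} (h : ∀ b c, S (tmul b c) = T (tmul b c)) : S = T := by
  ext y
  induction y using induction_on with
  | hc => exact isClosed_eq S.continuous T.continuous
  | h x =>
    induction x with
    | zero => simp
    | add a b ha hb => simp only [map_add, ha, hb]
    | tmul b c => exact h b c

/-- The bounded extension to `B ⊗ C` of a linear map on the algebraic tensor product. -/
def extendL {F : Type*} [NormedAddCommGroup F] [NormedSpace ℂ F] [CompleteSpace F]
    (f : B ⊗[ℂ] C →ₗ[ℂ] F) : MinTensor B C →L[ℂ] F :=
  f.extendOfNorm (incl B C : B ⊗[ℂ] C →ₗ[ℂ] MinTensor B C)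

theorem extendL_incl {F : Type*} [NormedAddCommGroup F] [NormedSpace ℂ F] [CompleteSpace F]
    {f : B ⊗[ℂ] C →ₗ[ℂ] F} {K : ℝ} (hf : ∀ x, ‖f x‖ ≤ K * ‖incl B C x‖) (x : B ⊗[ℂ] C) :
    extendL f (incl B C x) = f x :=
  LinearMap.extendOfNorm_eq (e := (incl B C : B ⊗[ℂ] C →ₗ[ℂ] MinTensor B C)) denseRange_incl
    ⟨K, hf⟩ x

theorem _root_.norm_inner_self_eq_sq {E : Type*} [NormedAddCommGroup E] [InnerProductSpace ℂ E]
    (x : E) : ‖⟪x, x⟫_ℂ‖ = ‖x‖ ^ 2 := by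
  rw [inner_self_eq_norm_sq_to_K]; simp

/-- The matrix coefficient `x ↦ ⟪ζ', (π ⊗ ρ)(x) ζ⟫` on the algebraic tensor product. -/
def algCoeff (π : HilbertRep B) (ρ : HilbertRep C) (ζ ζ' : π.space ⊗[ℂ] ρ.space) :
    B ⊗[ℂ] C →ₗ[ℂ] ℂ where
  toFun x := ⟪ζ', tensorRep π ρ x ζ⟫_ℂ
  map_add' x y := by rw [map_add]; exact inner_add_right _ _ _
  map_smul' r x := by rw [map_smul]; exact inner_smul_right ζ' (tensorRep π ρ x ζ) r

theorem norm_algCoeff_le (π : HilbertRep B) (ρ : HilbertRep C) (ζ ζ' : π.space ⊗[ℂ] ρ.space)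
    (x : B ⊗[ℂ] C) : ‖algCoeff π ρ ζ ζ' x‖ ≤ (‖ζ‖ * ‖ζ'‖) * ‖incl B C x‖ := by
  refine (norm_inner_le_norm ζ' (tensorRep π ρ x ζ)).trans ?_
  have h1 := (tensorRep π ρ x).le_opNorm ζ
  have h2 := norm_tensorRep_le π ρ x
  calc ‖ζ'‖ * ‖tensorRep π ρ x ζ‖ ≤ ‖ζ'‖ * (‖incl B C x‖ * ‖ζ‖) := by
        gcongr
        exact h1.trans (by gcongr)
    _ = _ := by ring

/-- The matrix coefficient `y ↦ ⟪ζ', (π ⊗ ρ)(y) ζ⟫` on `B ⊗ C`. -/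
def coeff (π : HilbertRep B) (ρ : HilbertRep C) (ζ ζ' : π.space ⊗[ℂ] ρ.space) :
    MinTensor B C →L[ℂ] ℂ := extendL (algCoeff π ρ ζ ζ')

theorem coeff_incl (π : HilbertRep B) (ρ : HilbertRep C) (ζ ζ' : π.space ⊗[ℂ] ρ.space)
    (x : B ⊗[ℂ] C) : coeff π ρ ζ ζ' (incl B C x) = ⟪ζ', tensorRep π ρ x ζ⟫_ℂ :=
  extendL_incl (norm_algCoeff_le π ρ ζ ζ') x

theorem norm_coeff_le (π : HilbertRep B) (ρ : HilbertRep C) (ζ ζ' : π.space ⊗[ℂ] ρ.space)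
    (y : MinTensor B C) : ‖coeff π ρ ζ ζ' y‖ ≤ (‖ζ‖ * ‖ζ'‖) * ‖y‖ := by
  induction y using induction_on with
  | hc => exact isClosed_le (by fun_prop) (by fun_prop)
  | h x => rw [coeff_incl]; exact norm_algCoeff_le π ρ ζ ζ' x

theorem coeff_tmul (π : HilbertRep B) (ρ : HilbertRep C) (h h' : π.space) (k k' : ρ.space)
    (b : B) (c : C) :
    coeff π ρ (h ⊗ₜ k) (h' ⊗ₜ k') (tmul b c) = ⟪h', π.hom b h⟫_ℂ * ⟪k', ρ.hom c k⟫_ℂ := by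
  rw [tmul, coeff_incl, tensorRep_tmul]
  simp [tensorOp]

/-- Cauchy–Schwarz. It lets the vanishing of one diagonal coefficient of `y*y` kill all coefficients
of `y` with the same initial vector. -/
theorem norm_coeff_sq_le (π : HilbertRep B) (ρ : HilbertRep C) (ζ ζ' : π.space ⊗[ℂ] ρ.space)
    (y : MinTensor B C) :
    ‖coeff π ρ ζ ζ' y‖ ^ 2 ≤ ‖coeff π ρ ζ ζ (star y * y)‖ * ‖ζ'‖ ^ 2 := by
  induction y using induction_on with
  | hc => exact isClosed_le (by fun_prop) (by fun_prop)
  | h x =>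
    have h1 := norm_inner_le_norm (𝕜 := ℂ) ζ' (tensorRep π ρ x ζ)
    have h2 : ⟪ζ, tensorRep π ρ (star x) (tensorRep π ρ x ζ)⟫_ℂ =
        ⟪tensorRep π ρ x ζ, tensorRep π ρ x ζ⟫_ℂ := by
      rw [← tensorRep_star, star_star]
    rw [← StarHomClass.map_star, ← map_mul, coeff_incl, coeff_incl, tensorRep_mul,
      mul_apply_eq_comp, h2]
    have h3 : ‖⟪tensorRep π ρ x ζ, tensorRep π ρ x ζ⟫_ℂ‖ = ‖tensorRep π ρ x ζ‖ ^ 2 :=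
      norm_inner_self_eq_sq (tensorRep π ρ x ζ)
    rw [h3]
    calc _ ≤ (‖ζ'‖ * ‖tensorRep π ρ x ζ‖) ^ 2 := by gcongr
      _ = _ := by ring

theorem coeff_add_left (π : HilbertRep B) (ρ : HilbertRep C) (ζ₁ ζ₂ ζ' : π.space ⊗[ℂ] ρ.space)
    (y : MinTensor B C) : coeff π ρ (ζ₁ + ζ₂) ζ' y = coeff π ρ ζ₁ ζ' y + coeff π ρ ζ₂ ζ' y := by
  induction y using induction_on with
  | hc => exact isClosed_eq (by fun_prop) (by fun_prop)
  | h x => simp only [coeff_incl, map_add, inner_add_right]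

theorem coeff_add_right (π : HilbertRep B) (ρ : HilbertRep C) (ζ ζ₁ ζ₂ : π.space ⊗[ℂ] ρ.space)
    (y : MinTensor B C) : coeff π ρ ζ (ζ₁ + ζ₂) y = coeff π ρ ζ ζ₁ y + coeff π ρ ζ ζ₂ y := by
  induction y using induction_on with
  | hc => exact isClosed_eq (by fun_prop) (by fun_prop)
  | h x => simp only [coeff_incl, inner_add_left]

theorem coeff_zero_left (π : HilbertRep B) (ρ : HilbertRep C) (ζ' : π.space ⊗[ℂ] ρ.space)
    (y : MinTensor B C) : coeff π ρ 0 ζ' y = 0 := by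
  simpa using coeff_add_left π ρ 0 0 ζ' y

theorem coeff_zero_right (π : HilbertRep B) (ρ : HilbertRep C) (ζ : π.space ⊗[ℂ] ρ.space)
    (y : MinTensor B C) : coeff π ρ ζ 0 y = 0 := by
  simpa using coeff_add_right π ρ ζ 0 0 y

/-- The minimal norm is computed on algebraic tensor products of Hilbert spaces, whose vectors are
finite sums of elementary ones, so coefficients at elementary vectors suffice. -/
theorem eq_zero_of_coeff (y : MinTensor B C)
    (h : ∀ (π : HilbertRep B) (ρ : HilbertRep C) (h h' : π.space) (k k' : ρ.space),
      coeff π ρ (h ⊗ₜ k) (h' ⊗ₜ k') y = 0) : y = 0 := by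
  have hall : ∀ (π : HilbertRep B) (ρ : HilbertRep C) ζ ζ', coeff π ρ ζ ζ' y = 0 := by
    intro π ρ ζ ζ'
    induction ζ with
    | zero => exact coeff_zero_left _ _ _ _
    | add a b ha hb => rw [coeff_add_left, ha, hb, add_zero]
    | tmul h₁ k₁ =>
      induction ζ' with
      | zero => exact coeff_zero_right _ _ _ _
      | add a b ha hb => rw [coeff_add_right, ha, hb, add_zero]
      | tmul h₂ k₂ => exact h π ρ h₁ h₂ k₁ k₂
  rw [← norm_le_zero_iff]
  refine le_of_forall_pos_le_add fun ε hε => ?_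
  obtain ⟨x, hx⟩ := denseRange_incl.exists_dist_lt y (half_pos hε)
  rw [dist_eq_norm] at hx
  have hx2 : ‖incl B C x‖ ≤ ε / 2 := by
    rw [norm_incl]
    refine CStarSeminorm.iSup_le _ _ _ (half_pos hε).le fun q => ?_
    change ‖tensorRep q.1 q.2 x‖ ≤ _
    refine ContinuousLinearMap.opNorm_le_bound _ (half_pos hε).le fun ζ => ?_
    -- The approximant `x` of `y` is tested against its own image vector: this coefficient is a
    -- squared norm, while the same coefficient of `y` is zero.
    set ζ' := tensorRep q.1 q.2 x ζ with hζ'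
    have h1 := norm_coeff_le q.1 q.2 ζ ζ' (incl B C x - y)
    rw [map_sub, hall, sub_zero, coeff_incl, ← hζ', norm_sub_rev] at h1
    have h2 : ‖⟪ζ', ζ'⟫_ℂ‖ = ‖ζ'‖ ^ 2 := norm_inner_self_eq_sq ζ'
    rw [h2] at h1
    rcases (norm_nonneg ζ').eq_or_lt with h0 | h0
    · rw [← h0]; positivity
    · have h2 : ‖ζ'‖ * ‖ζ'‖ ≤ (ε / 2 * ‖ζ‖) * ‖ζ'‖ := by
        calc ‖ζ'‖ * ‖ζ'‖ = ‖ζ'‖ ^ 2 := by ring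
          _ ≤ _ := h1
          _ ≤ ‖ζ‖ * ‖ζ'‖ * (ε / 2) := by gcongr
          _ = _ := by ring
      exact le_of_mul_le_mul_right h2 h0
  calc ‖y‖ ≤ ‖y - incl B C x‖ + ‖incl B C x‖ := by simpa using norm_add_le (y - incl B C x) (incl B C x)
    _ ≤ 0 + ε := by linarith

/-- The vector functional `c ↦ ⟪k', ρ(c) k⟫`. -/
def vecFun (ρ : HilbertRep C) (k k' : ρ.space) : C →ₗ[ℂ] ℂ where
  toFun c := ⟪k', ρ.hom c k⟫_ℂ
  map_add' x y := by simp
  map_smul' r x := by simp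

/-- The slice map `b ⊗ c ↦ ⟪k', ρ(c) k⟫ b` on the algebraic tensor product. -/
def algSliceRight (B : Type u) [NonUnitalCStarAlgebra B] (ρ : HilbertRep C) (k k' : ρ.space) :
    B ⊗[ℂ] C →ₗ[ℂ] B :=
  TensorProduct.lift ((LinearMap.lsmul ℂ B).flip.compl₂ (vecFun ρ k k'))

theorem algSliceRight_tmul (ρ : HilbertRep C) (k k' : ρ.space) (b : B) (c : C) :
    algSliceRight B ρ k k' (b ⊗ₜ c) = ⟪k', ρ.hom c k⟫_ℂ • b := rfl

theorem inner_algSliceRight (π : HilbertRep B) (ρ : HilbertRep C) (h h' : π.space)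
    (k k' : ρ.space) (x : B ⊗[ℂ] C) :
    ⟪h', π.hom (algSliceRight B ρ k k' x) h⟫_ℂ = coeff π ρ (h ⊗ₜ k) (h' ⊗ₜ k') (incl B C x) := by
  induction x with
  | zero => simp
  | add a b ha hb => simp only [map_add, add_apply, inner_add_right, ha, hb]
  | tmul b c =>
    rw [algSliceRight_tmul, map_smul, smul_apply, inner_smul_right]
    exact (mul_comm _ _).trans (coeff_tmul π ρ h h' k k' b c).symm

theorem norm_le_of_inner_le {E : Type*} [NormedAddCommGroup E] [InnerProductSpace ℂ E]
    {T : E →L[ℂ] E} {K : ℝ} (hK : 0 ≤ K) (h : ∀ ξ η, ‖⟪η, T ξ⟫_ℂ‖ ≤ K * (‖ξ‖ * ‖η‖)) :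
    ‖T‖ ≤ K := by
  refine ContinuousLinearMap.opNorm_le_bound _ hK fun ξ => ?_
  have h1 := h ξ (T ξ)
  rw [norm_inner_self_eq_sq] at h1
  rcases (norm_nonneg (T ξ)).eq_or_lt with h0 | h0
  · rw [← h0]; positivity
  · refine le_of_mul_le_mul_right ?_ h0
    calc _ = ‖T ξ‖ ^ 2 := by ring
      _ ≤ _ := h1
      _ = _ := by ring

/-- The universal representation is isometric, so the norm of the slice can be read from its matrix
coefficients, and these are coefficients of `x`. -/
theorem norm_algSliceRight_le (ρ : HilbertRep C) (k k' : ρ.space) (x : B ⊗[ℂ] C) :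
    ‖algSliceRight B ρ k k' x‖ ≤ (‖k‖ * ‖k'‖) * ‖incl B C x‖ := by
  rw [← norm_universalRep]
  refine norm_le_of_inner_le (by positivity) fun ξ η => ?_
  rw [inner_algSliceRight]
  refine (norm_coeff_le _ _ _ _ _).trans (le_of_eq ?_)
  rw [TensorProduct.norm_tmul, TensorProduct.norm_tmul]
  ring

/-- The slice map `b ⊗ c ↦ ⟪k', ρ(c) k⟫ b` on `B ⊗ C`. -/
def sliceRight (ρ : HilbertRep C) (k k' : ρ.space) : MinTensor B C →L[ℂ] B :=
  extendL (algSliceRight B ρ k k')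

theorem sliceRight_tmul (ρ : HilbertRep C) (k k' : ρ.space) (b : B) (c : C) :
    sliceRight ρ k k' (tmul b c) = ⟪k', ρ.hom c k⟫_ℂ • b :=
  extendL_incl (norm_algSliceRight_le ρ k k') (b ⊗ₜ c)

theorem inner_sliceRight (π : HilbertRep B) (ρ : HilbertRep C) (h h' : π.space)
    (k k' : ρ.space) (y : MinTensor B C) :
    ⟪h', π.hom (sliceRight ρ k k' y) h⟫_ℂ = coeff π ρ (h ⊗ₜ k) (h' ⊗ₜ k') y := by
  have hπ : Continuous π.hom := AddMonoidHomClass.continuous_of_bound π.hom 1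
    fun b => by simpa using NonUnitalStarAlgHom.norm_apply_le π.hom b
  induction y using induction_on with
  | hc => exact isClosed_eq (by fun_prop) (by fun_prop)
  | h x =>
    rw [← inner_algSliceRight, sliceRight, extendL_incl (norm_algSliceRight_le ρ k k')]

section Left

variable {K : Type v} [NormedAddCommGroup K] [InnerProductSpace ℂ K] [CompleteSpace K]

/-- The identity representation of the bounded operators on `K`. -/
def _root_.HilbertRep.ofOperators (K : Type v) [NormedAddCommGroup K] [InnerProductSpace ℂ K]
    [CompleteSpace K] : HilbertRep (K →L[ℂ] K) where
  space := K
  hom := NonUnitalStarAlgHom.id ℂ _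

/-- The slice map `b ⊗ T ↦ ⟪h', π(b) h⟫ T` on the algebraic tensor product. -/
def algSliceLeft (π : HilbertRep B) (K : Type v) [NormedAddCommGroup K] [InnerProductSpace ℂ K]
    [CompleteSpace K] (h h' : π.space) : B ⊗[ℂ] (K →L[ℂ] K) →ₗ[ℂ] (K →L[ℂ] K) :=
  TensorProduct.lift ((LinearMap.lsmul ℂ (K →L[ℂ] K)).comp (vecFun π h h'))

theorem algSliceLeft_tmul (π : HilbertRep B) (h h' : π.space) (b : B) (T : K →L[ℂ] K) :
    algSliceLeft π K h h' (b ⊗ₜ T) = ⟪h', π.hom b h⟫_ℂ • T := rfl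

theorem inner_algSliceLeft (π : HilbertRep B) (ρ : HilbertRep (K →L[ℂ] K)) (h h' : π.space)
    (k k' : ρ.space) (x : B ⊗[ℂ] (K →L[ℂ] K)) :
    ⟪k', ρ.hom (algSliceLeft π K h h' x) k⟫_ℂ = coeff π ρ (h ⊗ₜ k) (h' ⊗ₜ k') (incl _ _ x) := by
  induction x with
  | zero => simp
  | add a b ha hb => simp only [map_add, add_apply, inner_add_right, ha, hb]
  | tmul b c =>
    rw [algSliceLeft_tmul, map_smul, smul_apply, inner_smul_right]
    exact (coeff_tmul π ρ h h' k k' b c).symm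

/-- The identity representation of the operators on `K` plays the role that the universal
representation plays for right slices. -/
theorem norm_algSliceLeft_le (π : HilbertRep B) (h h' : π.space) (x : B ⊗[ℂ] (K →L[ℂ] K)) :
    ‖algSliceLeft π K h h' x‖ ≤ (‖h‖ * ‖h'‖) * ‖incl _ _ x‖ := by
  refine norm_le_of_inner_le (by positivity) fun ξ η => ?_
  have := inner_algSliceLeft π (HilbertRep.ofOperators K) h h' ξ η x
  refine (congrArg norm this).le.trans ((norm_coeff_le _ _ _ _ _).trans (le_of_eq ?_))
  have h1 := TensorProduct.norm_tmul (𝕜 := ℂ) h (ξ : (HilbertRep.ofOperators K).space)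
  have h2 := TensorProduct.norm_tmul (𝕜 := ℂ) h' (η : (HilbertRep.ofOperators K).space)
  refine (congrArg₂ (fun a b => a * b * ‖incl B (K →L[ℂ] K) x‖) h1 h2).trans ?_
  ring

/-- The slice map `b ⊗ T ↦ ⟪h', π(b) h⟫ T` on `B ⊗ 𝓑(K)`. -/
def sliceLeft (π : HilbertRep B) (K : Type v) [NormedAddCommGroup K] [InnerProductSpace ℂ K]
    [CompleteSpace K] (h h' : π.space) : MinTensor B (K →L[ℂ] K) →L[ℂ] (K →L[ℂ] K) :=
  extendL (algSliceLeft π K h h')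

theorem sliceLeft_tmul (π : HilbertRep B) (h h' : π.space) (b : B) (T : K →L[ℂ] K) :
    sliceLeft π K h h' (tmul b T) = ⟪h', π.hom b h⟫_ℂ • T :=
  extendL_incl (norm_algSliceLeft_le π h h') (b ⊗ₜ T)

theorem inner_sliceLeft (π : HilbertRep B) (ρ : HilbertRep (K →L[ℂ] K)) (h h' : π.space)
    (k k' : ρ.space) (y : MinTensor B (K →L[ℂ] K)) :
    ⟪k', ρ.hom (sliceLeft π K h h' y) k⟫_ℂ = coeff π ρ (h ⊗ₜ k) (h' ⊗ₜ k') y := by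
  have hρ : Continuous ρ.hom := AddMonoidHomClass.continuous_of_bound ρ.hom 1
    fun b => by simpa using NonUnitalStarAlgHom.norm_apply_le ρ.hom b
  induction y using induction_on with
  | hc => exact isClosed_eq (by fun_prop) (by fun_prop)
  | h x =>
    rw [← inner_algSliceLeft, sliceLeft, extendL_incl (norm_algSliceLeft_le π h h')]

theorem eq_zero_of_sliceLeft (y : MinTensor B (K →L[ℂ] K))
    (hy : ∀ (π : HilbertRep B) (h h' : π.space), sliceLeft π K h h' y = 0) : y = 0 := by
  refine eq_zero_of_coeff y fun π ρ h h' k k' => ?_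
  rw [← inner_sliceLeft, hy, map_zero]
  simp

end Left

end MinTensor

/-! ### Partial isometries from families with equal inner products -/

section HilbertSpace

variable {H : Type*} [NormedAddCommGroup H] [InnerProductSpace ℂ H] [CompleteSpace H]

theorem Submodule.clm_ext_of_orthogonal (S : Submodule ℂ H) {F : Type*} [NormedAddCommGroup F]
    [NormedSpace ℂ F] {T₁ T₂ : H →L[ℂ] F} (h1 : ∀ x ∈ S, T₁ x = T₂ x)
    (h2 : ∀ x ∈ Sᗮ, T₁ x = T₂ x) : T₁ = T₂ := by
  have h3 : ∀ x ∈ S.topologicalClosure, T₁ x = T₂ x := fun x hx =>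
    closure_minimal (s := (S : Set H)) (t := {x | T₁ x = T₂ x}) h1
      (isClosed_eq T₁.continuous T₂.continuous) hx
  have : CompleteSpace S.topologicalClosure :=
    (Submodule.isClosed_topologicalClosure _).completeSpace_coe
  ext x
  have h4 : x = S.topologicalClosure.starProjection x +
      (x - S.topologicalClosure.starProjection x) := by abel
  have h5 : x - S.topologicalClosure.starProjection x ∈ Sᗮ := by
    rw [← Submodule.orthogonal_closure]
    exact Submodule.sub_starProjection_mem_orthogonal x
  rw [h4, map_add, map_add, h2 _ h5, h3 _ (Submodule.starProjection_apply_mem _ x)]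

variable {X : Type*} [AddCommGroup X] [Module ℂ X]

theorem exists_clm_of_norm_eq (e f : X →ₗ[ℂ] H) (h : ∀ x, ‖f x‖ = ‖e x‖) :
    ∃ V : H →L[ℂ] H, (∀ x, V (e x) = f x) ∧ ∀ ξ ∈ (LinearMap.range e)ᗮ, V ξ = 0 := by
  set E := (LinearMap.range e).topologicalClosure with hE
  have : CompleteSpace E := (Submodule.isClosed_topologicalClosure _).completeSpace_coe
  let e' : X →ₗ[ℂ] E := e.codRestrict _ fun x =>
    Submodule.le_topologicalClosure _ (LinearMap.mem_range_self _ x)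
  have hd : DenseRange e' := by
    intro ⟨y, hy⟩
    rw [closure_subtype]
    have : (Subtype.val '' Set.range e') = Set.range e := by
      rw [← Set.range_comp]; rfl
    rw [this]
    exact hy
  refine ⟨f.extendOfNorm e' ∘L E.orthogonalProjectionOnto, fun x => ?_, fun ξ hξ => ?_⟩
  · have h1 : E.orthogonalProjectionOnto (e x) = e' x :=
      E.orthogonalProjectionOnto_mem_subspace_eq_self (e' x)
    rw [ContinuousLinearMap.comp_apply, h1,
      LinearMap.extendOfNorm_eq hd ⟨1, fun x => by rw [one_mul]; exact (h x).le⟩]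
  · have h1 : E.orthogonalProjectionOnto ξ = 0 := by
      rw [Submodule.orthogonalProjectionOnto_eq_zero_iff, hE, Submodule.orthogonal_closure]
      exact hξ
    rw [ContinuousLinearMap.comp_apply, h1, map_zero]

/-- Equal inner products make `e x ↦ f x` well defined and isometric; it is extended by zero off the
range of `e`. The adjoint turns out to be the operator built with `e` and `f` exchanged, and both
projections follow from that. -/
theorem exists_partialIsometry (e f : X →ₗ[ℂ] H) (h : ∀ x y, ⟪f x, f y⟫_ℂ = ⟪e x, e y⟫_ℂ) :
    ∃ V : H →L[ℂ] H, (∀ x, V (e x) = f x) ∧ (∀ ξ ∈ (LinearMap.range e)ᗮ, V ξ = 0) ∧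
      star V * V = (LinearMap.range e).topologicalClosure.starProjection ∧
      V * star V = (LinearMap.range f).topologicalClosure.starProjection := by
  have hn : ∀ x, ‖f x‖ = ‖e x‖ := fun x => by
    rw [← sq_eq_sq₀ (norm_nonneg _) (norm_nonneg _), ← norm_inner_self_eq_sq,
      ← norm_inner_self_eq_sq, h]
  obtain ⟨V, hV, hV0⟩ := exists_clm_of_norm_eq e f hn
  obtain ⟨W, hW, hW0⟩ := exists_clm_of_norm_eq f e fun x => (hn x).symm
  have hadj : star V = W := by
    rw [ContinuousLinearMap.star_eq_adjoint]
    symm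
    rw [ContinuousLinearMap.eq_adjoint_iff]
    intro ζ η
    have key : ∀ ζ, innerSL ℂ (W ζ) = innerSL ℂ ζ ∘L V := fun ζ => by
      refine (LinearMap.range e).clm_ext_of_orthogonal ?_ ?_
      · rintro _ ⟨x, rfl⟩
        simp only [innerSL_apply_apply, ContinuousLinearMap.comp_apply, hV]
        have : (innerSL ℂ (e x)) ∘L W = innerSL ℂ (f x) := by
          refine (LinearMap.range f).clm_ext_of_orthogonal ?_ ?_
          · rintro _ ⟨y, rfl⟩
            simp only [innerSL_apply_apply, ContinuousLinearMap.comp_apply, hW, h]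
          · intro y hy
            rw [ContinuousLinearMap.comp_apply, hW0 y hy, map_zero, innerSL_apply_apply]
            exact (hy _ (LinearMap.mem_range_self f x)).symm
        have h2 := congrArg (fun T => T ζ) this
        simp only [innerSL_apply_apply, ContinuousLinearMap.comp_apply] at h2
        rw [← inner_conj_symm, h2, inner_conj_symm]
      · intro y hy
        rw [ContinuousLinearMap.comp_apply, hV0 y hy, map_zero, innerSL_apply_apply,
          ← inner_conj_symm]
        have : (innerSL ℂ y) ∘L W = 0 := by
          refine (LinearMap.range f).clm_ext_of_orthogonal ?_ ?_
          · rintro _ ⟨x, rfl⟩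
            simp only [innerSL_apply_apply, ContinuousLinearMap.comp_apply, hW]
            rw [← inner_conj_symm, hy _ (LinearMap.mem_range_self e x)]
            simp
          · intro x hx
            rw [ContinuousLinearMap.comp_apply, hW0 x hx, map_zero]; simp
        have h2 := congrArg (fun T => T ζ) this
        simp only [innerSL_apply_apply, ContinuousLinearMap.comp_apply, zero_apply] at h2
        rw [h2, map_zero]
    exact congrArg (fun T => T η) (key ζ)
  have hproj : ∀ (g : X →ₗ[ℂ] H), ∀ x ∈ (LinearMap.range g)ᗮ,
      (LinearMap.range g).topologicalClosure.starProjection x = 0 := fun g x hx => by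
    rw [Submodule.starProjection_apply_eq_zero_iff, Submodule.orthogonal_closure]
    exact hx
  have hproj' : ∀ (g : X →ₗ[ℂ] H) (x : X),
      (LinearMap.range g).topologicalClosure.starProjection (g x) = g x := fun g x => by
    rw [Submodule.starProjection_eq_self_iff]
    exact Submodule.le_topologicalClosure _ (LinearMap.mem_range_self g x)
  refine ⟨V, hV, hV0, ?_, ?_⟩
  · rw [hadj]
    refine (LinearMap.range e).clm_ext_of_orthogonal ?_ ?_
    · rintro _ ⟨x, rfl⟩
      rw [mul_apply_eq_comp, hV, hW, hproj']
    · intro x hx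
      rw [mul_apply_eq_comp, hV0 x hx, map_zero, hproj e x hx]
  · rw [hadj]
    refine (LinearMap.range f).clm_ext_of_orthogonal ?_ ?_
    · rintro _ ⟨x, rfl⟩
      rw [mul_apply_eq_comp, hW, hV, hproj']
    · intro x hx
      rw [mul_apply_eq_comp, hW0 x hx, map_zero, hproj f x hx]

end HilbertSpace

/-! ### Spectral subspaces -/

namespace Coaction

variable {G : Type} [Group G] {B : Type u} [NonUnitalCStarAlgebra B] (δ : Coaction G B)

theorem mul_mem_spectral {s t : G} {x y : B} (hx : x ∈ δ.spectral s) (hy : y ∈ δ.spectral t) :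
    x * y ∈ δ.spectral (s * t) := by
  rw [mem_spectral] at *
  rw [map_mul, hx, hy, MinTensor.tmul_mul_tmul, ← GroupCStar.elt_mul]

theorem star_mem_spectral {s : G} {x : B} (hx : x ∈ δ.spectral s) :
    star x ∈ δ.spectral s⁻¹ := by
  rw [mem_spectral] at *
  rw [StarHomClass.map_star, hx, MinTensor.star_tmul, GroupCStar.star_elt]

theorem star_mem_spectral' {s : G} {x : B} (hx : x ∈ δ.spectral s⁻¹) :
    star x ∈ δ.spectral s := by
  simpa using δ.star_mem_spectral hx

theorem isClosed_ideal (s : G) : IsClosed (δ.ideal s : Set B) :=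
  Submodule.isClosed_topologicalClosure _

theorem mul_star_mem_ideal {s : G} {x y : B} (hx : x ∈ δ.spectral s) (hy : y ∈ δ.spectral s) :
    x * star y ∈ δ.ideal s :=
  Submodule.le_topologicalClosure _ (Submodule.subset_span ⟨x, hx, y, hy, rfl⟩)

/-- To prove a closed linear condition on `D_s` it suffices to prove it on the products `x y*`. -/
theorem ideal_le {s : G} {K : Submodule ℂ B} (hK : IsClosed (K : Set B))
    (h : ∀ x ∈ δ.spectral s, ∀ y ∈ δ.spectral s, x * star y ∈ K) : δ.ideal s ≤ K := by
  refine Submodule.topologicalClosure_minimal _ (Submodule.span_le.2 ?_) hK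
  rintro _ ⟨x, hx, y, hy, rfl⟩
  exact h x hx y hy

theorem ideal_le_spectral_one (s : G) : δ.ideal s ≤ δ.spectral 1 := by
  refine δ.ideal_le (δ.isClosed_spectral 1) fun x hx y hy => ?_
  simpa using δ.mul_mem_spectral hx (δ.star_mem_spectral hy)

theorem spectral_one_mul {s : G} {a x : B} (ha : a ∈ δ.spectral 1) (hx : x ∈ δ.spectral s) :
    a * x ∈ δ.spectral s := by
  simpa using δ.mul_mem_spectral ha hx

theorem mul_mem_ideal_left {s : G} {a d : B} (ha : a ∈ δ.spectral 1) (hd : d ∈ δ.ideal s) :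
    a * d ∈ δ.ideal s := by
  refine δ.ideal_le (K := (δ.ideal s).comap (LinearMap.mulLeft ℂ a))
    ((δ.isClosed_ideal s).preimage (continuous_const_mul a)) (fun x hx y hy => ?_) hd
  change a * (x * star y) ∈ δ.ideal s
  rw [← mul_assoc]
  exact δ.mul_star_mem_ideal (δ.spectral_one_mul ha hx) hy

theorem star_mem_ideal {s : G} {d : B} (hd : d ∈ δ.ideal s) : star d ∈ δ.ideal s := by
  have hcl : IsClosed {d : B | star d ∈ δ.ideal s} :=
    (δ.isClosed_ideal s).preimage continuous_star
  refine closure_minimal ?_ hcl hd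
  intro d hd
  change star d ∈ δ.ideal s
  induction hd using Submodule.span_induction with
  | mem d h =>
    obtain ⟨x, hx, y, hy, rfl⟩ := h
    rw [star_mul, star_star]
    exact δ.mul_star_mem_ideal hy hx
  | zero => simp
  | add a b _ _ ha hb => rw [star_add]; exact add_mem ha hb
  | smul r a _ ha => rw [star_smul]; exact Submodule.smul_mem _ _ ha

/-- The fixed point algebra `B_e`. -/
def fixedAlgebra : NonUnitalStarSubalgebra ℂ B where
  __ := δ.spectral 1
  mul_mem' ha hb := by simpa using δ.mul_mem_spectral ha hb
  star_mem' ha := by simpa using δ.star_mem_spectral ha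

/-- `D_s` as a `C*`-subalgebra of `B`. -/
def idealAlgebra (s : G) : NonUnitalStarSubalgebra ℂ B where
  __ := δ.ideal s
  mul_mem' ha hb := δ.mul_mem_ideal_left (δ.ideal_le_spectral_one s ha) hb
  star_mem' ha := δ.star_mem_ideal ha

/-- Since `xx*` lies in `D_s`, an approximate unit of `D_s` also approximates `x`. In this way
closed conditions on `B_s` need only be checked on products `ex` with `e` in `D_s`. -/
theorem mem_closure_ideal_mul {s : G} {x : B} (hx : x ∈ δ.spectral s) :
    x ∈ closure {y | ∃ e ∈ δ.ideal s, y = e * x} :=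
  (δ.idealAlgebra s).mem_closure_mul_of_star_mem (δ.isClosed_ideal s) (δ.mul_star_mem_ideal hx hx)

theorem mem_closure_ideal_mul_self {s : G} {d : B} (hd : d ∈ δ.ideal s) :
    d ∈ closure {y | ∃ e ∈ δ.ideal s, y = e * d} :=
  (δ.idealAlgebra s).mem_closure_mul_of_star_mem (δ.isClosed_ideal s)
    ((δ.idealAlgebra s).mul_mem hd (δ.star_mem_ideal hd))

theorem mem_closure_mul_ideal {s : G} {x : B} (hx : x ∈ δ.spectral s) :
    x ∈ closure {y | ∃ e ∈ δ.ideal s⁻¹, y = x * e} := by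
  have h1 := δ.mem_closure_ideal_mul (δ.star_mem_spectral hx)
  have h2 := mem_closure_image (continuous_star.continuousAt (x := star x)) h1
  rw [star_star] at h2
  refine closure_mono ?_ h2
  rintro _ ⟨_, ⟨e, he, rfl⟩, rfl⟩
  exact ⟨star e, δ.star_mem_ideal he, by simp⟩

end Coaction

/-! ### Unitary multipliers and module isomorphisms -/

section UnitProj

variable {B : Type u} [NonUnitalCStarAlgebra B]

local notation "Φ" => HilbertRep.hom (universalRep B)

theorem continuous_universalRep : Continuous Φ :=
  (NonUnitalStarAlgHom.isometry _ universalRep_injective).continuous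

theorem isClosed_universalRep_image {S : Set B} (hS : IsClosed S) :
    IsClosed {T | ∃ b ∈ S, T = Φ b} := by
  have h : {T | ∃ b ∈ S, T = Φ b} = Φ '' S :=
    Set.ext fun T => exists_congr fun b => and_congr_right fun _ => eq_comm
  rw [h]
  exact (NonUnitalStarAlgHom.isometry _
    (universalRep_injective (B := B))).isClosedEmbedding.isClosedMap S hS

theorem star_unitProj (D : Submodule ℂ B) : star (unitProj D) = unitProj D :=
  (isSelfAdjoint_starProjection _).star_eq

theorem universalRep_apply_mem {D : Submodule ℂ B} {x : B}
    (hx : x ∈ closure {y | ∃ e ∈ D, y = e * x}) (ξ : (universalRep B).space) :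
    Φ x ξ ∈ (Submodule.span ℂ {η | ∃ d ∈ D,
      ∃ ξ : (universalRep B).space, η = Φ d ξ}).topologicalClosure := by
  have hcl : IsClosed {z : B | Φ z ξ ∈ (Submodule.span ℂ {η | ∃ d ∈ D,
      ∃ ξ : (universalRep B).space, η = Φ d ξ}).topologicalClosure} :=
    (Submodule.isClosed_topologicalClosure _).preimage
      (continuous_universalRep.clm_apply continuous_const)
  refine closure_minimal ?_ hcl hx
  rintro _ ⟨e, he, rfl⟩
  refine Submodule.le_topologicalClosure _ (Submodule.subset_span ⟨e, he, Φ x ξ, ?_⟩)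
  rw [map_mul, mul_apply_eq_comp]

theorem unitProj_mul {D : Submodule ℂ B} {x : B} (hx : x ∈ closure {y | ∃ e ∈ D, y = e * x}) :
    unitProj D * Φ x = Φ x := by
  ext ξ
  rw [mul_apply_eq_comp]
  exact Submodule.starProjection_eq_self_iff.2 (universalRep_apply_mem hx ξ)

theorem mul_unitProj {D : Submodule ℂ B} {x : B}
    (hx : star x ∈ closure {y | ∃ e ∈ D, y = e * star x}) : Φ x * unitProj D = Φ x := by
  have h := congrArg star (unitProj_mul hx)
  rwa [star_mul, star_unitProj, StarHomClass.map_star, star_star] at h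

end UnitProj

namespace Coaction

variable {G : Type} [Group G] {B : Type u} [NonUnitalCStarAlgebra B] (δ : Coaction G B)

local notation "Φ" => HilbertRep.hom (universalRep B)
local notation "𝓗" => HilbertRep.space (universalRep B)

theorem proj_mul_ideal {s : G} {d : B} (hd : d ∈ δ.ideal s) : δ.proj s * Φ d = Φ d :=
  unitProj_mul (δ.mem_closure_ideal_mul_self hd)

theorem ideal_mul_proj {s : G} {d : B} (hd : d ∈ δ.ideal s) : Φ d * δ.proj s = Φ d :=
  mul_unitProj (δ.mem_closure_ideal_mul_self (δ.star_mem_ideal hd))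

theorem spectral_mul_proj {s : G} {x : B} (hx : x ∈ δ.spectral s) : Φ x * δ.proj s⁻¹ = Φ x :=
  mul_unitProj (δ.mem_closure_ideal_mul (δ.star_mem_spectral hx))

/-- Each `x*` is a limit of `ex*` with `e` in `D_{s⁻¹}`; conversely `D_{s⁻¹}` is the closed span of
the products `xy*` with `x, y` in `B_{s⁻¹} = B_s*`. This identifies the final space of the partial
isometry built from a module isomorphism. -/
theorem closure_span_star_spectral (s : G) :
    (Submodule.span ℂ {η | ∃ x ∈ δ.spectral s, ∃ ξ : (universalRep B).space,
      η = Φ (star x) ξ}).topologicalClosure =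
    (Submodule.span ℂ {η | ∃ d ∈ δ.ideal s⁻¹, ∃ ξ : (universalRep B).space,
      η = Φ d ξ}).topologicalClosure := by
  apply le_antisymm
  · refine Submodule.topologicalClosure_minimal _ ?_ (Submodule.isClosed_topologicalClosure _)
    rw [Submodule.span_le]
    rintro _ ⟨x, hx, ξ, rfl⟩
    exact universalRep_apply_mem (δ.mem_closure_ideal_mul (δ.star_mem_spectral hx)) ξ
  · refine Submodule.topologicalClosure_minimal _ ?_ (Submodule.isClosed_topologicalClosure _)
    rw [Submodule.span_le]
    rintro _ ⟨d, hd, ξ, rfl⟩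
    let ev : B →ₗ[ℂ] (universalRep B).space :=
      { toFun := fun b => Φ b ξ, map_add' := fun b c => by simp, map_smul' := fun r b => by simp }
    have hev : Continuous ev := continuous_universalRep.clm_apply continuous_const
    refine δ.ideal_le (K := Submodule.comap ev (Submodule.topologicalClosure _))
      (IsClosed.preimage hev (Submodule.isClosed_topologicalClosure _)) (fun x hx y hy => ?_) hd
    refine Submodule.le_topologicalClosure _ (Submodule.subset_span
      ⟨star x, δ.star_mem_spectral' hx, Φ (star y) ξ, ?_⟩)
    change Φ (x * star y) ξ = _
    rw [map_mul, mul_apply_eq_comp, star_star]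

/-- A partial isometry `u` with `u u* = p_s`, `u* u = p_{s⁻¹}`, `D_s u ⊆ B_s` and
`u D_{s⁻¹} ⊆ B_s`. -/
structure IsUnitaryMultiplier (s : G)
    (u : (universalRep B).space →L[ℂ] (universalRep B).space) : Prop where
  mul_adjoint : u * star u = δ.proj s
  adjoint_mul : star u * u = δ.proj s⁻¹
  left : ∀ d ∈ δ.ideal s, ∃ b ∈ δ.spectral s, Φ d * u = Φ b
  right : ∀ d ∈ δ.ideal s⁻¹, ∃ b ∈ δ.spectral s, u * Φ d = Φ b

variable {δ}

namespace IsUnitaryMultiplier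

variable {s : G} {u : (universalRep B).space →L[ℂ] (universalRep B).space}

theorem adjoint (hu : δ.IsUnitaryMultiplier s u) : δ.IsUnitaryMultiplier s⁻¹ (star u) where
  mul_adjoint := by rw [star_star]; exact hu.adjoint_mul
  adjoint_mul := by rw [star_star, inv_inv]; exact hu.mul_adjoint
  left d hd := by
    obtain ⟨b, hb, h⟩ := hu.right (star d) (δ.star_mem_ideal hd)
    refine ⟨star b, δ.star_mem_spectral hb, ?_⟩
    rw [StarHomClass.map_star, ← h, star_mul, StarHomClass.map_star, star_star]
  right d hd := by
    rw [inv_inv] at hd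
    obtain ⟨b, hb, h⟩ := hu.left (star d) (δ.star_mem_ideal hd)
    refine ⟨star b, δ.star_mem_spectral hb, ?_⟩
    rw [StarHomClass.map_star, ← h, star_mul, StarHomClass.map_star, star_star]

/-- `x` is a limit of elements `xe` with `e` in `D_{s⁻¹}`, and `eu* = (ue*)*` is the adjoint of an
element of `B_s`. So `xeu*` lies in `B_s B_s*`. -/
theorem spectral_mul_star (hu : δ.IsUnitaryMultiplier s u) {x : B} (hx : x ∈ δ.spectral s) :
    ∃ d ∈ δ.ideal s, Φ x * star u = Φ d := by
  have hcl : IsClosed {z : B | ∃ d ∈ δ.ideal s, Φ z * star u = Φ d} :=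
    (isClosed_universalRep_image (δ.isClosed_ideal s)).preimage
      (continuous_universalRep.mul continuous_const)
  refine closure_minimal ?_ hcl (δ.mem_closure_mul_ideal hx)
  rintro _ ⟨e, he, rfl⟩
  obtain ⟨b, hb, h⟩ := hu.right (star e) (δ.star_mem_ideal he)
  refine ⟨x * star b, δ.mul_star_mem_ideal hx hb, ?_⟩
  rw [map_mul, map_mul, StarHomClass.map_star, ← h, star_mul, StarHomClass.map_star,
    star_star, mul_assoc]

/-- The isomorphism is `x ↦ xu*`. It preserves inner products because `u*u = p_{s⁻¹}`, and it has
the inverse `d ↦ du` because `uu* = p_s`. -/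
theorem hasModuleIso (hu : δ.IsUnitaryMultiplier s u) : δ.HasModuleIso s := by
  choose f hf hfu using fun x : δ.spectral s => hu.spectral_mul_star x.2
  have hinj : Function.Injective Φ := universalRep_injective
  let F : δ.spectral s →ₗ[ℂ] δ.ideal s :=
    { toFun := fun x => ⟨f x, hf x⟩
      map_add' := fun x y => Subtype.ext <| hinj <| by
        change Φ (f _) = Φ (f x + f y)
        rw [map_add, ← hfu, ← hfu, ← hfu, ← add_mul, ← map_add]; rfl
      map_smul' := fun r x => Subtype.ext <| hinj <| by
        change Φ (f _) = Φ (r • f x)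
        rw [map_smul, ← hfu, ← hfu, ← smul_mul_assoc, ← map_smul]; rfl }
  have hF : ∀ x : δ.spectral s, Φ (F x : B) = Φ (x : B) * star u := fun x => (hfu x).symm
  have hinner : ∀ x y : δ.spectral s,
      (F x : B) * star (F y : B) = (x : B) * star (y : B) := fun x y => by
    apply hinj
    rw [map_mul, StarHomClass.map_star, hF, hF, star_mul, star_star,
      ← mul_assoc, mul_assoc (Φ (x : B)), hu.adjoint_mul, δ.spectral_mul_proj x.2, map_mul,
      StarHomClass.map_star]
  have hbij : Function.Bijective F := by
    constructor
    · rw [injective_iff_map_eq_zero]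
      intro x hx
      have h := hinner x x
      rw [hx, Submodule.coe_zero, zero_mul] at h
      exact Subtype.ext ((CStarRing.mul_star_self_eq_zero_iff _).1 h.symm)
    · intro d
      obtain ⟨b, hb, h⟩ := hu.left d d.2
      refine ⟨⟨b, hb⟩, Subtype.ext (hinj ?_)⟩
      rw [hF, ← h, mul_assoc, hu.mul_adjoint, δ.ideal_mul_proj d.2]
  refine ⟨LinearEquiv.ofBijective F hbij, fun d x => hinj ?_, hinner⟩
  change Φ (F _ : B) = Φ (d * (F x : B))
  rw [hF, map_mul, map_mul, hF, mul_assoc]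

end IsUnitaryMultiplier

theorem isUnitaryMultiplier_of_mem {s : G}
    {u : (universalRep B).space →L[ℂ] (universalRep B).space} (h : u ∈ δ.multipliers s)
    (h1 : u * star u = δ.proj s) (h2 : star u * u = δ.proj s⁻¹) : δ.IsUnitaryMultiplier s u :=
  ⟨h1, h2, h.2.1, h.2.2⟩

-- If `ψ(x) = xu*`, then `ψ⁻¹(d) = du` and therefore `u*d = ψ⁻¹(d*)*`. This formula is taken as the
-- definition of `u*` on the vectors `d h`; it is isometric because `ψ` preserves inner products.
-- The resulting partial isometry is `V`, and the multiplier is its adjoint.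
set_option maxHeartbeats 1000000 in
theorem hasUnitaryMultiplier_of_hasModuleIso {s : G} (h : δ.HasModuleIso s) :
    δ.HasUnitaryMultiplier s := by
  obtain ⟨ψ, hlin, hinner⟩ := h
  let sd : δ.ideal s → δ.ideal s := fun d => ⟨star (d : B), δ.star_mem_ideal d.2⟩
  have hsym : ∀ d d' : δ.ideal s,
      (ψ.symm d : B) * star (ψ.symm d' : B) = (d : B) * star (d' : B) := fun d d' => by
    have := hinner (ψ.symm d) (ψ.symm d')
    simpa using this.symm
  let e : (δ.ideal s) ⊗[ℂ] 𝓗 →ₗ[ℂ] 𝓗 :=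
    TensorProduct.lift (LinearMap.mk₂ ℂ (fun d h => Φ (d : B) h)
      (fun d d' h => by simp) (fun r d h => by simp) (fun d h h' => by simp)
      (fun r d h => by simp))
  -- Two adjoints are taken, so the expression is linear in `d`.
  let f : (δ.ideal s) ⊗[ℂ] 𝓗 →ₗ[ℂ] 𝓗 :=
    TensorProduct.lift (LinearMap.mk₂ ℂ (fun d h => Φ (star (ψ.symm (sd d) : B)) h)
      (fun d d' h => by
        have : sd (d + d') = sd d + sd d' := Subtype.ext (by simp [sd])
        rw [this]; simp)
      (fun r d h => by
        have : sd (r • d) = star r • sd d := Subtype.ext (by simp [sd])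
        rw [this]; simp) (fun d h h' => by simp)
      (fun r d h => by simp))
  have he : ∀ d h, e (d ⊗ₜ h) = Φ (d : B) h := fun d h => rfl
  have hf : ∀ d h, f (d ⊗ₜ h) = Φ (star (ψ.symm (sd d) : B)) h := fun d h => rfl
  have hadj : ∀ (b : B) (x y : 𝓗), ⟪Φ b x, y⟫_ℂ = ⟪x, Φ (star b) y⟫_ℂ := fun b x y => by
    rw [StarHomClass.map_star, ContinuousLinearMap.star_eq_adjoint,
      ContinuousLinearMap.adjoint_inner_right]
  have hef : ∀ x y, ⟪f x, f y⟫_ℂ = ⟪e x, e y⟫_ℂ := fun x y => by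
    induction x with
    | zero => simp
    | add a b ha hb => simp only [map_add, inner_add_left, ha, hb]
    | tmul d h =>
      induction y with
      | zero => simp
      | add a b ha hb => simp only [map_add, inner_add_right, ha, hb]
      | tmul d' h' =>
        rw [he, he, hf, hf, hadj, hadj, ← mul_apply_eq_comp, ← mul_apply_eq_comp, ← map_mul,
          ← map_mul, star_star, hsym]
        simp [sd]
  obtain ⟨V, hV, hV0, hVV, hVV'⟩ := exists_partialIsometry e f hef
  have hVd : ∀ d : δ.ideal s, V * Φ (d : B) = Φ (star (ψ.symm (sd d) : B)) := fun d => by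
    ext h
    rw [mul_apply_eq_comp, ← he, hV, hf]
  have hrange_e : LinearMap.range e = Submodule.span ℂ {η | ∃ d ∈ δ.ideal s, ∃ ξ : 𝓗, η = Φ d ξ} := by
    apply le_antisymm
    · rintro _ ⟨x, rfl⟩
      induction x with
      | zero => simp
      | add a b ha hb => rw [map_add]; exact add_mem ha hb
      | tmul d h => exact Submodule.subset_span ⟨d, d.2, h, rfl⟩
    · rw [Submodule.span_le]
      rintro _ ⟨d, hd, ξ, rfl⟩
      exact ⟨⟨d, hd⟩ ⊗ₜ ξ, rfl⟩
  have hrange_f : LinearMap.range f = Submodule.span ℂ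
      {η | ∃ x ∈ δ.spectral s, ∃ ξ : 𝓗, η = Φ (star x) ξ} := by
    apply le_antisymm
    · rintro _ ⟨x, rfl⟩
      induction x with
      | zero => simp
      | add a b ha hb => rw [map_add]; exact add_mem ha hb
      | tmul d h => exact Submodule.subset_span ⟨_, (ψ.symm (sd d)).2, h, rfl⟩
    · rw [Submodule.span_le]
      rintro _ ⟨x, hx, ξ, rfl⟩
      refine ⟨sd (ψ ⟨x, hx⟩) ⊗ₜ ξ, ?_⟩
      have : sd (sd (ψ ⟨x, hx⟩)) = ψ ⟨x, hx⟩ := Subtype.ext (by simp [sd])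
      rw [hf, this]; simp
  have hp : star V * V = δ.proj s := by
    rw [hVV, hrange_e]; rfl
  have hp' : V * star V = δ.proj s⁻¹ := by
    rw [hVV']
    simp only [hrange_f, closure_span_star_spectral δ s]
    rfl
  have hVp : V * δ.proj s = V := by
    rw [← hp]
    refine (LinearMap.range e).clm_ext_of_orthogonal ?_ ?_
    · rintro _ ⟨x, rfl⟩
      rw [hVV, mul_apply_eq_comp, Submodule.starProjection_eq_self_iff.2
        (Submodule.le_topologicalClosure _ (LinearMap.mem_range_self e x))]
    · intro x hx
      rw [mul_apply_eq_comp, mul_apply_eq_comp, hV0 x hx, map_zero, map_zero]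
  have hpV : δ.proj s⁻¹ * V = V := by
    rw [← hp', mul_assoc, hp, hVp]
  have hdu : ∀ d : δ.ideal s, Φ (d : B) * star V = Φ (ψ.symm d : B) := fun d => by
    have h1 := congrArg star (hVd (sd d))
    have : sd (sd d) = d := Subtype.ext (by simp [sd])
    rw [this, star_mul, StarHomClass.map_star, star_star] at h1
    rw [h1, StarHomClass.map_star, star_star]
  -- `V` is defined through elements of `B` only, so it commutes with the commutant of `B`; this
  -- puts its adjoint into the bicommutant.
  have hcomm : ∀ T ∈ Set.centralizer (Set.range Φ), T * V = V * T := by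
    intro T hT
    have hT' : ∀ b ξ, T (Φ b ξ) = Φ b (T ξ) := fun b ξ => by
      rw [← mul_apply_eq_comp, ← mul_apply_eq_comp, hT _ ⟨b, rfl⟩]
    refine (LinearMap.range e).clm_ext_of_orthogonal ?_ ?_
    · rintro _ ⟨x, rfl⟩
      induction x with
      | zero => simp
      | add a b ha hb => rw [map_add, map_add, map_add, ha, hb]
      | tmul d h =>
        rw [mul_apply_eq_comp, mul_apply_eq_comp, hV, hf, hT', he, hT', ← he, hV, hf]
    -- `V` vanishes on the orthogonal complement of `D_s 𝓗`, and `T` preserves that complement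
    -- because `star T` also commutes with `D_s`.
    · intro x hx
      rw [mul_apply_eq_comp, mul_apply_eq_comp, hV0 x hx, map_zero, hV0]
      rintro _ ⟨y, rfl⟩
      induction y with
      | zero => simp
      | add a b ha hb => rw [map_add, inner_add_left, ha, hb, add_zero]
      | tmul d h =>
        have hT'' : Φ (d : B) * star T = star T * Φ (d : B) := by
          have := congrArg star (hT (Φ (star (d : B))) ⟨_, rfl⟩)
          rw [star_mul, star_mul, StarHomClass.map_star, star_star] at this
          exact this.symm
        rw [he, ← ContinuousLinearMap.adjoint_inner_left, ← ContinuousLinearMap.star_eq_adjoint,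
          ← mul_apply_eq_comp, ← hT'']
        exact hx _ ⟨d ⊗ₜ (star T h), rfl⟩
  refine ⟨star V, ⟨⟨star V, ?_, ?_⟩, ?_, ?_⟩, by rw [star_star, hp], by rw [star_star, hp']⟩
  · intro T hT
    have hT' : star T ∈ Set.centralizer (Set.range Φ) := by
      rintro _ ⟨b, rfl⟩
      have := congrArg star (hT (Φ (star (b : B))) ⟨_, rfl⟩)
      rw [star_mul, star_mul, StarHomClass.map_star, star_star] at this
      exact this.symm
    have := congrArg star (hcomm _ hT')
    rw [star_mul, star_mul, star_star] at this
    exact this.symm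
  · have h1 := congrArg star hVp
    have h2 := congrArg star hpV
    rw [star_mul, proj, star_unitProj] at h1 h2
    rw [proj, proj, h1, h2]
  · intro d hd
    exact ⟨_, (ψ.symm ⟨d, hd⟩).2, hdu ⟨d, hd⟩⟩
  · intro d hd
    let M : B →ₗ[ℂ] (𝓗 →L[ℂ] 𝓗) :=
      { toFun := fun b => star V * Φ b
        map_add' := fun b c => by rw [map_add, mul_add]
        map_smul' := fun r b => by rw [map_smul, mul_smul_comm]; rfl }
    let N : Submodule ℂ (𝓗 →L[ℂ] 𝓗) := (δ.spectral s).map (Φ : B →ₗ[ℂ] (𝓗 →L[ℂ] 𝓗))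
    have hN : IsClosed (N : Set (𝓗 →L[ℂ] 𝓗)) := by
      convert isClosed_universalRep_image (δ.isClosed_spectral s) using 1
      ext T
      simp only [N, Submodule.map_coe, Set.mem_image]
      exact ⟨fun ⟨b, hb, h⟩ => ⟨b, hb, h.symm⟩, fun ⟨b, hb, h⟩ => ⟨b, hb, h.symm⟩⟩
    have key := δ.ideal_le (K := N.comap M)
      (hN.preimage (continuous_const.mul continuous_universalRep)) (fun x hx y hy => ?_) hd
    · obtain ⟨b, hb, h⟩ := key
      exact ⟨b, hb, h.symm⟩
    -- With `u = star V` and `x` in `B_{s⁻¹}`, one has `ux = (x*u*)* = ψ(x*)*` in `D_s`, so `uxy*`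
    -- lies in `D_s B_s`, which is contained in `B_s`.
    · let x' : δ.spectral s := ⟨star x, δ.star_mem_spectral' hx⟩
      have h1 : Φ (star x) * V = Φ (ψ x' : B) := by
        have h2 := hdu (ψ x')
        rw [LinearEquiv.symm_apply_apply] at h2
        change Φ (x' : B) * V = _
        rw [← h2, mul_assoc, hp, δ.ideal_mul_proj (ψ x').2]
      have h3 := congrArg star h1
      rw [star_mul, StarHomClass.map_star, star_star] at h3
      refine ⟨star (ψ x' : B) * star y, δ.ideal_mul_spectral (δ.star_mem_ideal (ψ x').2)
        (δ.star_mem_spectral' hy), ?_⟩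
      change Φ (star (ψ x' : B) * star y) = star V * Φ (x * star y)
      rw [map_mul, StarHomClass.map_star, ← h3, map_mul, mul_assoc]

theorem hasUnitaryMultiplier_iff {s : G} : δ.HasUnitaryMultiplier s ↔ δ.HasModuleIso s :=
  ⟨fun ⟨_, hm, h1, h2⟩ => (isUnitaryMultiplier_of_mem hm h1 h2).hasModuleIso,
    hasUnitaryMultiplier_of_hasModuleIso⟩

end Coaction

/-! ### Coordinates of `ℓ²(G, H)` -/

section Coordinates

variable {G : Type*} {H : Type*} [NormedAddCommGroup H] [InnerProductSpace ℂ H]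

open scoped Classical in
/-- The inclusion of `H` into `ℓ²(G, H)` as the coordinate at `r`. -/
def coordIncl (H : Type*) [NormedAddCommGroup H] [InnerProductSpace ℂ H] (r : G) :
    H →L[ℂ] lp (fun _ : G => H) 2 :=
  LinearMap.mkContinuous
    { toFun := fun h => lp.single 2 r h
      map_add' := fun h h' => by simp
      map_smul' := fun c h => by simp } 1 fun h => by
      simp [lp.norm_single]

open scoped Classical in
theorem coordIncl_eq (r : G) (h : H) : coordIncl H r h = lp.single 2 r h := rfl

theorem coordIncl_apply_self (r : G) (h : H) : coordIncl H r h r = h := by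
  classical
  rw [coordIncl_eq, lp.single_apply_self]

theorem coordIncl_apply_ne {r t : G} (hrt : t ≠ r) (h : H) : coordIncl H r h t = 0 := by
  classical
  rw [coordIncl_eq, lp.single_apply_ne _ _ _ hrt]

/-- The coordinate at `r`, as a bounded map `ℓ²(G, H) → H`. -/
def coordProj (H : Type*) [NormedAddCommGroup H] [InnerProductSpace ℂ H] (r : G) :
    lp (fun _ : G => H) 2 →L[ℂ] H :=
  LinearMap.mkContinuous
    { toFun := fun ξ => ξ r
      map_add' := fun h h' => rfl
      map_smul' := fun c h => rfl } 1 fun ξ => by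
      rw [one_mul]; exact lp.norm_apply_le_norm (by norm_num) ξ r

theorem inner_coordIncl (r : G) (h : H) (ξ : lp (fun _ : G => H) 2) :
    ⟪coordIncl H r h, ξ⟫_ℂ = ⟪h, ξ r⟫_ℂ := by
  rw [lp.inner_eq_tsum, tsum_eq_single r, coordIncl_apply_self]
  intro t ht
  rw [coordIncl_apply_ne ht, inner_zero_left]

/-- Bounded operators on `ℓ²(G, H)` that agree on all coordinates are equal. -/
theorem clm_ext_coordIncl {F : Type*} [NormedAddCommGroup F] [NormedSpace ℂ F]
    {S T : lp (fun _ : G => H) 2 →L[ℂ] F} (h : ∀ r x, S (coordIncl H r x) = T (coordIncl H r x)) :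
    S = T := by
  classical
  ext ξ
  have h1 := lp.hasSum_single (E := fun _ : G => H) (p := 2) (by norm_num) ξ
  have h2 := h1.mapL S
  have h3 := h1.mapL T
  refine h2.unique ?_
  convert h3 using 2 with r
  exact h r (ξ r)

theorem leftShift_coordIncl [Group G] (s r : G) (h : H) :
    leftShift H s (coordIncl H r h) = coordIncl H (s * r) h := by
  ext t
  rw [leftShift_apply]
  by_cases ht : t = s * r
  · subst ht
    rw [coordIncl_apply_self, inv_mul_cancel_left, coordIncl_apply_self]
  · rw [coordIncl_apply_ne ht, coordIncl_apply_ne]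
    rintro rfl
    simp at ht

end Coordinates

/-! ### Fourier coefficients of a coaction -/

namespace Coaction

variable {G : Type} [Group G] {B : Type u} [NonUnitalCStarAlgebra B] (δ : Coaction G B)

theorem continuous_hom : Continuous δ.hom := AddMonoidHomClass.continuous_of_bound δ.hom 1
  fun b => by simpa using NonUnitalStarAlgHom.norm_apply_le δ.hom b

/-- The coaction as a bounded linear map. -/
def homL : B →L[ℂ] MinTensor B (GroupCStar G) := ⟨(δ.hom : B →ₗ[ℂ] _), δ.continuous_hom⟩

/-- The left regular representation of `C*(G)`. -/
def regularRep (G : Type) [Group G] : HilbertRep (GroupCStar G) where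
  space := lp (fun _ : G => ℂ) 2
  hom := GroupCStar.regular G

/-- The basis vector of `ℓ²(G)` at `r`. -/
def basisVec (r : G) : (regularRep G).space := coordIncl ℂ r 1

open scoped Classical in
theorem inner_basisVec_elt (r t s : G) :
    ⟪basisVec t, (regularRep G).hom (GroupCStar.elt s) (basisVec r)⟫_ℂ =
      (if s * r = t then 1 else 0 : ℂ) := by
  have h1 : (regularRep G).hom (GroupCStar.elt s) = leftShift ℂ s := GroupCStar.lift_elt _ _ _ s
  rw [h1]
  change ⟪coordIncl ℂ t 1, leftShift ℂ s (coordIncl ℂ r 1)⟫_ℂ = _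
  rw [leftShift_coordIncl, inner_coordIncl]
  split_ifs with h
  · rw [h, coordIncl_apply_self]; simp
  · rw [coordIncl_apply_ne (Ne.symm h)]; simp

/-- The bounded map `b ↦ (ι ⊗ ω)(δ b)`, where `ω` is the matrix coefficient of the regular
representation at `r, t`. It is the identity on `B_s` if `s r = t`, and zero otherwise. -/
def fourier (r t : G) : B →L[ℂ] B :=
  MinTensor.sliceRight (regularRep G) (basisVec r) (basisVec t) ∘L δ.homL

theorem fourier_apply (r t : G) (b : B) :
    δ.fourier r t b = MinTensor.sliceRight (regularRep G) (basisVec r) (basisVec t) (δ.hom b) := rfl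

open scoped Classical in
theorem fourier_of_mem {s : G} {b : B} (hb : b ∈ δ.spectral s) (r t : G) :
    δ.fourier r t b = if s * r = t then b else 0 := by
  rw [fourier_apply, δ.mem_spectral.1 hb, MinTensor.sliceRight_tmul, inner_basisVec_elt]
  split_ifs <;> simp

/-- The linear span of the spectral subspaces. -/
def spectralSpan : Submodule ℂ B := Submodule.span ℂ (⋃ s, (δ.spectral s : Set B))

/-- On `B_s` the diagonal coefficient at `r` is the identity or zero according to whether `s = e`,
independently of `r`; density does the rest. -/
theorem fourier_diag (hd : Dense (δ.spectralSpan : Set B)) (r : G) :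
    δ.fourier r r = δ.fourier 1 1 := by
  ext x
  refine hd.induction (P := fun x => δ.fourier r r x = δ.fourier 1 1 x) ?_
    (isClosed_eq (δ.fourier r r).continuous (δ.fourier 1 1).continuous) x
  intro x hx
  induction hx using Submodule.span_induction with
  | mem x h =>
    obtain ⟨s, hs⟩ := Set.mem_iUnion.1 h
    rw [δ.fourier_of_mem hs, δ.fourier_of_mem hs]
    have h1 : s * r = r ↔ s * 1 = 1 := by rw [mul_eq_right, mul_one]
    by_cases h2 : s * 1 = 1
    · rw [if_pos h2, if_pos (h1.2 h2)]
    · rw [if_neg h2, if_neg (mt h1.1 h2)]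
  | zero => simp
  | add a b _ _ ha hb => rw [map_add, map_add, ha, hb]
  | smul c a _ ha => rw [map_smul, map_smul, ha]

/-- For a normal coaction the conditional expectation `b ↦ (ι ⊗ τ)(δ b)` onto `B_e` is faithful. -/
theorem eq_zero_of_fourier_eq_zero (hδ : δ.IsNormal) (hd : Dense (δ.spectralSpan : Set B)) {x : B}
    (hx : δ.fourier 1 1 (star x * x) = 0) : x = 0 := by
  have h1 : ∀ (π : HilbertRep B) (h h' : π.space) (r t : G),
      MinTensor.coeff π (regularRep G) (h ⊗ₜ basisVec r) (h' ⊗ₜ basisVec t) (δ.hom x) = 0 := by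
    intro π h h' r t
    -- By Cauchy–Schwarz the coefficient of `δ(x)` is bounded by a diagonal coefficient at `r` of
    -- `δ(x*x)`, which equals the one at `e` and hence vanishes.
    have h2 := MinTensor.norm_coeff_sq_le π (regularRep G) (h ⊗ₜ basisVec r) (h' ⊗ₜ basisVec t)
      (δ.hom x)
    rw [← StarHomClass.map_star, ← map_mul,
      ← MinTensor.inner_sliceRight π _ h h (basisVec r) (basisVec r), ← fourier_apply,
      δ.fourier_diag hd, hx, map_zero, zero_apply, inner_zero_right, norm_zero, zero_mul] at h2
    exact norm_eq_zero.1 (pow_eq_zero_iff two_ne_zero |>.1 (le_antisymm h2 (sq_nonneg _)))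
  have h2 : MinTensor.map (NonUnitalStarAlgHom.id ℂ B) (GroupCStar.regular G) (δ.hom x) = 0 := by
    refine MinTensor.eq_zero_of_sliceLeft _ fun π h h' => ?_
    -- Coefficients of `(ι ⊗ λ)(y)` at basis vectors are coefficients of `y` in the regular
    -- representation. So all of them vanish for `y = δ(x)`, and normality applies.
    have hcomp : ∀ y : MinTensor B (GroupCStar G), ∀ r t : G,
        ⟪coordIncl ℂ t (1 : ℂ), MinTensor.sliceLeft π _ h h'
          (MinTensor.map (NonUnitalStarAlgHom.id ℂ B) (GroupCStar.regular G) y)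
            (coordIncl ℂ r (1 : ℂ))⟫_ℂ =
        MinTensor.coeff π (regularRep G) (h ⊗ₜ basisVec r) (h' ⊗ₜ basisVec t) y := by
      intro y r t
      have hc : Continuous (MinTensor.map (NonUnitalStarAlgHom.id ℂ B) (GroupCStar.regular G)) :=
        AddMonoidHomClass.continuous_of_bound _ 1
          fun b => by simpa using NonUnitalStarAlgHom.norm_apply_le _ b
      induction y using MinTensor.induction_on with
      | hc => exact isClosed_eq (by fun_prop) (by fun_prop)
      | h z =>
        induction z with
        | zero => simp
        | add a b ha hb => simp only [map_add, add_apply, inner_add_right, ha, hb]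
        | tmul b c =>
          have h3 := MinTensor.coeff_tmul π (regularRep G) h h' (basisVec r) (basisVec t) b c
          refine Eq.trans ?_ h3.symm
          change ⟪coordIncl ℂ t (1 : ℂ), MinTensor.sliceLeft π _ h h'
            (MinTensor.map (NonUnitalStarAlgHom.id ℂ B) (GroupCStar.regular G)
              (MinTensor.tmul b c)) (coordIncl ℂ r (1 : ℂ))⟫_ℂ = _
          rw [MinTensor.map_tmul, MinTensor.sliceLeft_tmul, smul_apply, inner_smul_right]
          rfl
    refine clm_ext_coordIncl fun r z => ?_
    have hz : coordIncl ℂ r z = z • coordIncl ℂ r (1 : ℂ) := by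
      rw [← map_smul, smul_eq_mul, mul_one]
    rw [hz, map_smul, map_smul, zero_apply]
    congr 1
    ext t
    have h3 := hcomp (δ.hom x) r t
    rw [h1, inner_coordIncl] at h3
    simpa using h3
  refine hδ ?_
  change _ = MinTensor.map (NonUnitalStarAlgHom.id ℂ B) (GroupCStar.regular G) (δ.hom 0)
  rw [map_zero, map_zero]
  exact h2

end Coaction

/-- The linear span of a set that is closed under products and adjoints up to linear
combinations, as a `*`-subalgebra. -/
def NonUnitalStarSubalgebra.ofSpan {A : Type*} [NonUnitalRing A] [StarRing A] [Module ℂ A]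
    [IsScalarTower ℂ A A] [SMulCommClass ℂ A A] [StarModule ℂ A] (S : Set A)
    (hmul : ∀ x ∈ S, ∀ y ∈ S, x * y ∈ Submodule.span ℂ S)
    (hstar : ∀ x ∈ S, star x ∈ Submodule.span ℂ S) : NonUnitalStarSubalgebra ℂ A where
  __ := Submodule.span ℂ S
  mul_mem' {a b} ha hb := by
    change a * b ∈ Submodule.span ℂ S
    induction ha using Submodule.span_induction with
    | mem x hx =>
      induction hb using Submodule.span_induction with
      | mem y hy => exact hmul x hx y hy
      | zero => rw [mul_zero]; exact zero_mem _
      | add y z _ _ hy hz => rw [mul_add]; exact add_mem hy hz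
      | smul c y _ hy => rw [mul_smul_comm]; exact Submodule.smul_mem _ c hy
    | zero => rw [zero_mul]; exact zero_mem _
    | add y z _ _ hy hz => rw [add_mul]; exact add_mem hy hz
    | smul c y _ hy => rw [smul_mul_assoc]; exact Submodule.smul_mem _ c hy
  star_mem' {a} ha := by
    change star a ∈ Submodule.span ℂ S
    induction ha using Submodule.span_induction with
    | mem x hx => exact hstar x hx
    | zero => rw [star_zero]; exact zero_mem _
    | add y z _ _ hy hz => rw [star_add]; exact add_mem hy hz
    | smul c y _ hy => rw [star_smul]; exact Submodule.smul_mem _ _ hy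

/-! ### Partial actions as graphs, and the extended maps `ᾱ_{t⁻¹}` -/

namespace PartialAction

variable {G : Type} [Group G] {A : Type u} [NonUnitalCStarAlgebra A] (α : PartialAction G A)

/-- The graph of `α_s`: `x ∈ D_{s⁻¹}` and `α_s x = y`. -/
def Rel (s : G) (x y : A) : Prop := ∃ h : x ∈ α.ideal s⁻¹, (α.equiv s ⟨x, h⟩ : A) = y

variable {α}

theorem Rel.mem_left {s : G} {x y : A} (h : α.Rel s x y) : x ∈ α.ideal s⁻¹ := h.1

theorem Rel.mem_right {s : G} {x y : A} (h : α.Rel s x y) : y ∈ α.ideal s := by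
  obtain ⟨h, rfl⟩ := h
  exact (α.equiv s ⟨x, h⟩).2

theorem Rel.right_unique {s : G} {x y z : A} (h : α.Rel s x y) (h' : α.Rel s x z) : y = z := by
  obtain ⟨h, rfl⟩ := h
  obtain ⟨h', rfl⟩ := h'
  rfl

theorem Rel.left_unique {s : G} {x y z : A} (h : α.Rel s x z) (h' : α.Rel s y z) : x = y := by
  obtain ⟨h, rfl⟩ := h
  obtain ⟨h', h2⟩ := h'
  exact congrArg Subtype.val ((α.equiv s).injective (Subtype.ext h2)).symm

theorem exists_rel {s : G} {x : A} (hx : x ∈ α.ideal s⁻¹) : ∃ y, α.Rel s x y := ⟨_, hx, rfl⟩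

theorem exists_rel_left {s : G} {y : A} (hy : y ∈ α.ideal s) : ∃ x, α.Rel s x y :=
  ⟨(α.equiv s).symm ⟨y, hy⟩, Subtype.prop _, by simp⟩

theorem Rel.add {s : G} {x y x' y' : A} (h : α.Rel s x y) (h' : α.Rel s x' y') :
    α.Rel s (x + x') (y + y') := by
  obtain ⟨h, rfl⟩ := h
  obtain ⟨h', rfl⟩ := h'
  refine ⟨add_mem h h', ?_⟩
  have := map_add (α.equiv s) ⟨x, h⟩ ⟨x', h'⟩
  exact congrArg Subtype.val this

theorem Rel.smul {s : G} {x y : A} (c : ℂ) (h : α.Rel s x y) : α.Rel s (c • x) (c • y) := by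
  obtain ⟨h, rfl⟩ := h
  refine ⟨SMulMemClass.smul_mem c h, ?_⟩
  have := map_smul (α.equiv s) c ⟨x, h⟩
  exact congrArg Subtype.val this

theorem Rel.mul {s : G} {x y x' y' : A} (h : α.Rel s x y) (h' : α.Rel s x' y') :
    α.Rel s (x * x') (y * y') := by
  obtain ⟨h, rfl⟩ := h
  obtain ⟨h', rfl⟩ := h'
  refine ⟨mul_mem h h', ?_⟩
  have := map_mul (α.equiv s) ⟨x, h⟩ ⟨x', h'⟩
  exact congrArg Subtype.val this

theorem Rel.star {s : G} {x y : A} (h : α.Rel s x y) : α.Rel s (star x) (star y) := by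
  obtain ⟨h, rfl⟩ := h
  refine ⟨star_mem h, ?_⟩
  have := StarHomClass.map_star (α.equiv s) ⟨x, h⟩
  exact congrArg Subtype.val this

theorem Rel.norm_eq {s : G} {x y : A} (h : α.Rel s x y) : ‖x‖ = ‖y‖ := by
  obtain ⟨h, rfl⟩ := h
  have := α.isClosed s
  have := α.isClosed s⁻¹
  exact (StarAlgEquiv.norm_map (α.equiv s) ⟨x, h⟩).symm

theorem Rel.comp {s t : G} {x y z : A} (h : α.Rel t x y) (h' : α.Rel s y z) :
    α.Rel (s * t) x z := by
  obtain ⟨h, rfl⟩ := h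
  obtain ⟨h', rfl⟩ := h'
  obtain ⟨h2, h3⟩ := α.extend s t ⟨x, h⟩ h'
  exact ⟨h2, h3⟩

theorem mem_ideal_one (x : A) : x ∈ α.ideal 1 := by
  rw [α.ideal_one]; exact NonUnitalStarAlgebra.mem_top

/-- The extension axiom gives `α_e ∘ α_e = α_e`, and `α_e` is injective with domain `A`, hence the
identity. -/
theorem rel_one (x : A) : α.Rel 1 x x := by
  obtain ⟨y, hy⟩ := α.exists_rel (s := 1) (x := x) (by rw [inv_one]; exact mem_ideal_one x)
  obtain ⟨z, hz⟩ := α.exists_rel (s := 1) (x := y) (by rw [inv_one]; exact mem_ideal_one y)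
  have h1 := hy.comp hz
  rw [one_mul] at h1
  have h2 := h1.right_unique hy
  subst h2
  have h3 := hy.left_unique hz
  subst h3
  exact hy

theorem rel_one_iff {x y : A} : α.Rel 1 x y ↔ x = y :=
  ⟨fun h => (rel_one x).right_unique h, fun h => h ▸ rel_one x⟩

/-- `α_{s⁻¹} ∘ α_s` is a restriction of `α_e`, which is the identity. -/
theorem Rel.inv {s : G} {x y : A} (h : α.Rel s x y) : α.Rel s⁻¹ y x := by
  obtain ⟨z, hz⟩ := α.exists_rel (s := s⁻¹) (x := y) (by rw [inv_inv]; exact h.mem_right)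
  have h1 := h.comp hz
  rw [inv_mul_cancel, rel_one_iff] at h1
  rwa [h1]

variable (π : HilbertRep A)

variable (α) in
/-- The canonical extension of `π ∘ α_{t⁻¹}` from `D_t` to `A`. -/
def ext (t : G) (a : A) : π.space →L[ℂ] π.space :=
  idealExt (α.ideal t) (α.mul_mem_left t) (α.twist π t) a

variable (α) in
/-- The linear span of the vectors `π(d) h` with `d ∈ D_{t⁻¹}`. -/
def essSpan (t : G) : Submodule ℂ π.space :=
  Submodule.span ℂ {η | ∃ d ∈ α.ideal t⁻¹, ∃ h, η = π.hom d h}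

theorem norm_ext_le (t : G) (a : A) : ‖α.ext π t a‖ ≤ ‖a‖ :=
  norm_idealExt_le _ _ _ (α.isClosed t) a

variable {π}

/-- Here `e = α_{t⁻¹}(a α_t(d))`. Together with the vanishing on the orthogonal complement
(`ext_eq_zero`) this formula determines the operator, and the algebraic rules for `ext` are checked
on these two kinds of vectors. -/
theorem ext_apply {t : G} {a d d' e : A} (hd : α.Rel t d d') (he : α.Rel t e (a * d'))
    (h : π.space) : α.ext π t a (π.hom d h) = π.hom e h := by
  have hs : ∀ {x y : A} (hxy : α.Rel t x y), α.twist π t ⟨y, hxy.mem_right⟩ = π.hom x := by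
    rintro x _ ⟨hx, rfl⟩
    change π.hom ((α.equiv t).symm (α.equiv t ⟨x, hx⟩) : A) = _
    rw [StarAlgEquiv.symm_apply_apply]
  have h1 := idealExt_apply (α.ideal t) (α.mul_mem_left t) (α.twist π t) (α.isClosed t) a
    ⟨d', hd.mem_right⟩ h
  rw [hs hd] at h1
  rw [ext, h1]
  exact congrArg (fun T => T h) (hs he)

theorem ext_eq_zero {t : G} (a : A) {ξ : π.space} (hξ : ξ ∈ (α.essSpan π t)ᗮ) :
    α.ext π t a ξ = 0 := by
  have h1 : (essentialSpace (α.ideal t) (α.twist π t)).orthogonalProjectionOnto ξ = 0 := by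
    rw [Submodule.orthogonalProjectionOnto_eq_zero_iff, essentialSpace,
      Submodule.orthogonal_closure]
    rintro _ ⟨x, rfl⟩
    induction x with
    | zero => simp
    | add a b ha hb => rw [map_add, inner_add_left, ha, hb, add_zero]
    | tmul d h =>
      refine hξ _ (Submodule.subset_span ⟨((α.equiv t).symm d : A), Subtype.prop _, h, rfl⟩)
  rw [ext, idealExt, ContinuousLinearMap.comp_apply, h1, map_zero]

theorem ext_apply_mem {t : G} (a : A) {d : A} (hd : d ∈ α.ideal t⁻¹) (h : π.space) :
    ∃ d' e, α.Rel t d d' ∧ α.Rel t e (a * d') ∧ α.ext π t a (π.hom d h) = π.hom e h := by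
  obtain ⟨d', hd'⟩ := α.exists_rel hd
  obtain ⟨e, he⟩ := α.exists_rel_left (α.mul_mem_left t a d' hd'.mem_right)
  exact ⟨d', e, hd', he, ext_apply hd' he h⟩

theorem clm_ext_essSpan {t : G} {F : Type*} [NormedAddCommGroup F] [NormedSpace ℂ F]
    {S T : π.space →L[ℂ] F} (h1 : ∀ d ∈ α.ideal t⁻¹, ∀ h, S (π.hom d h) = T (π.hom d h))
    (h2 : ∀ ξ ∈ (α.essSpan π t)ᗮ, S ξ = T ξ) : S = T := by
  refine (α.essSpan π t).clm_ext_of_orthogonal (fun x hx => ?_) h2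
  induction hx using Submodule.span_induction with
  | mem x h =>
    obtain ⟨d, hd, h, rfl⟩ := h
    exact h1 d hd h
  | zero => simp
  | add a b _ _ ha hb => rw [map_add, map_add, ha, hb]
  | smul c a _ ha => rw [map_smul, map_smul, ha]

theorem ext_add (t : G) (a b : A) : α.ext π t (a + b) = α.ext π t a + α.ext π t b := by
  refine clm_ext_essSpan (α := α) (t := t) (fun d hd h => ?_) fun ξ hξ => ?_
  · obtain ⟨d', e, hd', he, h1⟩ := ext_apply_mem a hd h
    obtain ⟨d'', e', hd'', he', h2⟩ := ext_apply_mem b hd h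
    obtain rfl := hd'.right_unique hd''
    have h3 := he.add he'
    rw [← add_mul] at h3
    rw [add_apply, h1, h2, ext_apply hd' h3, map_add, add_apply]
  · rw [add_apply, ext_eq_zero _ hξ, ext_eq_zero _ hξ, ext_eq_zero _ hξ, add_zero]

theorem ext_smul (t : G) (c : ℂ) (a : A) : α.ext π t (c • a) = c • α.ext π t a := by
  refine clm_ext_essSpan (α := α) (t := t) (fun d hd h => ?_) fun ξ hξ => ?_
  · obtain ⟨d', e, hd', he, h1⟩ := ext_apply_mem a hd h
    have h3 := he.smul c
    rw [← smul_mul_assoc] at h3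
    rw [smul_apply, h1, ext_apply hd' h3, map_smul, smul_apply]
  · rw [smul_apply, ext_eq_zero _ hξ, ext_eq_zero _ hξ, smul_zero]

theorem ext_mul (t : G) (a b : A) : α.ext π t (a * b) = α.ext π t a * α.ext π t b := by
  refine clm_ext_essSpan (α := α) (t := t) (fun d hd h => ?_) fun ξ hξ => ?_
  · obtain ⟨d', e, hd', he, h1⟩ := ext_apply_mem b hd h
    obtain ⟨d'', e', hd'', he', h2⟩ := ext_apply_mem a he.mem_left h
    obtain rfl := he.right_unique hd''
    rw [← mul_assoc] at he'
    rw [mul_apply_eq_comp, h1, h2, ext_apply hd' he']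
  · rw [mul_apply_eq_comp, ext_eq_zero _ hξ, ext_eq_zero _ hξ, map_zero]

theorem inner_hom_left (b : A) (x y : π.space) :
    ⟪π.hom b x, y⟫_ℂ = ⟪x, π.hom (star b) y⟫_ℂ := by
  rw [StarHomClass.map_star, ContinuousLinearMap.star_eq_adjoint,
    ContinuousLinearMap.adjoint_inner_right]

/-- On essential vectors the claim is `e*c = d*f`, and `α_t` sends both sides to `d'*ac'`. -/
theorem ext_star (t : G) (a : A) : α.ext π t (star a) = star (α.ext π t a) := by
  refine clm_ext_essSpan (α := α) (t := t) (fun d hd h => ?_) fun ξ hξ => ?_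
  · obtain ⟨d', e, hd', he, h1⟩ := ext_apply_mem (star a) hd h
    rw [h1]
    have key : innerSL ℂ (π.hom e h) = innerSL ℂ (π.hom d h) ∘L α.ext π t a := by
      refine clm_ext_essSpan (α := α) (t := t) (fun c hc k => ?_) fun ξ hξ => ?_
      · obtain ⟨c', f, hc', hf, h2⟩ := ext_apply_mem a hc k
        rw [ContinuousLinearMap.comp_apply, h2, innerSL_apply_apply, innerSL_apply_apply,
          inner_hom_left, inner_hom_left, ← mul_apply_eq_comp, ← mul_apply_eq_comp, ← map_mul,
          ← map_mul]
        have h3 := he.star.mul hc'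
        have h4 := hd'.star.mul hf
        rw [star_mul, star_star, mul_assoc] at h3
        rw [h3.left_unique h4]
      · rw [ContinuousLinearMap.comp_apply, ext_eq_zero _ hξ, map_zero, innerSL_apply_apply]
        exact hξ _ (Submodule.subset_span ⟨e, he.mem_left, h, rfl⟩)
    refine ext_inner_right ℂ fun η => ?_
    have := congrArg (fun T => T η) key
    rw [ContinuousLinearMap.star_eq_adjoint, ContinuousLinearMap.adjoint_inner_left]
    exact this
  · rw [ext_eq_zero _ hξ]
    refine ext_inner_right ℂ fun η => ?_
    rw [ContinuousLinearMap.star_eq_adjoint, ContinuousLinearMap.adjoint_inner_left,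
      inner_zero_left]
    have key : (0 : π.space →L[ℂ] ℂ) = innerSL ℂ ξ ∘L α.ext π t a := by
      refine clm_ext_essSpan (α := α) (t := t) (fun c hc k => ?_) fun ξ' hξ' => ?_
      · obtain ⟨c', f, hc', hf, h2⟩ := ext_apply_mem a hc k
        rw [ContinuousLinearMap.comp_apply, h2, innerSL_apply_apply, zero_apply]
        exact ((Submodule.mem_orthogonal' _ _).1 hξ _
          (Submodule.subset_span ⟨f, hf.mem_left, k, rfl⟩)).symm
      · rw [ContinuousLinearMap.comp_apply, ext_eq_zero _ hξ', map_zero, zero_apply]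
    exact congrArg (fun T => T η) key

theorem ext_one (a : A) : α.ext π 1 a = π.hom a := by
  refine clm_ext_essSpan (α := α) (t := 1) (fun d hd h => ?_) fun ξ hξ => ?_
  · rw [ext_apply (rel_one d) (rel_one (a * d)), map_mul, mul_apply_eq_comp]
  · rw [ext_eq_zero _ hξ]
    refine ext_inner_right ℂ fun η => ?_
    rw [inner_zero_left, inner_hom_left]
    refine ((Submodule.mem_orthogonal' _ _).1 hξ _
      (Submodule.subset_span ⟨star a, ?_, η, rfl⟩)).symm
    rw [inv_one]; exact mem_ideal_one _

/-- The adjoint operator has its range in the closed span of the vectors `π(f)k` with `f` in both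
ideals: if `α_{sr}(f) = a*c'` lies in `E_s`, then `α_{s⁻¹}` applies to it, so `α_r(f)` is defined as
well. -/
theorem ext_eq_zero_of_mem {s r : G} {a : A} (ha : a ∈ α.ideal s) {ξ : π.space}
    (hξ : ∀ d ∈ α.ideal (s * r)⁻¹, d ∈ α.ideal r⁻¹ → ∀ h, ⟪π.hom d h, ξ⟫_ℂ = 0) :
    α.ext π (s * r) a ξ = 0 := by
  refine ext_inner_left ℂ fun η => ?_
  rw [inner_zero_right, ← star_star a, ext_star, ContinuousLinearMap.star_eq_adjoint,
    ContinuousLinearMap.adjoint_inner_right, ← inner_conj_symm]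
  have key : innerSL ℂ ξ ∘L α.ext π (s * r) (star a) = 0 := by
    refine clm_ext_essSpan (α := α) (t := s * r) (fun c hc k => ?_) fun ξ' hξ' => ?_
    · obtain ⟨c', f, hc', hf, h2⟩ := ext_apply_mem (star a) hc k
      rw [ContinuousLinearMap.comp_apply, h2, innerSL_apply_apply, zero_apply]
      obtain ⟨z, hz⟩ := α.exists_rel (s := s⁻¹) (x := star a * c')
        (by rw [inv_inv]; exact α.mul_mem_right s _ _ (star_mem ha))
      have h3 := hf.comp hz
      rw [inv_mul_cancel_left] at h3
      rw [← inner_conj_symm, hξ f hf.mem_left h3.mem_left k, map_zero]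
    · rw [ContinuousLinearMap.comp_apply, ext_eq_zero _ hξ', map_zero, zero_apply]
  have h3 : ⟪ξ, α.ext π (s * r) (star a) η⟫_ℂ = 0 := congrArg (fun T => T η) key
  rw [h3, map_zero]

/-- This is the covariance `ᾱ_{(sr)⁻¹}(a) = ᾱ_{r⁻¹}(α_{s⁻¹}(a))`, the source of the product and
adjoint formulas for the generators. The two essential spaces differ in general. However, both
operators vanish on the orthogonal complement of the vectors coming from the intersection of the
domains of `α_{sr}` and `α_r`, and on that intersection `α_{sr} = α_s ∘ α_r`. -/
theorem ext_rel {s : G} {a' a : A} (h : α.Rel s a' a) (r : G) :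
    α.ext π (s * r) a = α.ext π r a' := by
  refine (Submodule.span ℂ {η | ∃ d ∈ α.ideal (s * r)⁻¹, d ∈ α.ideal r⁻¹ ∧
    ∃ h, η = π.hom d h}).clm_ext_of_orthogonal (fun x hx => ?_) fun ξ hξ => ?_
  · induction hx using Submodule.span_induction with
    | mem x hx =>
      obtain ⟨d, hd, hd', k, rfl⟩ := hx
      obtain ⟨d₂, e, hd₂, he, h1⟩ := ext_apply_mem a hd k
      obtain ⟨d₁, f, hd₁, hf, h2⟩ := ext_apply_mem a' hd' k
      have h3 := hd₁.inv.comp hd₂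
      rw [mul_inv_cancel_right] at h3
      rw [h1, h2, he.left_unique (hf.comp (h.mul h3))]
    | zero => simp
    | add a b _ _ ha hb => rw [map_add, map_add, ha, hb]
    | smul c a _ ha => rw [map_smul, map_smul, ha]
  · have h0 : ∀ d ∈ α.ideal (s * r)⁻¹, d ∈ α.ideal r⁻¹ → ∀ h, ⟪π.hom d h, ξ⟫_ℂ = 0 :=
      fun d hd hd' k => hξ _ (Submodule.subset_span ⟨d, hd, hd', k, rfl⟩)
    rw [ext_eq_zero_of_mem h.mem_right h0]
    have h1 := ext_eq_zero_of_mem (α := α) (π := π) (s := s⁻¹) (r := s * r) (a := a') (ξ := ξ)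
      h.mem_left (by
        rw [inv_mul_cancel_left]
        exact fun d hd hd' => h0 d hd' hd)
    rw [inv_mul_cancel_left] at h1
    exact h1.symm

/-! ### The generators of the reduced crossed product -/

theorem regOp_apply (a : A) (s : G) (ξ : lp (fun _ : G => π.space) 2) (t : G) :
    α.regOp π a s ξ t = α.ext π t a (ξ (s⁻¹ * t)) := rfl

theorem regOp_add (a b : A) (s : G) :
    α.regOp π (a + b) s = α.regOp π a s + α.regOp π b s := by
  ext ξ t
  have : (α.regOp π a s + α.regOp π b s) ξ t = α.regOp π a s ξ t + α.regOp π b s ξ t := rfl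
  rw [this, regOp_apply, regOp_apply, regOp_apply, ext_add, add_apply]

theorem regOp_smul (c : ℂ) (a : A) (s : G) : α.regOp π (c • a) s = c • α.regOp π a s := by
  ext ξ t
  have : (c • α.regOp π a s) ξ t = c • α.regOp π a s ξ t := rfl
  rw [this, regOp_apply, regOp_apply, ext_smul, smul_apply]

/-- By covariance `ᾱ_{t⁻¹}(a)` is the extension of `a'` at the index `s⁻¹t`, the index at which `b`
acts after the shift, so the two coefficients multiply. -/
theorem regOp_mul {s : G} {a' a b c : A} (ha : α.Rel s a' a) (hc : α.Rel s (a' * b) c) (r : G) :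
    α.regOp π a s * α.regOp π b r = α.regOp π c (s * r) := by
  ext ξ t
  rw [mul_apply_eq_comp, regOp_apply, regOp_apply, regOp_apply]
  have h1 := ext_rel (π := π) ha (s⁻¹ * t)
  have h2 := ext_rel (π := π) hc (s⁻¹ * t)
  rw [mul_inv_cancel_left] at h1 h2
  rw [h1, h2, ext_mul, mul_apply_eq_comp, mul_inv_rev, mul_assoc]

theorem regOp_star {s : G} {a' a : A} (ha : α.Rel s a' a) :
    star (α.regOp π a s) = α.regOp π (star a') s⁻¹ := by
  symm
  rw [ContinuousLinearMap.star_eq_adjoint, ContinuousLinearMap.eq_adjoint_iff]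
  intro η ξ
  rw [lp.inner_eq_tsum, lp.inner_eq_tsum, ← (Equiv.mulLeft s⁻¹).tsum_eq]
  refine tsum_congr fun t => ?_
  rw [Equiv.coe_mulLeft, regOp_apply, regOp_apply, inv_inv, mul_inv_cancel_left, ext_star,
    ContinuousLinearMap.star_eq_adjoint, ContinuousLinearMap.adjoint_inner_left]
  have h1 := ext_rel (π := π) ha (s⁻¹ * t)
  rw [mul_inv_cancel_left] at h1
  rw [h1]

/-- `xb` lies in `E_r`, so `c` is in the range of `α_s ∘ α_r`, which `α_{sr}` extends. -/
theorem mem_ideal_mul {s r : G} {x b c : A} (hc : α.Rel s (x * b) c) (hb : b ∈ α.ideal r) :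
    c ∈ α.ideal (s * r) := by
  obtain ⟨z, hz⟩ := α.exists_rel_left (α.mul_mem_left r x b hb)
  exact (hz.comp hc).mem_right

theorem gen_add (s : G) (a b : α.ideal s) : α.gen s (a + b) = α.gen s a + α.gen s b :=
  Subtype.ext (regOp_add _ _ _)

theorem gen_smul (s : G) (c : ℂ) (a : α.ideal s) : α.gen s (c • a) = c • α.gen s a :=
  Subtype.ext (regOp_smul _ _ _)

theorem gen_mul {s r : G} {a' a b c : A} (ha : α.Rel s a' a) (hb : b ∈ α.ideal r)
    (hc : α.Rel s (a' * b) c) :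
    α.gen s ⟨a, ha.mem_right⟩ * α.gen r ⟨b, hb⟩ = α.gen (s * r) ⟨c, mem_ideal_mul hc hb⟩ :=
  Subtype.ext (regOp_mul ha hc r)

theorem gen_star {s : G} {a' a : A} (ha : α.Rel s a' a) :
    star (α.gen s ⟨a, ha.mem_right⟩) = α.gen s⁻¹ ⟨star a', star_mem ha.mem_left⟩ :=
  Subtype.ext (regOp_star ha)

variable (α) in
/-- The set of the canonical generators `a m_s`. -/
def genSet : Set α.ReducedCrossedProduct := {x | ∃ s a, x = α.gen s a}

/-- Products and adjoints of generators are again generators, so their linear span is already a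
`*`-algebra. -/
theorem dense_span_genSet : Dense (Submodule.span ℂ α.genSet : Set α.ReducedCrossedProduct) := by
  let S : Set (lp (fun _ : G => (universalRep A).space) 2 →L[ℂ]
      lp (fun _ : G => (universalRep A).space) 2) :=
    {T | ∃ (s : G), ∃ a ∈ α.ideal s, T = α.regOp (universalRep A) a s}
  let N := NonUnitalStarSubalgebra.ofSpan S
    (by
      rintro _ ⟨s, a, ha, rfl⟩ _ ⟨r, b, hb, rfl⟩
      obtain ⟨a', ha⟩ := α.exists_rel_left ha
      obtain ⟨c, hc⟩ := α.exists_rel (α.mul_mem_right _ b a' ha.mem_left)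
      exact Submodule.subset_span ⟨_, c, mem_ideal_mul hc hb, regOp_mul ha hc r⟩)
    (by
      rintro _ ⟨s, a, ha, rfl⟩
      obtain ⟨a', ha⟩ := α.exists_rel_left ha
      exact Submodule.subset_span ⟨_, _, star_mem ha.mem_left, regOp_star ha⟩)
  have hle : NonUnitalStarAlgebra.adjoin ℂ S ≤ N :=
    NonUnitalStarAlgebra.adjoin_le Submodule.subset_span
  rintro ⟨x, hx⟩
  have hx1 : x ∈ closure ((NonUnitalStarAlgebra.adjoin ℂ S : NonUnitalStarSubalgebra ℂ _) :
    Set (lp (fun _ : G => (universalRep A).space) 2 →L[ℂ]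
      lp (fun _ : G => (universalRep A).space) 2)) := hx
  have hx2 := closure_mono (SetLike.coe_subset_coe.2 hle) hx1
  let ι : α.ReducedCrossedProduct →ₗ[ℂ] (lp (fun _ : G => (universalRep A).space) 2 →L[ℂ]
      lp (fun _ : G => (universalRep A).space) 2) :=
    { toFun := Subtype.val, map_add' := fun _ _ => rfl, map_smul' := fun _ _ => rfl }
  have himg : ι '' (Submodule.span ℂ α.genSet : Set α.ReducedCrossedProduct) =
      (Submodule.span ℂ S : Set _) := by
    rw [← Submodule.map_coe, Submodule.map_span]
    congr 2
    ext T
    constructor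
    · rintro ⟨_, ⟨s, a, rfl⟩, rfl⟩
      exact ⟨s, a, a.2, rfl⟩
    · rintro ⟨s, a, ha, rfl⟩
      exact ⟨_, ⟨s, ⟨a, ha⟩, rfl⟩, rfl⟩
  have hemb : Topology.IsInducing ι := Topology.IsInducing.subtypeVal
  rw [hemb.closure_eq_preimage_closure_image, himg]
  exact hx2

variable (α) in
/-- The diagonal entry at `r` of an element of the reduced crossed product. -/
def diag (r : G) :
    α.ReducedCrossedProduct →L[ℂ] ((universalRep A).space →L[ℂ] (universalRep A).space) :=
  LinearMap.mkContinuous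
    { toFun := fun y => coordProj _ r ∘L (y.1 ∘L coordIncl _ r)
      map_add' := fun x y => by ext h; rfl
      map_smul' := fun c y => by ext h; rfl }
    (‖(coordProj (universalRep A).space r)‖ * ‖coordIncl (universalRep A).space r‖) fun y => by
      refine (ContinuousLinearMap.opNorm_comp_le _ _).trans ?_
      rw [mul_assoc]
      refine mul_le_mul_of_nonneg_left ?_ (norm_nonneg _)
      rw [mul_comm]
      exact ContinuousLinearMap.opNorm_comp_le _ _

theorem diag_apply (r : G) (y : α.ReducedCrossedProduct) (h : (universalRep A).space) :
    α.diag r y h = y.1 (coordIncl _ r h) r := rfl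

theorem diag_gen_one (r : G) (a : α.ideal 1) :
    α.diag r (α.gen 1 a) = α.ext (universalRep A) r (a : A) := by
  ext h
  rw [diag_apply]
  change α.regOp _ _ _ _ _ = _
  rw [regOp_apply, inv_one, one_mul, coordIncl_apply_self]

theorem diag_gen_ne {s : G} (hs : s ≠ 1) (r : G) (a : α.ideal s) : α.diag r (α.gen s a) = 0 := by
  ext h
  rw [diag_apply]
  change α.regOp _ _ _ _ _ = _
  rw [regOp_apply, coordIncl_apply_ne (by simpa using hs), map_zero, zero_apply]

/-- On the span of the generators the entry at every `r` is `ᾱ_{r⁻¹}(a)` for one and the same `a`,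
and the entry at `e` is `a` in a faithful representation. -/
theorem norm_diag_le (r : G) (y : α.ReducedCrossedProduct) : ‖α.diag r y‖ ≤ ‖α.diag 1 y‖ := by
  refine dense_span_genSet.induction (P := fun y => ‖α.diag r y‖ ≤ ‖α.diag 1 y‖) ?_
    (isClosed_le (by fun_prop) (by fun_prop)) y
  intro y hy
  have : ∃ a : A, ∀ r, α.diag r y = α.ext (universalRep A) r a := by
    induction hy using Submodule.span_induction with
    | mem x h =>
      obtain ⟨s, a, rfl⟩ := h
      by_cases hs : s = 1
      · subst hs
        exact ⟨a, fun r => diag_gen_one r a⟩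
      · refine ⟨0, fun r => ?_⟩
        have := ext_smul (α := α) (π := universalRep A) r 0 0
        rw [zero_smul, zero_smul] at this
        rw [diag_gen_ne hs, this]
    | zero =>
      refine ⟨0, fun r => ?_⟩
      have := ext_smul (α := α) (π := universalRep A) r 0 0
      rw [zero_smul, zero_smul] at this
      rw [map_zero, this]
    | add x y _ _ hx hy =>
      obtain ⟨a, ha⟩ := hx
      obtain ⟨b, hb⟩ := hy
      exact ⟨a + b, fun r => by rw [map_add, ha, hb, ext_add]⟩
    | smul c x _ hx =>
      obtain ⟨a, ha⟩ := hx
      exact ⟨c • a, fun r => by rw [map_smul, ha, ext_smul]⟩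
  obtain ⟨a, ha⟩ := this
  rw [ha, ha, ext_one, norm_universalRep]
  exact norm_ext_le _ r a

/-- The conditional expectation of the reduced crossed product onto `A` is faithful. -/
theorem eq_zero_of_diag_eq_zero {x : α.ReducedCrossedProduct}
    (hx : α.diag 1 (star x * x) = 0) : x = 0 := by
  have h1 : ∀ r, α.diag r (star x * x) = 0 := fun r => by
    have := norm_diag_le r (star x * x)
    rw [hx, norm_zero] at this
    exact norm_le_zero_iff.1 this
  refine Subtype.ext (clm_ext_coordIncl fun r h => ?_)
  change x.1 _ = (0 : _ →L[ℂ] _) _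
  -- The squared norm of `x` applied to the vector `h` at `r` is a coefficient of the diagonal entry
  -- of `x*x` at `r`.
  rw [zero_apply, ← inner_self_eq_zero (𝕜 := ℂ), ← ContinuousLinearMap.adjoint_inner_right,
    inner_coordIncl]
  have h2 := congrArg (fun T => T h) (h1 r)
  rw [diag_apply, zero_apply] at h2
  change ⟪h, (star x * x).1 (coordIncl _ r h) r⟫_ℂ = 0
  rw [h2, inner_zero_right]

theorem gen_congr {s t : G} (hst : s = t) {a : α.ideal s} {b : α.ideal t} (hab : (a : A) = b) :
    α.gen s a = α.gen t b := by
  subst hst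
  rw [Subtype.ext hab]

variable (α) in
/-- The canonical embedding `a ↦ a m_e` of `A` in the reduced crossed product. -/
def genOne : A →⋆ₙₐ[ℂ] α.ReducedCrossedProduct where
  toFun a := α.gen 1 ⟨a, mem_ideal_one a⟩
  map_smul' c a := gen_smul 1 c ⟨a, mem_ideal_one a⟩
  map_zero' := by
    have h := gen_smul (α := α) 1 0 ⟨0, mem_ideal_one 0⟩
    rw [zero_smul, zero_smul] at h
    exact h
  map_add' a b := gen_add 1 ⟨a, mem_ideal_one a⟩ ⟨b, mem_ideal_one b⟩
  map_mul' a b := ((gen_mul (rel_one a) (mem_ideal_one b) (rel_one (a * b))).trans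
    (gen_congr (one_mul 1) rfl)).symm
  map_star' a := ((gen_star (rel_one a)).trans (gen_congr inv_one rfl)).symm

theorem diag_genOne (r : G) (a : A) : α.diag r (α.genOne a) = α.ext (universalRep A) r a :=
  diag_gen_one r _

theorem genOne_injective : Function.Injective α.genOne := fun a b h => by
  apply universalRep_injective (B := A)
  rw [← ext_one (α := α), ← ext_one (α := α), ← diag_genOne, ← diag_genOne, h]

/-- The factor `m_s` cancels. This is why `B_s` and `D_s` agree as left Hilbert modules. -/
theorem gen_mul_star (s : G) (a b : α.ideal s) :
    α.gen s a * star (α.gen s b) = α.genOne (a * star (b : A)) := by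
  obtain ⟨a', ha⟩ := α.exists_rel_left a.2
  obtain ⟨b', hb⟩ := α.exists_rel_left b.2
  rw [show star (α.gen s b) = _ from gen_star hb]
  exact (gen_mul ha _ (ha.mul hb.star)).trans (gen_congr (mul_inv_cancel s) rfl)

theorem norm_gen (s : G) (a : α.ideal s) : ‖α.gen s a‖ = ‖(a : A)‖ := by
  have h1 := congrArg norm (gen_mul_star s a a)
  rw [CStarRing.norm_self_mul_star, NonUnitalStarAlgHom.norm_map _ genOne_injective,
    CStarRing.norm_self_mul_star] at h1
  exact (mul_self_inj (norm_nonneg _) (norm_nonneg _)).1 h1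

end PartialAction

/-! ### Functoriality of the minimal tensor product -/

theorem NonUnitalStarAlgHom.continuous_cstar {A B : Type*} [NonUnitalCStarAlgebra A]
    [NonUnitalCStarAlgebra B] (φ : A →⋆ₙₐ[ℂ] B) : Continuous φ :=
  AddMonoidHomClass.continuous_of_bound φ 1
    fun b => by simpa using NonUnitalStarAlgHom.norm_apply_le φ b

namespace MinTensor

variable {B : Type u} [NonUnitalCStarAlgebra B] {C : Type v} [NonUnitalCStarAlgebra C]
  {B' : Type u} [NonUnitalCStarAlgebra B'] {C' : Type v} [NonUnitalCStarAlgebra C']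
  {B'' : Type u} [NonUnitalCStarAlgebra B''] {C'' : Type v} [NonUnitalCStarAlgebra C'']

theorem hom_ext {F : Type*} [NonUnitalCStarAlgebra F] {S T : MinTensor B C →⋆ₙₐ[ℂ] F}
    (h : ∀ b c, S (tmul b c) = T (tmul b c)) (y : MinTensor B C) : S y = T y := by
  have := clm_ext (S := ⟨(S : MinTensor B C →ₗ[ℂ] F), S.continuous_cstar⟩)
    (T := ⟨(T : MinTensor B C →ₗ[ℂ] F), T.continuous_cstar⟩) h
  exact congrArg (fun T => T y) this

theorem map_map (φ : B →⋆ₙₐ[ℂ] B') (ψ : C →⋆ₙₐ[ℂ] C') (φ' : B' →⋆ₙₐ[ℂ] B'')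
    (ψ' : C' →⋆ₙₐ[ℂ] C'') (y : MinTensor B C) :
    map φ' ψ' (map φ ψ y) = map (φ'.comp φ) (ψ'.comp ψ) y :=
  hom_ext (S := (map φ' ψ').comp (map φ ψ)) (fun b c => by
    rw [NonUnitalStarAlgHom.comp_apply, map_tmul, map_tmul, map_tmul]; rfl) y

theorem map_id (y : MinTensor B C) :
    map (NonUnitalStarAlgHom.id ℂ B) (NonUnitalStarAlgHom.id ℂ C) y = y :=
  hom_ext (T := NonUnitalStarAlgHom.id ℂ _) (fun b c => by rw [map_tmul]; rfl) y

theorem map_symm_map (θ : B ≃⋆ₐ[ℂ] B') (y : MinTensor B C) :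
    map (θ.symm : B' →⋆ₙₐ[ℂ] B) (NonUnitalStarAlgHom.id ℂ C)
      (map (θ : B →⋆ₙₐ[ℂ] B') (NonUnitalStarAlgHom.id ℂ C) y) = y := by
  rw [map_map]
  have h : (θ.symm : B' →⋆ₙₐ[ℂ] B).comp (θ : B →⋆ₙₐ[ℂ] B') = NonUnitalStarAlgHom.id ℂ B :=
    NonUnitalStarAlgHom.ext fun b => θ.symm_apply_apply b
  rw [h]
  exact map_id y

end MinTensor

/-- A copy of the graded structure of the reduced crossed product of `α` inside the
coaction `δ`. -/
structure PartialAction.Model {G : Type} [Group G] {A : Type u} [NonUnitalCStarAlgebra A]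
    (α : PartialAction G A) {B : Type u} [NonUnitalCStarAlgebra B] (δ : Coaction G B) where
  equiv : B ≃⋆ₐ[ℂ] α.ReducedCrossedProduct
  mem_spectral : ∀ s a, equiv.symm (α.gen s a) ∈ δ.spectral s

/-! ### Spectral subspaces of a dual coaction -/

namespace PartialAction.Model

variable {G : Type} [Group G] {A : Type u} [NonUnitalCStarAlgebra A]
    {α : PartialAction G A} {B : Type u} [NonUnitalCStarAlgebra B] {δ : Coaction G B}

/-- An equivariant isomorphism with a normalised dual coaction gives a model. -/
def ofIsIsomorphic {ε : Coaction G α.ReducedCrossedProduct} (hε : α.IsNormalisedDual ε)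
    (θ : B ≃⋆ₐ[ℂ] α.ReducedCrossedProduct)
    (hθ : ∀ b : B, ε.hom (θ b) = MinTensor.map (θ : B →⋆ₙₐ[ℂ] α.ReducedCrossedProduct)
      (NonUnitalStarAlgHom.id ℂ (GroupCStar G)) (δ.hom b)) : α.Model δ where
  equiv := θ
  mem_spectral s a := by
    rw [Coaction.mem_spectral]
    have h1 := hθ (θ.symm (α.gen s a))
    rw [StarAlgEquiv.apply_symm_apply, hε] at h1
    have h2 := congrArg (MinTensor.map (θ.symm : α.ReducedCrossedProduct →⋆ₙₐ[ℂ] B)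
      (NonUnitalStarAlgHom.id ℂ (GroupCStar G))) h1
    rw [MinTensor.map_symm_map, MinTensor.map_tmul] at h2
    exact h2.symm

variable (M : α.Model δ)

/-- The element `a m_s` of `B`. -/
def gen (s : G) : α.ideal s →ₗ[ℂ] B where
  toFun a := M.equiv.symm (α.gen s a)
  map_add' a b := by rw [gen_add, map_add]
  map_smul' c a := by rw [gen_smul, map_smul]; rfl

theorem gen_apply (s : G) (a : α.ideal s) : M.gen s a = M.equiv.symm (α.gen s a) := rfl

theorem norm_gen (s : G) (a : α.ideal s) : ‖M.gen s a‖ = ‖(a : A)‖ := by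
  rw [gen_apply, StarAlgEquiv.norm_map, PartialAction.norm_gen]

theorem gen_mem (s : G) (a : α.ideal s) : M.gen s a ∈ δ.spectral s := M.mem_spectral s a

/-- The copy of `A` in `B`. -/
def base : A →⋆ₙₐ[ℂ] B := (M.equiv.symm : α.ReducedCrossedProduct →⋆ₙₐ[ℂ] B).comp α.genOne

theorem base_apply (a : A) : M.base a = M.equiv.symm (α.genOne a) := rfl

theorem base_injective : Function.Injective M.base :=
  M.equiv.symm.injective.comp genOne_injective

theorem gen_mul_star (s : G) (a b : α.ideal s) :
    M.gen s a * star (M.gen s b) = M.base (a * star (b : A)) := by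
  rw [gen_apply, gen_apply, ← StarHomClass.map_star, ← map_mul, PartialAction.gen_mul_star,
    base_apply]

theorem base_mul_gen (c : A) (s : G) (a : α.ideal s) :
    M.base c * M.gen s a = M.gen s ⟨c * a, α.mul_mem_left s c a a.2⟩ := by
  rw [gen_apply, gen_apply, base_apply, ← map_mul]
  congr 1
  exact (gen_mul (rel_one c) a.2 (rel_one _)).trans (gen_congr (one_mul s) rfl)

theorem gen_injective (s : G) : Function.Injective (M.gen s) := by
  rw [injective_iff_map_eq_zero]
  intro a ha
  have := M.norm_gen s a
  rw [ha, norm_zero] at this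
  exact Subtype.ext (norm_eq_zero.1 this.symm)

theorem isClosed_range_gen (s : G) : IsClosed (Set.range (M.gen s)) := by
  have h1 : Isometry (M.gen s) := AddMonoidHomClass.isometry_of_norm _ (M.norm_gen s)
  have : CompleteSpace (α.ideal s) := (α.isClosed s).completeSpace_coe
  exact h1.isClosedEmbedding.isClosed_range

theorem dense_span : Dense (Submodule.span ℂ {x | ∃ s a, x = M.gen s a} : Set B) := by
  have h1 := (M.equiv.symm.surjective.denseRange).dense_image
    (StarAlgEquiv.isometry M.equiv.symm).continuous α.dense_span_genSet
  convert h1 using 1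
  let L : α.ReducedCrossedProduct →ₗ[ℂ] B :=
    { toFun := M.equiv.symm, map_add' := map_add _, map_smul' := map_smul M.equiv.symm }
  change _ = L '' _
  rw [← Submodule.map_coe, Submodule.map_span]
  congr 2
  ext x
  constructor
  · rintro ⟨s, a, rfl⟩
    exact ⟨_, ⟨s, a, rfl⟩, rfl⟩
  · rintro ⟨_, ⟨s, a, rfl⟩, rfl⟩
    exact ⟨s, a, rfl⟩

/-- The spectral subspaces of a dual coaction are the subspaces `D_s m_s`. -/
theorem exists_gen_of_mem {s : G} {x : B} (hx : x ∈ δ.spectral s) : ∃ a, M.gen s a = x := by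
  classical
  have h1 : δ.fourier 1 s x = x := by rw [δ.fourier_of_mem hx, mul_one, if_pos rfl]
  rw [← h1]
  -- The Fourier coefficient at `s` fixes generators of degree `s` and kills those of other degrees.
  -- As the range of `gen` in degree `s` is closed, it receives the image of all of `B`.
  refine M.dense_span.induction (P := fun x => δ.fourier 1 s x ∈ Set.range (M.gen s)) ?_
    ((M.isClosed_range_gen s).preimage (δ.fourier 1 s).continuous) x
  intro x hx
  induction hx using Submodule.span_induction with
  | mem x h =>
    obtain ⟨t, a, rfl⟩ := h
    rw [δ.fourier_of_mem (M.gen_mem t a), mul_one]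
    split_ifs with hts
    · subst hts
      exact ⟨a, rfl⟩
    · exact ⟨0, map_zero _⟩
  | zero => exact ⟨0, by simp⟩
  | add y z _ _ hy hz =>
    obtain ⟨a, ha⟩ := hy
    obtain ⟨b, hb⟩ := hz
    exact ⟨a + b, by rw [map_add, map_add, ha, hb]⟩
  | smul c y _ hy =>
    obtain ⟨a, ha⟩ := hy
    exact ⟨c • a, by rw [map_smul, map_smul, ha]⟩

/-- An approximate unit of `E_s` makes `d` a limit of elements `ed`, and `ed` is the inner product
of `e m_s` and `d* m_s`. -/
theorem base_mem_ideal {s : G} {d : A} (hd : d ∈ α.ideal s) : M.base d ∈ δ.ideal s := by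
  have h1 := (α.ideal s).mem_closure_mul_of_star_mem (α.isClosed s)
    (mul_mem hd (star_mem hd))
  refine closure_minimal (t := {d | M.base d ∈ δ.ideal s}) ?_
    ((δ.isClosed_ideal s).preimage M.base.continuous_cstar) h1
  rintro _ ⟨e, he, rfl⟩
  have := M.gen_mul_star s ⟨e, he⟩ ⟨star d, star_mem hd⟩
  rw [star_star] at this
  change M.base (e * d) ∈ δ.ideal s
  rw [← this]
  exact δ.mul_star_mem_ideal (M.gen_mem _ _) (M.gen_mem _ _)

theorem exists_base_of_mem_ideal {s : G} {x : B} (hx : x ∈ δ.ideal s) :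
    ∃ d ∈ α.ideal s, M.base d = x := by
  let K : Submodule ℂ B := (α.ideal s).toSubmodule.map (M.base : A →ₗ[ℂ] B)
  have hK : IsClosed (K : Set B) :=
    (NonUnitalStarAlgHom.isometry _ M.base_injective).isClosedEmbedding.isClosedMap _
      (α.isClosed s)
  have h1 : δ.ideal s ≤ K := by
    refine δ.ideal_le hK fun x hx y hy => ?_
    obtain ⟨a, rfl⟩ := M.exists_gen_of_mem hx
    obtain ⟨b, rfl⟩ := M.exists_gen_of_mem hy
    rw [gen_mul_star]
    have hab : (a * star (b : A) : A) ∈ α.ideal s := mul_mem a.2 (star_mem b.2)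
    exact ⟨_, hab, rfl⟩
  obtain ⟨d, hd, h⟩ := h1 hx
  exact ⟨d, hd, h⟩

/-- The isomorphism drops `m_s`: it sends `a m_s` to `a m_e`. -/
theorem hasModuleIso (M : α.Model δ) (s : G) : δ.HasModuleIso s := by
  let e₁ : α.ideal s ≃ₗ[ℂ] δ.spectral s :=
    LinearEquiv.ofBijective ((M.gen s).codRestrict (δ.spectral s) (M.gen_mem s))
      ⟨fun a b h => M.gen_injective s (congrArg Subtype.val h), fun x => by
        obtain ⟨a, ha⟩ := M.exists_gen_of_mem x.2
        exact ⟨a, Subtype.ext ha⟩⟩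
  let L : α.ideal s →ₗ[ℂ] δ.ideal s :=
    { toFun := fun a => ⟨M.base a, M.base_mem_ideal a.2⟩
      map_add' := fun a b => Subtype.ext (map_add M.base (a : A) b)
      map_smul' := fun c a => Subtype.ext (map_smul M.base c (a : A)) }
  let e₂ : α.ideal s ≃ₗ[ℂ] δ.ideal s :=
    LinearEquiv.ofBijective L
      ⟨fun a b h => Subtype.ext (M.base_injective (congrArg Subtype.val h)), fun x => by
        obtain ⟨d, hd, h⟩ := M.exists_base_of_mem_ideal x.2
        exact ⟨⟨d, hd⟩, Subtype.ext h⟩⟩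
  have h₁ : ∀ a, (e₁ a : B) = M.gen s a := fun a => rfl
  have h₂ : ∀ a, (e₂ a : B) = M.base a := fun a => rfl
  refine ⟨e₁.symm.trans e₂, fun d x => ?_, fun x y => ?_⟩
  · obtain ⟨a, rfl⟩ := e₁.surjective x
    obtain ⟨c, rfl⟩ := e₂.surjective d
    have : (⟨(e₂ c : B) * (e₁ a : B), δ.ideal_mul_spectral (e₂ c).2 (e₁ a).2⟩ : δ.spectral s) =
        e₁ ⟨c * a, α.mul_mem_left s c a a.2⟩ := Subtype.ext (M.base_mul_gen c s a)
    rw [this]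
    simp only [LinearEquiv.trans_apply, LinearEquiv.symm_apply_apply, h₂, map_mul]
  · obtain ⟨a, rfl⟩ := e₁.surjective x
    obtain ⟨b, rfl⟩ := e₁.surjective y
    simp only [LinearEquiv.trans_apply, LinearEquiv.symm_apply_apply, h₁, h₂]
    rw [gen_mul_star, map_mul, StarHomClass.map_star]

end PartialAction.Model

/-! ### Multiplicativity implies generation -/

namespace PartialAction

variable {n : ℕ} {A : Type u} [NonUnitalCStarAlgebra A]
    {α : PartialAction (FreeGroup (Fin n)) A} {B : Type u} [NonUnitalCStarAlgebra B]
    {δ : Coaction (FreeGroup (Fin n)) B}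

theorem mem_pmap {G : Type} [Group G] {α : PartialAction G A} {s : G} {x y : A} :
    y ∈ α.pmap s x ↔ α.Rel s x y := Iff.rfl

theorem IsMultiplicative.exists_rel_cons (hα : α.IsMultiplicative) {l : Fin n × Bool}
    {w : List (Fin n × Bool)} (hw : FreeGroup.IsReduced (l :: w)) {x y : A}
    (h : α.Rel (FreeGroup.mk (l :: w)) x y) :
    ∃ z, α.Rel (FreeGroup.mk w) x z ∧ α.Rel (FreeGroup.mk [l]) z y := by
  have hw' : FreeGroup.IsReduced w := hw.infix (List.suffix_cons l w).isInfix
  have h1 := hα _ hw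
  rw [List.map_cons, List.foldr_cons, ← hα _ hw'] at h1
  rw [← mem_pmap, h1] at h
  obtain ⟨z, hz, hy⟩ := Part.mem_bind_iff.1 h
  exact ⟨z, hz, hy⟩

theorem Rel.sub_norm_eq {G : Type} [Group G] {α : PartialAction G A} {s : G} {x y x' y' : A}
    (h : α.Rel s x y) (h' : α.Rel s x' y') : ‖x - x'‖ = ‖y - y'‖ := by
  have := h.add (h'.smul (-1))
  simpa [sub_eq_add_neg] using this.norm_eq

/-- Induction on the length of a reduced word `lw`. Multiplicativity gives `z` in `E_w` with `α_l(z)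
= a`. For `e` in `E_w` the product `(a m_l)(e m_w)` equals `α_l(ze) m_{lw}`, which approaches `a
m_{lw}` as `ze` approaches `z`. -/
theorem Model.generatesCStar (M : α.Model δ) (hα : α.IsMultiplicative) :
    GeneratesCStar ((δ.spectral 1 : Set B) ∪ ⋃ i, (δ.spectral (FreeGroup.of i) : Set B)) := by
  set S := (δ.spectral 1 : Set B) ∪ ⋃ i, (δ.spectral (FreeGroup.of i) : Set B)
  set N := (NonUnitalStarAlgebra.adjoin ℂ S).topologicalClosure with hN
  have hNc : IsClosed (N : Set B) := NonUnitalStarSubalgebra.isClosed_topologicalClosure _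
  have hS : ∀ x ∈ S, x ∈ N := fun x hx =>
    NonUnitalStarSubalgebra.le_topologicalClosure _ (NonUnitalStarAlgebra.subset_adjoin ℂ _ hx)
  have hletter : ∀ l : Fin n × Bool, ∀ x ∈ δ.spectral (FreeGroup.mk [l]), x ∈ N := by
    rintro ⟨i, b⟩ x hx
    cases b with
    | true => exact hS x (Or.inr (Set.mem_iUnion.2 ⟨i, hx⟩))
    | false =>
      have h1 : (FreeGroup.mk [(i, false)] : FreeGroup (Fin n)) = (FreeGroup.of i)⁻¹ := rfl
      rw [h1] at hx
      rw [← star_star x]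
      exact star_mem (hS _ (Or.inr (Set.mem_iUnion.2 ⟨i, δ.star_mem_spectral' hx⟩)))
  have hword : ∀ w : List (Fin n × Bool), FreeGroup.IsReduced w →
      ∀ a : α.ideal (FreeGroup.mk w), M.gen _ a ∈ N := by
    intro w
    induction w with
    | nil => exact fun _ a => hS _ (Or.inl (M.gen_mem _ a))
    | cons l w ih =>
      intro hw a
      have hw' : FreeGroup.IsReduced w := hw.infix (List.suffix_cons l w).isInfix
      obtain ⟨x, hx⟩ := α.exists_rel_left a.2
      obtain ⟨z, hxz, hza⟩ := hα.exists_rel_cons hw hx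
      -- Approximating `star z` from the left is the same as approximating `z` from the right, which
      -- is where the factor from `E_w` is needed.
      have h1 := (α.ideal (FreeGroup.mk w)).mem_closure_mul_of_star_mem (α.isClosed _)
        (x := star z) (mul_mem (star_mem hxz.mem_right) (star_mem (star_mem hxz.mem_right)))
      have h2 : M.gen _ a ∈ closure (N : Set B) := by
        rw [Metric.mem_closure_iff] at h1 ⊢
        intro η hη
        obtain ⟨_, ⟨e, he, rfl⟩, hd⟩ := h1 η hη
        obtain ⟨c, hc⟩ := α.exists_rel (α.mul_mem_right _ (star e) z hza.mem_left)
        refine ⟨M.gen _ ⟨a, hza.mem_right⟩ * M.gen _ ⟨star e, star_mem he⟩,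
          mul_mem (hletter l _ (M.gen_mem _ _)) (ih hw' _), ?_⟩
        have h3 := gen_mul hza (star_mem he) hc
        rw [M.gen_apply, M.gen_apply, M.gen_apply, ← map_mul, h3, dist_eq_norm, ← map_sub,
          StarAlgEquiv.norm_map]
        have h4 : α.gen (FreeGroup.mk (l :: w)) a =
            α.gen (FreeGroup.mk [l] * FreeGroup.mk w) ⟨a, a.2⟩ := rfl
        rw [h4]
        have h5 : ∀ {s : FreeGroup (Fin n)} (a b : α.ideal s),
            ‖α.gen s a - α.gen s b‖ = ‖(a : A) - b‖ := fun {s} a b => by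
          have := PartialAction.norm_gen s (a + (-1 : ℂ) • b)
          rw [gen_add, gen_smul] at this
          simpa [sub_eq_add_neg] using this
        rw [h5, ← hza.sub_norm_eq hc, ← norm_star]
        simpa [dist_eq_norm] using hd
      rwa [hNc.closure_eq] at h2
  have hall : ∀ s (a : α.ideal s), M.gen s a ∈ N := by
    intro s
    have h1 := hword s.toWord FreeGroup.isReduced_toWord
    rwa [FreeGroup.mk_toWord] at h1
  rw [GeneratesCStar, ← hN, eq_top_iff]
  intro x _
  refine closure_minimal (t := (N : Set B)) ?_ hNc (M.dense_span x)
  have h2 : Submodule.span ℂ {x | ∃ s a, x = M.gen s a} ≤ N.toSubmodule := by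
    rw [Submodule.span_le]
    rintro _ ⟨s, a, rfl⟩
    exact hall s a
  exact h2

end PartialAction

theorem Coaction.IsMultiplicativeDual.generates_and_hasModuleIso {n : ℕ} {B : Type u}
    [NonUnitalCStarAlgebra B] {δ : Coaction (FreeGroup (Fin n)) B} (h : δ.IsMultiplicativeDual) :
    GeneratesCStar ((δ.spectral 1 : Set B) ∪ ⋃ i, (δ.spectral (FreeGroup.of i) : Set B)) ∧
      ∀ i, δ.HasModuleIso (FreeGroup.of i) := by
  obtain ⟨A, _, α, ε, hα, hε, θ, hθ⟩ := h
  let M := PartialAction.Model.ofIsIsomorphic hε θ hθ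
  exact ⟨M.generatesCStar hα, fun i => M.hasModuleIso _⟩

/-! ### Partial automorphisms as closed graphs -/

/-- An isometric image of a complete space is complete. This gives closedness of domains, ranges and
compositions of graphs. -/
theorem NonUnitalStarSubalgebra.isClosed_map_of_norm_eq {X Y : Type*} [NonUnitalCStarAlgebra X]
    [NonUnitalCStarAlgebra Y] (T : NonUnitalStarSubalgebra ℂ X) (hT : IsClosed (T : Set X))
    (φ : X →⋆ₙₐ[ℂ] Y) (h : ∀ x ∈ T, ‖φ x‖ = ‖x‖) : IsClosed (T.map φ : Set Y) := by
  have := hT.completeSpace_coe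
  let L : T →ₗ[ℂ] Y := (φ : X →ₗ[ℂ] Y) ∘ₗ T.toSubmodule.subtype
  have hL : Isometry L := AddMonoidHomClass.isometry_of_norm L fun x => h x x.2
  convert hL.isClosedEmbedding.isClosed_range using 1
  ext y
  constructor
  · rintro ⟨x, hx, rfl⟩
    exact ⟨⟨x, hx⟩, rfl⟩
  · rintro ⟨x, rfl⟩
    exact ⟨x, x.2, rfl⟩

/-- A partial automorphism of a `C*`-algebra, an isomorphism between two closed ideals, given by
its graph. -/
structure PartialAut (A : Type*) [NonUnitalCStarAlgebra A] where
  graph : NonUnitalStarSubalgebra ℂ (A × A)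
  isClosed : IsClosed (graph : Set (A × A))
  norm_eq : ∀ {x y}, (x, y) ∈ graph → ‖x‖ = ‖y‖
  left : ∀ {x y}, (x, y) ∈ graph → ∀ a, ∃ y', (a * x, y') ∈ graph
  right : ∀ {x y}, (x, y) ∈ graph → ∀ a, ∃ x', (x', a * y) ∈ graph

namespace PartialAut

variable {A : Type*} [NonUnitalCStarAlgebra A] (f g : PartialAut A)

variable {f} in
theorem right_unique {x y z : A} (h : (x, y) ∈ f.graph) (h' : (x, z) ∈ f.graph) : y = z := by
  have h1 := f.norm_eq (x := x - x) (y := y - z) (sub_mem h h')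
  rw [sub_self, norm_zero] at h1
  exact sub_eq_zero.1 (norm_eq_zero.1 h1.symm)

variable {f} in
theorem left_unique {x y z : A} (h : (x, z) ∈ f.graph) (h' : (y, z) ∈ f.graph) : x = y := by
  have h1 := f.norm_eq (x := x - y) (y := z - z) (sub_mem h h')
  rw [sub_self, norm_zero] at h1
  exact sub_eq_zero.1 (norm_eq_zero.1 h1)

/-- The range of a partial automorphism. -/
def ran : NonUnitalStarSubalgebra ℂ A := f.graph.map (NonUnitalStarAlgHom.snd ℂ A A)

theorem mem_ran {y : A} : y ∈ f.ran ↔ ∃ x, (x, y) ∈ f.graph := by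
  constructor
  · rintro ⟨⟨x, _⟩, h, rfl⟩
    exact ⟨x, h⟩
  · rintro ⟨x, h⟩
    exact ⟨(x, y), h, rfl⟩

theorem isClosed_ran : IsClosed (f.ran : Set A) := by
  refine f.graph.isClosed_map_of_norm_eq f.isClosed _ ?_
  rintro ⟨x, y⟩ h
  change ‖y‖ = max ‖x‖ ‖y‖
  rw [f.norm_eq h, max_self]

theorem mul_mem_ran (a : A) {y : A} (hy : y ∈ f.ran) : a * y ∈ f.ran := by
  obtain ⟨x, h⟩ := f.mem_ran.1 hy
  exact f.mem_ran.2 (f.right h a)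

theorem mem_ran_mul (a : A) {y : A} (hy : y ∈ f.ran) : y * a ∈ f.ran := by
  rw [← star_star (y * a), star_mul]
  exact star_mem (f.mul_mem_ran _ (star_mem hy))

/-- The inverse of a partial automorphism. -/
def inv : PartialAut A where
  graph := f.graph.comap ((NonUnitalStarAlgHom.snd ℂ A A).prod (NonUnitalStarAlgHom.fst ℂ A A))
  isClosed := f.isClosed.preimage continuous_swap
  norm_eq h := (f.norm_eq h).symm
  left h a := f.right h a
  right h a := f.left h a

theorem mem_ran_inv {x : A} : x ∈ f.inv.ran ↔ ∃ y, (x, y) ∈ f.graph := f.inv.mem_ran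

variable (A) in
/-- The identity as a partial automorphism. -/
protected def id : PartialAut A where
  graph :=
    { carrier := {p | p.1 = p.2}
      add_mem' := fun hp hq => congrArg₂ (· + ·) hp hq
      zero_mem' := rfl
      mul_mem' := fun hp hq => congrArg₂ (· * ·) hp hq
      smul_mem' := fun c _ hp => congrArg (c • ·) hp
      star_mem' := fun hp => congrArg star hp }
  isClosed := isClosed_eq continuous_fst continuous_snd
  norm_eq h := congrArg norm h
  left _ _ := ⟨_, rfl⟩
  right _ _ := ⟨_, rfl⟩

/-- The graph of `f ∘ g`. -/
def compGraph : NonUnitalStarSubalgebra ℂ (A × A) where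
  carrier := {p | ∃ z, (p.1, z) ∈ g.graph ∧ (z, p.2) ∈ f.graph}
  add_mem' := by
    rintro p q ⟨z, h1, h2⟩ ⟨z', h1', h2'⟩
    exact ⟨z + z', add_mem h1 h1', add_mem h2 h2'⟩
  zero_mem' := ⟨0, zero_mem _, zero_mem _⟩
  mul_mem' := by
    rintro p q ⟨z, h1, h2⟩ ⟨z', h1', h2'⟩
    exact ⟨z * z', mul_mem h1 h1', mul_mem h2 h2'⟩
  smul_mem' := by
    rintro c p ⟨z, h1, h2⟩
    exact ⟨c • z, SMulMemClass.smul_mem c h1, SMulMemClass.smul_mem c h2⟩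
  star_mem' := by
    rintro p ⟨z, h1, h2⟩
    exact ⟨star z, star_mem h1, star_mem h2⟩

/-- The composed graph is the image of the closed set of triples `(x, g x, f (g x))`. The three
entries have equal norms, so forgetting the middle one is isometric for the maximum norm. -/
theorem isClosed_compGraph : IsClosed (compGraph f g : Set (A × A)) := by
  let φ₁ : A × A × A →⋆ₙₐ[ℂ] A × A := (NonUnitalStarAlgHom.fst ℂ A (A × A)).prod
    ((NonUnitalStarAlgHom.fst ℂ A A).comp (NonUnitalStarAlgHom.snd ℂ A (A × A)))
  let φ₂ : A × A × A →⋆ₙₐ[ℂ] A × A := NonUnitalStarAlgHom.snd ℂ A (A × A)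
  let φ : A × A × A →⋆ₙₐ[ℂ] A × A := (NonUnitalStarAlgHom.fst ℂ A (A × A)).prod
    ((NonUnitalStarAlgHom.snd ℂ A A).comp (NonUnitalStarAlgHom.snd ℂ A (A × A)))
  let T : NonUnitalStarSubalgebra ℂ (A × A × A) := g.graph.comap φ₁ ⊓ f.graph.comap φ₂
  have hT : IsClosed (T : Set (A × A × A)) :=
    (g.isClosed.preimage φ₁.continuous_cstar).inter (f.isClosed.preimage φ₂.continuous_cstar)
  have hφ : ∀ x ∈ T, ‖φ x‖ = ‖x‖ := by
    rintro ⟨x, z, y⟩ ⟨h1, h2⟩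
    have h3 : ‖x‖ = ‖z‖ := g.norm_eq h1
    have h4 : ‖z‖ = ‖y‖ := f.norm_eq h2
    change max ‖x‖ ‖y‖ = max ‖x‖ (max ‖z‖ ‖y‖)
    rw [h3, h4, max_self, max_self]
  have h := T.isClosed_map_of_norm_eq hT φ hφ
  suffices (compGraph f g : Set (A × A)) = T.map φ by rw [this]; exact h
  refine Set.ext fun ⟨x, y⟩ => ?_
  constructor
  · rintro ⟨z, h1, h2⟩
    exact ⟨(x, z, y), ⟨h1, h2⟩, rfl⟩
  · rintro ⟨⟨x, z, y⟩, ⟨h1, h2⟩, h3⟩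
    obtain ⟨rfl, rfl⟩ := Prod.mk.inj h3
    exact ⟨z, h1, h2⟩

/-- The domain of `f ∘ g` is closed, and `x` is a limit of `ex` with `e` in the domain of `g`. The
element `aex` is mapped by `g` to `g(ae)g(x)`, which lies in the domain of `f` because `g(x)` does.
-/
theorem left_compGraph {x y : A} (h : (x, y) ∈ compGraph f g) (a : A) :
    ∃ y', (a * x, y') ∈ compGraph f g := by
  obtain ⟨z, h1, h2⟩ := h
  have hx : x ∈ g.inv.ran := g.mem_ran_inv.2 ⟨z, h1⟩
  have hcl := g.inv.ran.mem_closure_mul_of_star_mem g.inv.isClosed_ran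
    (mul_mem hx (star_mem hx))
  let φ := NonUnitalStarAlgHom.fst ℂ A A
  have hD : IsClosed ((compGraph f g).map φ : Set A) := by
    refine (compGraph f g).isClosed_map_of_norm_eq (isClosed_compGraph f g) _ ?_
    rintro ⟨x, y⟩ ⟨z, h1, h2⟩
    have h3 : ‖x‖ = ‖z‖ := g.norm_eq h1
    have h4 : ‖z‖ = ‖y‖ := f.norm_eq h2
    change ‖x‖ = max ‖x‖ ‖y‖
    rw [h3, h4, max_self]
  have key : a * x ∈ (compGraph f g).map φ := by
    refine closure_minimal (t := {x | a * x ∈ (compGraph f g).map φ}) ?_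
      (hD.preimage (continuous_const.mul continuous_id)) hcl
    rintro _ ⟨e, he, rfl⟩
    obtain ⟨e', he'⟩ := g.mem_ran_inv.1 he
    obtain ⟨w, hw⟩ := g.left he' a
    obtain ⟨y', hy'⟩ := f.left h2 w
    refine ⟨(a * (e * x), y'), ⟨w * z, ?_, hy'⟩, rfl⟩
    rw [← mul_assoc]
    exact mul_mem hw h1
  obtain ⟨⟨_, y'⟩, h3, rfl⟩ := key
  exact ⟨_, h3⟩

/-- The composition `f ∘ g` of partial automorphisms, with its natural domain. -/
def comp : PartialAut A where
  graph := compGraph f g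
  isClosed := isClosed_compGraph f g
  norm_eq := by
    rintro x y ⟨z, h1, h2⟩
    exact (g.norm_eq h1).trans (f.norm_eq h2)
  left h a := left_compGraph f g h a
  right := by
    rintro x y ⟨z, h1, h2⟩ a
    -- The condition on ranges is the condition on domains for the inverse `g⁻¹ ∘ f⁻¹`.
    obtain ⟨x', z', h3, h4⟩ := left_compGraph g.inv f.inv (x := y) (y := x) ⟨z, h2, h1⟩ a
    exact ⟨x', z', h4, h3⟩

section EquivOfGraph

variable {D E : NonUnitalStarSubalgebra ℂ A} (hD : ∀ x, x ∈ D ↔ ∃ y, (x, y) ∈ f.graph)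
  (hE : ∀ y, y ∈ E ↔ ∃ x, (x, y) ∈ f.graph)

/-- The image of an element of the domain of a partial automorphism. -/
def image (x : D) : A := ((hD x).1 x.2).choose

theorem image_mem (x : D) : ((x : A), f.image hD x) ∈ f.graph := ((hD x).1 x.2).choose_spec

/-- The isomorphism between two ideals given by the graph of a partial automorphism. -/
def equivOfGraph : D ≃⋆ₐ[ℂ] E where
  toFun x := ⟨f.image hD x, (hE _).2 ⟨x, f.image_mem hD x⟩⟩
  invFun y := ⟨f.inv.image hE y, (hD _).2 ⟨y, f.inv.image_mem hE y⟩⟩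
  left_inv x := Subtype.ext (left_unique (f.inv.image_mem hE _) (f.image_mem hD x))
  right_inv y := Subtype.ext (right_unique (f.image_mem hD _) (f.inv.image_mem hE y))
  map_mul' x y := Subtype.ext (right_unique (f.image_mem hD _)
    (mul_mem (f.image_mem hD x) (f.image_mem hD y)))
  map_add' x y := Subtype.ext (right_unique (f.image_mem hD _)
    (add_mem (f.image_mem hD x) (f.image_mem hD y)))
  map_star' x := Subtype.ext (right_unique (f.image_mem hD _) (star_mem (f.image_mem hD x)))
  map_smul' c x := Subtype.ext (right_unique (f.image_mem hD _)
    (SMulMemClass.smul_mem c (f.image_mem hD x)))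

theorem equivOfGraph_mem (x : D) : ((x : A), (f.equivOfGraph hD hE x : A)) ∈ f.graph :=
  f.image_mem hD x

end EquivOfGraph

/-! ### Words in partial automorphisms -/

variable {ι : Type} (base : ι → PartialAut A)

/-- The partial automorphism attached to a generator or the inverse of one. -/
def letter (l : ι × Bool) : PartialAut A := if l.2 then base l.1 else (base l.1).inv

theorem mem_letter_not (i : ι) (b : Bool) {x y : A} :
    (x, y) ∈ (letter base (i, !b)).graph ↔ (y, x) ∈ (letter base (i, b)).graph := by
  cases b <;> exact Iff.rfl

/-- The composition of the partial automorphisms along a word. -/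
def word : List (ι × Bool) → PartialAut A
  | [] => PartialAut.id A
  | l :: w => (letter base l).comp (word w)

theorem mem_word_cons {l : ι × Bool} {w : List (ι × Bool)} {x y : A} :
    (x, y) ∈ (word base (l :: w)).graph ↔
      ∃ z, (x, z) ∈ (word base w).graph ∧ (z, y) ∈ (letter base l).graph := Iff.rfl

theorem mem_word_singleton {l : ι × Bool} {x y : A} :
    (x, y) ∈ (word base [l]).graph ↔ (x, y) ∈ (letter base l).graph := by
  rw [mem_word_cons]
  constructor
  · rintro ⟨z, hz, h⟩
    obtain rfl : x = z := hz
    exact h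
  · exact fun h => ⟨x, rfl, h⟩

theorem mem_word_append {w w' : List (ι × Bool)} {x y : A} :
    (x, y) ∈ (word base (w ++ w')).graph ↔
      ∃ z, (x, z) ∈ (word base w').graph ∧ (z, y) ∈ (word base w).graph := by
  induction w generalizing y with
  | nil =>
    constructor
    · exact fun h => ⟨y, h, rfl⟩
    · rintro ⟨z, h, hz⟩
      obtain rfl : z = y := hz
      exact h
  | cons l w ih =>
    constructor
    · rintro ⟨z, h1, h2⟩
      obtain ⟨z', h3, h4⟩ := ih.1 h1
      exact ⟨z', h3, z, h4, h2⟩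
    · rintro ⟨z', h3, z, h4, h2⟩
      exact ⟨z, ih.2 ⟨z', h3, h4⟩, h2⟩

theorem mem_word_invRev {w : List (ι × Bool)} {x y : A} :
    (x, y) ∈ (word base (FreeGroup.invRev w)).graph ↔ (y, x) ∈ (word base w).graph := by
  induction w generalizing x with
  | nil => exact eq_comm
  | cons l w ih =>
    have h1 : FreeGroup.invRev (l :: w) = FreeGroup.invRev w ++ [(l.1, !l.2)] := by
      simp [FreeGroup.invRev]
    rw [h1, mem_word_append, mem_word_cons]
    refine exists_congr fun z => ?_
    rw [mem_word_singleton, mem_letter_not, ih, and_comm]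

/-- A cancelling pair of letters contributes a partial automorphism composed with its inverse, a
restriction of the identity. Deleting it can only enlarge the graph. -/
theorem mem_word_of_step {w w' : List (ι × Bool)} (h : FreeGroup.Red.Step w w') {x y : A}
    (hxy : (x, y) ∈ (word base w).graph) : (x, y) ∈ (word base w').graph := by
  obtain ⟨⟩ := h
  rename_i L₁ L₂ i b
  obtain ⟨z, h1, h2⟩ := (mem_word_append base).1 hxy
  obtain ⟨z', ⟨z'', h3, h4⟩, h5⟩ := h1
  rw [mem_letter_not] at h4
  obtain rfl := right_unique h4 h5
  exact (mem_word_append base).2 ⟨_, h3, h2⟩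

theorem mem_word_of_red {w w' : List (ι × Bool)} (h : FreeGroup.Red w w') {x y : A}
    (hxy : (x, y) ∈ (word base w).graph) : (x, y) ∈ (word base w').graph := by
  induction h with
  | refl => exact hxy
  | tail _ h ih => exact mem_word_of_step base h ih

section FreeGroup

variable [DecidableEq ι]

theorem red_toWord_mul (s t : FreeGroup ι) :
    FreeGroup.Red (s.toWord ++ t.toWord) (s * t).toWord := by
  rw [FreeGroup.toWord_mul]
  exact FreeGroup.reduce.red

theorem mem_ran_toWord_inv {s : FreeGroup ι} {x : A} :
    x ∈ (word base (s⁻¹).toWord).ran ↔ ∃ y, (x, y) ∈ (word base s.toWord).graph := by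
  rw [mem_ran, FreeGroup.toWord_inv]
  exact exists_congr fun y => mem_word_invRev base

end FreeGroup

end PartialAut

/-! ### The partial action freely generated by partial automorphisms -/

namespace PartialAction

variable {A : Type u} [NonUnitalCStarAlgebra A]

section OfBase

variable {ι : Type} [DecidableEq ι] (base : ι → PartialAut A)

/-- The partial action of a free group that is freely generated by partial automorphisms. -/
def ofBase : PartialAction (FreeGroup ι) A where
  ideal s := (PartialAut.word base s.toWord).ran
  isClosed s := PartialAut.isClosed_ran _
  mul_mem_left s a d hd := PartialAut.mul_mem_ran _ a hd
  mul_mem_right s a d hd := PartialAut.mem_ran_mul _ a hd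
  equiv s := (PartialAut.word base s.toWord).equivOfGraph
    (fun _ => PartialAut.mem_ran_toWord_inv base) fun _ => PartialAut.mem_ran _
  ideal_one := by
    rw [eq_top_iff]
    intro x _
    rw [FreeGroup.toWord_one]
    exact (PartialAut.mem_ran _).2 ⟨x, rfl⟩
  -- `α_s ∘ α_t` belongs to the concatenation of the reduced words of `s` and `t`, and reducing that
  -- word enlarges the graph.
  extend s t x h := by
    set y := (PartialAut.word base t.toWord).equivOfGraph
      (fun _ => PartialAut.mem_ran_toWord_inv base) (fun _ => PartialAut.mem_ran _) x
    have h1 : ((x : A), (y : A)) ∈ (PartialAut.word base t.toWord).graph :=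
      PartialAut.equivOfGraph_mem _ _ _ x
    have h2 := PartialAut.equivOfGraph_mem (PartialAut.word base s.toWord)
      (fun _ => PartialAut.mem_ran_toWord_inv base) (fun _ => PartialAut.mem_ran _) ⟨y, h⟩
    have h3 := PartialAut.mem_word_of_red base (PartialAut.red_toWord_mul s t)
      ((PartialAut.mem_word_append base).2 ⟨_, h1, h2⟩)
    exact ⟨(PartialAut.mem_ran_toWord_inv base).2 ⟨_, h3⟩,
      PartialAut.right_unique (PartialAut.equivOfGraph_mem _ _ _ _) h3⟩

theorem rel_ofBase {s : FreeGroup ι} {x y : A} :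
    (ofBase base).Rel s x y ↔ (x, y) ∈ (PartialAut.word base s.toWord).graph := by
  constructor
  · rintro ⟨h, rfl⟩
    exact PartialAut.equivOfGraph_mem (PartialAut.word base s.toWord) _ _ ⟨x, h⟩
  · intro h
    have h1 := (PartialAut.mem_ran_toWord_inv base).2 ⟨_, h⟩
    exact ⟨h1, PartialAut.right_unique
      (PartialAut.equivOfGraph_mem (PartialAut.word base s.toWord) _ _ ⟨x, h1⟩) h⟩

end OfBase

theorem isMultiplicative_ofBase {n : ℕ} (base : Fin n → PartialAut A) :
    (ofBase base).IsMultiplicative := by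
  -- This holds for every word; reducedness is needed only to identify the word map with `α` at the
  -- group element.
  have key : ∀ (w : List (Fin n × Bool)) (x y : A), (x, y) ∈ (PartialAut.word base w).graph ↔
      y ∈ (w.map fun l => (ofBase base).pmap (FreeGroup.mk [l])).foldr PFun.comp (PFun.id A) x := by
    intro w x
    induction w with
    | nil => exact fun y => (eq_comm.trans Part.mem_some_iff.symm)
    | cons l w ih =>
      intro y
      have h1 : ∀ z, (z, y) ∈ (PartialAut.letter base l).graph ↔
          y ∈ (ofBase base).pmap (FreeGroup.mk [l]) z := fun z => by
        rw [mem_pmap (α := ofBase base), rel_ofBase, FreeGroup.toWord_mk,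
          FreeGroup.IsReduced.reduce_eq (by simp), PartialAut.mem_word_singleton]
      constructor
      · rintro ⟨z, hz, hy⟩
        exact Part.mem_bind_iff.2 ⟨z, (ih z).1 hz, (h1 z).1 hy⟩
      · intro h
        obtain ⟨z, hz, hy⟩ := Part.mem_bind_iff.1 h
        exact ⟨z, (ih z).2 hz, (h1 z).2 hy⟩
  intro w hw
  refine PFun.ext fun x y => ?_
  rw [← key, mem_pmap (α := ofBase base), rel_ofBase, FreeGroup.toWord_mk, FreeGroup.IsReduced.reduce_eq hw]

end PartialAction

/-! ### Conjugation by unitary multipliers, and their products along words -/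

namespace Coaction

section Conj

variable {G : Type} [Group G] {B : Type u} [NonUnitalCStarAlgebra B] {δ : Coaction G B}
  {s : G} {u : (universalRep B).space →L[ℂ] (universalRep B).space}

local notation "Φ" => HilbertRep.hom (universalRep B)

namespace IsUnitaryMultiplier

/-- Conjugation passes through `B_s`: first `ud` lies in `B_s`, then `B_s u*` lies in `D_s`. -/
theorem exists_conj (hu : δ.IsUnitaryMultiplier s u) {d : B} (hd : d ∈ δ.ideal s⁻¹) :
    ∃ d' ∈ δ.ideal s, Φ d' = u * Φ d * star u := by
  obtain ⟨b, hb, h⟩ := hu.right d hd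
  obtain ⟨d', hd', h'⟩ := hu.spectral_mul_star hb
  exact ⟨d', hd', by rw [h, h']⟩

theorem ideal_mul_cancel (hu : δ.IsUnitaryMultiplier s u) {d : B} (hd : d ∈ δ.ideal s) :
    Φ d * u * star u = Φ d := by
  rw [mul_assoc, hu.mul_adjoint, δ.ideal_mul_proj hd]

theorem ideal_inv_mul_cancel (hu : δ.IsUnitaryMultiplier s u) {d : B} (hd : d ∈ δ.ideal s⁻¹) :
    Φ d * star u * u = Φ d := by
  rw [mul_assoc, hu.adjoint_mul, δ.ideal_mul_proj hd]

theorem cancel_mul_ideal_inv (hu : δ.IsUnitaryMultiplier s u) {d : B} (hd : d ∈ δ.ideal s⁻¹) :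
    star u * (u * Φ d) = Φ d := by
  rw [← mul_assoc, hu.adjoint_mul, δ.proj_mul_ideal hd]

theorem conj_symm (hu : δ.IsUnitaryMultiplier s u) {d d' : B} (hd : d ∈ δ.ideal s⁻¹)
    (h : Φ d' = u * Φ d * star u) : Φ d = star u * Φ d' * u := by
  rw [h, mul_assoc, mul_assoc (u * Φ d), mul_assoc u, ← mul_assoc (Φ d),
    hu.ideal_inv_mul_cancel hd, hu.cancel_mul_ideal_inv hd]

theorem norm_le_one (hu : δ.IsUnitaryMultiplier s u) : ‖u‖ ≤ 1 := by
  have h1 : ‖u‖ * ‖u‖ ≤ 1 := by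
    rw [← CStarRing.norm_self_mul_star, hu.mul_adjoint]
    exact Submodule.starProjection_norm_le _
  nlinarith [norm_nonneg u]

theorem norm_conj_le (hu : δ.IsUnitaryMultiplier s u) {d d' : B}
    (h : Φ d' = u * Φ d * star u) : ‖d'‖ ≤ ‖d‖ := by
  rw [← norm_universalRep, h, ← norm_universalRep d]
  refine (norm_mul_le _ _).trans ?_
  rw [norm_star]
  refine (mul_le_of_le_one_right (norm_nonneg _) hu.norm_le_one).trans ?_
  exact (norm_mul_le _ _).trans (mul_le_of_le_one_left (norm_nonneg _) hu.norm_le_one)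

variable {A : Type u} [NonUnitalCStarAlgebra A] (j : A →⋆ₙₐ[ℂ] B)

/-- The partial automorphism of the fixed point algebra `j(A)` given by conjugation with `u`. -/
def conj (hj : Function.Injective j) (hj1 : ∀ {b}, b ∈ δ.spectral 1 ↔ ∃ a, j a = b)
    (hu : δ.IsUnitaryMultiplier s u) : PartialAut A where
  graph :=
    { carrier := {p | j p.1 ∈ δ.ideal s⁻¹ ∧ j p.2 ∈ δ.ideal s ∧
        Φ (j p.2) = u * Φ (j p.1) * star u}
      add_mem' := by
        rintro p q ⟨h1, h2, h3⟩ ⟨h1', h2', h3'⟩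
        refine ⟨?_, ?_, ?_⟩
        · rw [Prod.fst_add, map_add]; exact add_mem h1 h1'
        · rw [Prod.snd_add, map_add]; exact add_mem h2 h2'
        · rw [Prod.fst_add, Prod.snd_add, map_add, map_add, map_add, map_add, h3, h3', mul_add,
            add_mul]
      zero_mem' := by
        refine ⟨?_, ?_, ?_⟩
        · rw [Prod.fst_zero, map_zero]; exact zero_mem _
        · rw [Prod.snd_zero, map_zero]; exact zero_mem _
        · rw [Prod.fst_zero, Prod.snd_zero, map_zero, map_zero, mul_zero, zero_mul]
      mul_mem' := by
        rintro p q ⟨h1, h2, h3⟩ ⟨h1', h2', h3'⟩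
        refine ⟨?_, ?_, ?_⟩
        · rw [Prod.fst_mul, map_mul]
          exact δ.mul_mem_ideal_left (δ.ideal_le_spectral_one _ h1) h1'
        · rw [Prod.snd_mul, map_mul]
          exact δ.mul_mem_ideal_left (δ.ideal_le_spectral_one _ h2) h2'
        -- The inner factor `u*u` is the unit on `D_{s⁻¹}` and drops out between the two conjugates.
        · rw [Prod.fst_mul, Prod.snd_mul, map_mul, map_mul, map_mul, map_mul, h3, h3',
            mul_assoc (u * Φ (j p.1)), ← mul_assoc (star u), hu.cancel_mul_ideal_inv h1',
            mul_assoc u, mul_assoc u, mul_assoc (Φ (j p.1))]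
      smul_mem' := by
        rintro c p ⟨h1, h2, h3⟩
        refine ⟨?_, ?_, ?_⟩
        · rw [Prod.smul_fst, map_smul]; exact Submodule.smul_mem _ c h1
        · rw [Prod.smul_snd, map_smul]; exact Submodule.smul_mem _ c h2
        · rw [Prod.smul_fst, Prod.smul_snd, map_smul, map_smul, map_smul, map_smul, h3,
            mul_smul_comm, smul_mul_assoc]
      star_mem' := by
        rintro p ⟨h1, h2, h3⟩
        refine ⟨?_, ?_, ?_⟩
        · rw [Prod.fst_star, StarHomClass.map_star]; exact δ.star_mem_ideal h1
        · rw [Prod.snd_star, StarHomClass.map_star]; exact δ.star_mem_ideal h2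
        · rw [Prod.fst_star, Prod.snd_star, StarHomClass.map_star, StarHomClass.map_star,
            StarHomClass.map_star, StarHomClass.map_star, h3, star_mul, star_mul, star_star,
            mul_assoc] }
  isClosed := by
    have hjc := j.continuous_cstar
    have hΦ : Continuous Φ := continuous_universalRep
    refine ((δ.isClosed_ideal _).preimage (hjc.comp continuous_fst)).inter
      (((δ.isClosed_ideal _).preimage (hjc.comp continuous_snd)).inter (isClosed_eq ?_ ?_))
    · exact hΦ.comp (hjc.comp continuous_snd)
    · exact (continuous_const.mul (hΦ.comp (hjc.comp continuous_fst))).mul continuous_const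
  norm_eq := by
    rintro x y ⟨h1, h2, h3⟩
    -- Conjugations by `u` and by `u*` are mutually inverse contractions, hence isometric.
    have h4 := hu.conj_symm h1 h3
    rw [← NonUnitalStarAlgHom.norm_map j hj x, ← NonUnitalStarAlgHom.norm_map j hj y]
    exact le_antisymm (hu.adjoint.norm_conj_le (by rw [star_star]; exact h4))
      (hu.norm_conj_le h3)
  left := by
    rintro x y ⟨h1, h2, h3⟩ a
    have h4 : j (a * x) ∈ δ.ideal s⁻¹ := by
      rw [map_mul]
      exact δ.mul_mem_ideal_left (hj1.2 ⟨a, rfl⟩) h1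
    obtain ⟨d, hd, h5⟩ := hu.exists_conj h4
    obtain ⟨y', rfl⟩ := hj1.1 (δ.ideal_le_spectral_one _ hd)
    exact ⟨y', h4, hd, h5⟩
  right := by
    rintro x y ⟨h1, h2, h3⟩ a
    have h4 : j (a * y) ∈ δ.ideal s := by
      rw [map_mul]
      exact δ.mul_mem_ideal_left (hj1.2 ⟨a, rfl⟩) h2
    have h4' : j (a * y) ∈ δ.ideal s⁻¹⁻¹ := by rwa [inv_inv]
    obtain ⟨d, hd, h5⟩ := hu.adjoint.exists_conj h4'
    obtain ⟨x', rfl⟩ := hj1.1 (δ.ideal_le_spectral_one _ hd)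
    refine ⟨x', hd, h4, ?_⟩
    have h6 := hu.adjoint.conj_symm h4' h5
    rwa [star_star] at h6

theorem mem_ran_conj {hj : Function.Injective j} {hj1 : ∀ {b}, b ∈ δ.spectral 1 ↔ ∃ a, j a = b}
    {hu : δ.IsUnitaryMultiplier s u} {y : A} (hy : j y ∈ δ.ideal s) :
    y ∈ (hu.conj j hj hj1).ran := by
  have hy' : j y ∈ δ.ideal s⁻¹⁻¹ := by rwa [inv_inv]
  obtain ⟨d, hd, h⟩ := hu.adjoint.exists_conj hy'
  obtain ⟨x, rfl⟩ := hj1.1 (δ.ideal_le_spectral_one _ hd)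
  refine (PartialAut.mem_ran _).2 ⟨x, hd, hy, ?_⟩
  have h6 := hu.adjoint.conj_symm hy' h
  rwa [star_star] at h6

end IsUnitaryMultiplier

end Conj

variable {ι : Type} [DecidableEq ι] {B : Type u} [NonUnitalCStarAlgebra B]
  (δ : Coaction (FreeGroup ι) B) (A : Type u) [NonUnitalCStarAlgebra A]

/-- The fixed point algebra of a coaction of a free group, with unitary multipliers for the
generators. -/
structure Frame where
  incl : A →⋆ₙₐ[ℂ] B
  injective : Function.Injective incl
  mem_spectral_one : ∀ {b}, b ∈ δ.spectral 1 ↔ ∃ a, incl a = b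
  mult : ι → ((universalRep B).space →L[ℂ] (universalRep B).space)
  isUnitary : ∀ i, δ.IsUnitaryMultiplier (FreeGroup.of i) (mult i)

namespace Frame

variable {δ A} (F : δ.Frame A)

local notation "Φ" => HilbertRep.hom (universalRep B)

/-- The element of the fixed point algebra as an operator. -/
def op (a : A) : (universalRep B).space →L[ℂ] (universalRep B).space := Φ (F.incl a)

theorem op_mul (a b : A) : F.op (a * b) = F.op a * F.op b := by
  rw [op, map_mul, map_mul]; rfl

theorem op_star (a : A) : F.op (star a) = star (F.op a) := by
  rw [op, StarHomClass.map_star, StarHomClass.map_star]; rfl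

/-- The partial automorphisms given by conjugation with the multipliers of the generators. -/
def base (i : ι) : PartialAut A := (F.isUnitary i).conj F.incl F.injective F.mem_spectral_one

/-- The multiplier of a generator or the inverse of one. -/
def unit (l : ι × Bool) : (universalRep B).space →L[ℂ] (universalRep B).space :=
  if l.2 then F.mult l.1 else star (F.mult l.1)

theorem isUnitary_unit (l : ι × Bool) : δ.IsUnitaryMultiplier (FreeGroup.mk [l]) (F.unit l) := by
  obtain ⟨i, b⟩ := l
  cases b
  · exact (F.isUnitary i).adjoint
  · exact F.isUnitary i

theorem unit_not (i : ι) (b : Bool) : F.unit (i, !b) = star (F.unit (i, b)) := by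
  cases b
  · exact (star_star (F.mult i)).symm
  · rfl

theorem mem_letter {l : ι × Bool} {x y : A} (h : (x, y) ∈ (PartialAut.letter F.base l).graph) :
    F.incl x ∈ δ.ideal (FreeGroup.mk [l])⁻¹ ∧ F.incl y ∈ δ.ideal (FreeGroup.mk [l]) ∧
      F.op y = F.unit l * F.op x * star (F.unit l) := by
  obtain ⟨i, b⟩ := l
  cases b
  · obtain ⟨h1, h2, h3⟩ := h
    refine ⟨h2, h1, ?_⟩
    have := (F.isUnitary i).conj_symm h1 h3
    change F.op y = star (F.mult i) * F.op x * star (star (F.mult i))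
    rw [star_star]
    exact this
  · exact h

theorem unit_mul_op {l : ι × Bool} {x y : A} (h : (x, y) ∈ (PartialAut.letter F.base l).graph) :
    F.unit l * F.op x = F.op y * F.unit l := by
  obtain ⟨h1, h2, h3⟩ := F.mem_letter h
  rw [h3, mul_assoc, mul_assoc, ← mul_assoc (F.op x)]
  exact congrArg _ ((F.isUnitary_unit l).ideal_inv_mul_cancel h1).symm

/-- The product of the multipliers along a word. -/
def wordUnit (w : List (ι × Bool)) : (universalRep B).space →L[ℂ] (universalRep B).space :=
  (w.map F.unit).prod

theorem wordUnit_cons (l : ι × Bool) (w : List (ι × Bool)) :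
    F.wordUnit (l :: w) = F.unit l * F.wordUnit w := List.prod_cons

theorem wordUnit_append (w w' : List (ι × Bool)) :
    F.wordUnit (w ++ w') = F.wordUnit w * F.wordUnit w' := by
  rw [wordUnit, List.map_append, List.prod_append]; rfl

theorem wordUnit_nil : F.wordUnit [] = 1 := rfl

theorem wordUnit_invRev (w : List (ι × Bool)) :
    F.wordUnit (FreeGroup.invRev w) = star (F.wordUnit w) := by
  induction w with
  | nil => exact star_one _ |>.symm
  | cons l w ih =>
    have h1 : FreeGroup.invRev (l :: w) = FreeGroup.invRev w ++ [(l.1, !l.2)] := by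
      simp [FreeGroup.invRev]
    rw [h1, wordUnit_append, ih, wordUnit_cons, wordUnit_cons, star_mul, unit_not, wordUnit_nil,
      mul_one]

/-- The one-letter relation `u_l x = α_l(x) u_l` is moved through the word. Nothing is claimed about
`u_w` being a partial isometry; only its products with elements of the domain or range of `α_w`
matter. -/
theorem wordUnit_mul_op {w : List (ι × Bool)} {x y : A}
    (h : (x, y) ∈ (PartialAut.word F.base w).graph) :
    F.wordUnit w * F.op x = F.op y * F.wordUnit w := by
  induction w generalizing y with
  | nil =>
    obtain rfl : x = y := h
    rw [wordUnit_nil, one_mul, mul_one]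
  | cons l w ih =>
    obtain ⟨z, h1, h2⟩ := h
    rw [wordUnit_cons, mul_assoc, ih h1, ← mul_assoc, F.unit_mul_op h2, mul_assoc]

/-- For a word `lw`, write `y u_l u_w = u_l z u_w` with `z` in `D_{l⁻¹}`. Replacing `z` by `ez` with
`e` in `D_{l⁻¹}` splits this into `u_l e`, an element of `B_l`, and `z u_w`, which lies in `B_w` by
induction. -/
theorem exists_mem_spectral {w : List (ι × Bool)} {x y : A}
    (h : (x, y) ∈ (PartialAut.word F.base w).graph) :
    ∃ b ∈ δ.spectral (FreeGroup.mk w), F.op y * F.wordUnit w = Φ b := by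
  induction w generalizing y with
  | nil => exact ⟨F.incl y, F.mem_spectral_one.2 ⟨y, rfl⟩, mul_one _⟩
  | cons l w ih =>
    obtain ⟨z, h1, h2⟩ := h
    obtain ⟨b, hb, hb'⟩ := ih h1
    have hz := (F.mem_letter h2).1
    rw [wordUnit_cons, ← mul_assoc, ← F.unit_mul_op h2]
    have hcl : IsClosed {v : B | ∃ c ∈ (δ.spectral (FreeGroup.mk (l :: w)) : Set B),
        F.unit l * Φ v * F.wordUnit w = Φ c} :=
      (isClosed_universalRep_image (δ.isClosed_spectral _)).preimage
        ((continuous_const.mul continuous_universalRep).mul continuous_const)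
    refine closure_minimal ?_ hcl (δ.mem_closure_ideal_mul_self hz)
    rintro _ ⟨e, he, rfl⟩
    obtain ⟨c, hc, hc'⟩ := (F.isUnitary_unit l).right e he
    have hcb := δ.mul_mem_spectral hc hb
    rw [FreeGroup.mul_mk, List.singleton_append] at hcb
    refine ⟨c * b, hcb, ?_⟩
    have hb2 : Φ (F.incl z) * F.wordUnit w = Φ b := hb'
    rw [map_mul Φ e, map_mul Φ c, ← hb2, ← hc']
    simp only [mul_assoc]

/-- Moving `y` through the letters before the cancelling pair turns it into some `z` in `D_l`, on
which `u_l u_l*` acts as the unit. Without the factor `y` the two products need not agree. -/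
theorem op_mul_wordUnit_of_step {w w' : List (ι × Bool)} (hw : FreeGroup.Red.Step w w') {x y : A}
    (h : (x, y) ∈ (PartialAut.word F.base w).graph) :
    F.op y * F.wordUnit w = F.op y * F.wordUnit w' := by
  obtain ⟨⟩ := hw
  rename_i L₁ L₂ i b
  obtain ⟨z, h1, h2⟩ := (PartialAut.mem_word_append F.base).1 h
  obtain ⟨z', h3, h4⟩ := h1
  have h5 := (F.isUnitary_unit (i, b)).ideal_mul_cancel (F.mem_letter h4).2.1
  rw [wordUnit_append, wordUnit_append, ← mul_assoc, ← mul_assoc, ← F.wordUnit_mul_op h2,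
    mul_assoc, mul_assoc, wordUnit_cons, wordUnit_cons, unit_not, ← mul_assoc (F.unit (i, b)),
    ← mul_assoc (F.op z), ← mul_assoc (F.op z)]
  congr 2

theorem op_mul_wordUnit_of_red {w w' : List (ι × Bool)} (hw : FreeGroup.Red w w') {x y : A}
    (h : (x, y) ∈ (PartialAut.word F.base w).graph) :
    F.op y * F.wordUnit w = F.op y * F.wordUnit w' := by
  induction hw with
  | refl => rfl
  | tail h1 h2 ih =>
    exact ih.trans (F.op_mul_wordUnit_of_step h2 (PartialAut.mem_word_of_red F.base h1 h))

end Frame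

end Coaction

/-- Both coordinate projections of `R` are injective `*`-homomorphisms, hence isometric with closed
range. The ranges are dense, so both projections are isomorphisms. -/
theorem NonUnitalStarSubalgebra.exists_starAlgEquiv {X Y : Type*} [NonUnitalCStarAlgebra X]
    [NonUnitalCStarAlgebra Y] (R : NonUnitalStarSubalgebra ℂ (X × Y))
    (hR : IsClosed (R : Set (X × Y))) (h₁ : ∀ y, (0, y) ∈ R → y = 0) (h₂ : ∀ x, (x, 0) ∈ R → x = 0)
    (hX : Dense {x | ∃ y, (x, y) ∈ R}) (hY : Dense {y | ∃ x, (x, y) ∈ R}) :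
    ∃ θ : X ≃⋆ₐ[ℂ] Y, ∀ x y, (x, y) ∈ R → θ x = y := by
  have := hR
  let π₁ : R →⋆ₙₐ[ℂ] X :=
    (NonUnitalStarAlgHom.fst ℂ X Y).comp (NonUnitalStarSubalgebraClass.subtype R)
  let π₂ : R →⋆ₙₐ[ℂ] Y :=
    (NonUnitalStarAlgHom.snd ℂ X Y).comp (NonUnitalStarSubalgebraClass.subtype R)
  have hi₁ : Function.Injective π₁ := by
    rw [injective_iff_map_eq_zero]
    rintro ⟨⟨x, y⟩, h⟩ hx
    obtain rfl : x = 0 := hx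
    exact Subtype.ext (Prod.ext rfl (h₁ y h))
  have hi₂ : Function.Injective π₂ := by
    rw [injective_iff_map_eq_zero]
    rintro ⟨⟨x, y⟩, h⟩ hx
    obtain rfl : y = 0 := hx
    exact Subtype.ext (Prod.ext (h₂ x h) rfl)
  have hs₁ : Function.Surjective π₁ := by
    have hc := (NonUnitalStarAlgHom.isometry π₁ hi₁).isClosedEmbedding.isClosed_range
    rw [← Set.range_eq_univ, ← hc.closure_eq, ← dense_iff_closure_eq]
    refine hX.mono ?_
    rintro x ⟨y, h⟩
    exact ⟨⟨(x, y), h⟩, rfl⟩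
  have hs₂ : Function.Surjective π₂ := by
    have hc := (NonUnitalStarAlgHom.isometry π₂ hi₂).isClosedEmbedding.isClosed_range
    rw [← Set.range_eq_univ, ← hc.closure_eq, ← dense_iff_closure_eq]
    refine hY.mono ?_
    rintro y ⟨x, h⟩
    exact ⟨⟨(x, y), h⟩, rfl⟩
  let e₁ : R ≃⋆ₐ[ℂ] X := StarAlgEquiv.ofBijective π₁ ⟨hi₁, hs₁⟩
  let e₂ : R ≃⋆ₐ[ℂ] Y := StarAlgEquiv.ofBijective π₂ ⟨hi₂, hs₂⟩
  refine ⟨e₁.symm.trans e₂, fun x y h => ?_⟩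
  have h3 : e₁.symm x = ⟨(x, y), h⟩ := e₁.symm_apply_eq.2 rfl
  change e₂ (e₁.symm x) = y
  rw [h3]
  rfl

namespace Coaction

/-! ### Transport of a coaction along an isomorphism -/

section Transport

variable {G : Type} [Group G] {B C : Type u} [NonUnitalCStarAlgebra B] [NonUnitalCStarAlgebra C]
  (δ : Coaction G B) (θ : B ≃⋆ₐ[ℂ] C)

/-- The isomorphism `θ ⊗ ι`. -/
def transportMap : MinTensor B (GroupCStar G) →⋆ₙₐ[ℂ] MinTensor C (GroupCStar G) :=
  MinTensor.map (θ : B →⋆ₙₐ[ℂ] C) (NonUnitalStarAlgHom.id ℂ (GroupCStar G))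

theorem transportMap_symm (y : MinTensor B (GroupCStar G)) :
    transportMap θ.symm (transportMap θ y) = y := MinTensor.map_symm_map θ y

theorem transportMap_apply_symm (y : MinTensor C (GroupCStar G)) :
    transportMap θ (transportMap θ.symm y) = y := MinTensor.map_symm_map θ.symm y

/-- The underlying homomorphism of the coaction that corresponds to `δ` under `θ`. -/
def transportHom : C →⋆ₙₐ[ℂ] MinTensor C (GroupCStar G) :=
  (transportMap θ).comp (δ.hom.comp (θ.symm : C →⋆ₙₐ[ℂ] B))

theorem transportHom_apply (c : C) :
    δ.transportHom θ c = transportMap θ (δ.hom (θ.symm c)) := rfl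

theorem transportHom_apply_map (b : B) :
    δ.transportHom θ (θ b) = transportMap θ (δ.hom b) := by
  rw [transportHom_apply, StarAlgEquiv.symm_apply_apply]

theorem transport_nondegenerate :
    (Submodule.span ℂ {z | ∃ (c : C) (x : MinTensor C (GroupCStar G)),
      z = δ.transportHom θ c * x}).topologicalClosure = ⊤ := by
  rw [eq_top_iff]
  intro z _
  set K := (Submodule.span ℂ {z | ∃ (c : C) (x : MinTensor C (GroupCStar G)),
      z = δ.transportHom θ c * x}).topologicalClosure with hK
  have hKc : IsClosed (K : Set (MinTensor C (GroupCStar G))) :=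
    Submodule.isClosed_topologicalClosure _
  have h1 : ∀ y : MinTensor B (GroupCStar G), transportMap θ y ∈ K := by
    intro y
    have hy : y ∈ (Submodule.span ℂ {z | ∃ (b : B) (x : MinTensor B (GroupCStar G)),
        z = δ.hom b * x}).topologicalClosure := by rw [δ.nondegenerate]; trivial
    refine closure_minimal (t := {y | transportMap θ y ∈ K}) ?_
      (hKc.preimage (transportMap θ).continuous_cstar) hy
    intro y hy
    change transportMap θ y ∈ K
    induction hy using Submodule.span_induction with
    | mem y h =>
      obtain ⟨b, x, rfl⟩ := h
      rw [map_mul, ← transportHom_apply_map]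
      exact Submodule.le_topologicalClosure _ (Submodule.subset_span ⟨_, _, rfl⟩)
    | zero => rw [map_zero]; exact zero_mem _
    | add a b _ _ ha hb => rw [map_add]; exact add_mem ha hb
    | smul c a _ ha => rw [map_smul]; exact Submodule.smul_mem _ c ha
  rw [← transportMap_apply_symm θ z]
  exact h1 _

/-- The map induced by `θ` on the triple tensor products intertwines both sides of the coaction
identity, and it carries one associativity graph into the other because it does so on elementary
tensors. -/
theorem transport_coassoc (c : C) :
    (MinTensor.map (δ.transportHom θ) (NonUnitalStarAlgHom.id ℂ (GroupCStar G))
        (δ.transportHom θ c),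
      MinTensor.map (NonUnitalStarAlgHom.id ℂ C) (GroupCStar.comul G) (δ.transportHom θ c)) ∈
    MinTensor.assocGraph C (GroupCStar G) (GroupCStar G) := by
  let I := NonUnitalStarAlgHom.id ℂ (GroupCStar G)
  let L₁ := MinTensor.map (transportMap (G := G) θ) I
  let L₂ := MinTensor.map (θ : B →⋆ₙₐ[ℂ] C)
    (NonUnitalStarAlgHom.id ℂ (MinTensor (GroupCStar G) (GroupCStar G)))
  have h1 : ∀ p ∈ MinTensor.assocGraph B (GroupCStar G) (GroupCStar G),
      (L₁ p.1, L₂ p.2) ∈ MinTensor.assocGraph C (GroupCStar G) (GroupCStar G) := by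
    intro p hp
    have hcl : IsClosed (SetLike.coe (MinTensor.assocGraph C (GroupCStar G) (GroupCStar G))) :=
      Submodule.isClosed_topologicalClosure _
    refine closure_minimal (t := {p : MinTensor (MinTensor B (GroupCStar G)) (GroupCStar G) ×
      MinTensor B (MinTensor (GroupCStar G) (GroupCStar G)) | (L₁ p.1, L₂ p.2) ∈
      MinTensor.assocGraph C (GroupCStar G) (GroupCStar G)}) ?_
      (hcl.preimage ((L₁.continuous_cstar.comp continuous_fst).prodMk
        (L₂.continuous_cstar.comp continuous_snd))) hp
    intro p hp
    change (L₁ p.1, L₂ p.2) ∈ MinTensor.assocGraph C (GroupCStar G) (GroupCStar G)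
    induction hp using Submodule.span_induction with
    | mem p h =>
      obtain ⟨b, x, y, rfl⟩ := h
      refine Submodule.le_topologicalClosure _ (Submodule.subset_span ⟨θ b, x, y, ?_⟩)
      refine Prod.ext ?_ ?_
      · change L₁ _ = _
        rw [MinTensor.map_tmul, transportMap, MinTensor.map_tmul]
        rfl
      · change L₂ _ = _
        rw [MinTensor.map_tmul]
        rfl
    | zero =>
      rw [Prod.fst_zero, Prod.snd_zero, map_zero, map_zero]
      exact zero_mem _
    | add a b _ _ ha hb =>
      rw [Prod.fst_add, Prod.snd_add, map_add, map_add]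
      exact add_mem ha hb
    | smul r a _ ha =>
      rw [Prod.smul_fst, Prod.smul_snd, map_smul, map_smul]
      exact Submodule.smul_mem _ r ha
  have h2 := h1 _ (δ.coassoc (θ.symm c))
  have h3 : ∀ y : MinTensor B (GroupCStar G), MinTensor.map (δ.transportHom θ) I
      (transportMap θ y) = L₁ (MinTensor.map δ.hom I y) := fun y =>
    MinTensor.hom_ext (S := (MinTensor.map (δ.transportHom θ) I).comp (transportMap θ))
      (T := L₁.comp (MinTensor.map δ.hom I)) (fun b x => by
        rw [NonUnitalStarAlgHom.comp_apply, NonUnitalStarAlgHom.comp_apply, transportMap,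
          MinTensor.map_tmul, MinTensor.map_tmul, MinTensor.map_tmul, MinTensor.map_tmul]
        exact congrArg (fun t => MinTensor.tmul t x) (δ.transportHom_apply_map θ b)) y
  have h4 : ∀ y : MinTensor B (GroupCStar G),
      MinTensor.map (NonUnitalStarAlgHom.id ℂ C) (GroupCStar.comul G) (transportMap θ y) =
      L₂ (MinTensor.map (NonUnitalStarAlgHom.id ℂ B) (GroupCStar.comul G) y) := fun y =>
    MinTensor.hom_ext
      (S := (MinTensor.map (NonUnitalStarAlgHom.id ℂ C) (GroupCStar.comul G)).comp
        (transportMap θ))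
      (T := L₂.comp (MinTensor.map (NonUnitalStarAlgHom.id ℂ B) (GroupCStar.comul G)))
      (fun b x => by
        rw [NonUnitalStarAlgHom.comp_apply, NonUnitalStarAlgHom.comp_apply, transportMap,
          MinTensor.map_tmul, MinTensor.map_tmul, MinTensor.map_tmul, MinTensor.map_tmul]
        rfl) y
  rw [transportHom_apply, h3, h4]
  exact h2

/-- The coaction that corresponds to `δ` under an isomorphism `θ`. -/
def transport : Coaction G C where
  hom := δ.transportHom θ
  injective x y h := by
    have h1 := congrArg (transportMap θ.symm) h
    rw [transportHom_apply, transportHom_apply, transportMap_symm, transportMap_symm] at h1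
    exact θ.symm.injective (δ.injective h1)
  nondegenerate := δ.transport_nondegenerate θ
  coassoc := δ.transport_coassoc θ

theorem transport_hom (b : B) : (δ.transport θ).hom (θ b) = MinTensor.map (θ : B →⋆ₙₐ[ℂ] C)
    (NonUnitalStarAlgHom.id ℂ (GroupCStar G)) (δ.hom b) := δ.transportHom_apply_map θ b

theorem transport_hom_of_mem_spectral {s : G} {b : B} (hb : b ∈ δ.spectral s) :
    (δ.transport θ).hom (θ b) = MinTensor.tmul (θ b) (GroupCStar.elt s) := by
  rw [transport_hom, (δ.mem_spectral).1 hb, MinTensor.map_tmul]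
  rfl

end Transport

/-- Products and adjoints of homogeneous elements are homogeneous, so the span of the spectral
subspaces is a `*`-algebra. -/
theorem dense_spectralSpan_of_generatesCStar {G : Type} [Group G] {B : Type u}
    [NonUnitalCStarAlgebra B] (δ : Coaction G B) {S : Set B} (hS : GeneratesCStar S)
    (h : S ⊆ ⋃ s, (δ.spectral s : Set B)) : Dense (δ.spectralSpan : Set B) := by
  let N : NonUnitalStarSubalgebra ℂ B :=
    NonUnitalStarSubalgebra.ofSpan (⋃ s, (δ.spectral s : Set B))
      (by
        intro x hx y hy
        obtain ⟨s, hx⟩ := Set.mem_iUnion.1 hx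
        obtain ⟨t, hy⟩ := Set.mem_iUnion.1 hy
        exact Submodule.subset_span (Set.mem_iUnion.2 ⟨s * t, δ.mul_mem_spectral hx hy⟩))
      (by
        intro x hx
        obtain ⟨s, hx⟩ := Set.mem_iUnion.1 hx
        exact Submodule.subset_span (Set.mem_iUnion.2 ⟨s⁻¹, δ.star_mem_spectral hx⟩))
  have h1 : NonUnitalStarAlgebra.adjoin ℂ S ≤ N :=
    NonUnitalStarAlgebra.adjoin_le fun x hx => Submodule.subset_span (h hx)
  intro x
  have h2 : x ∈ (NonUnitalStarAlgebra.adjoin ℂ S).topologicalClosure := by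
    rw [hS]; exact NonUnitalStarAlgebra.mem_top
  exact closure_mono h1 h2

/-! ### Comparison of `B` with the reduced crossed product -/

namespace Frame

variable {ι : Type} [DecidableEq ι] {B : Type u} [NonUnitalCStarAlgebra B]
  {δ : Coaction (FreeGroup ι) B} {A : Type u} [NonUnitalCStarAlgebra A] (F : δ.Frame A)

local notation "Φ" => HilbertRep.hom (universalRep B)

/-- The partial action generated by the multipliers. -/
def action : PartialAction (FreeGroup ι) A := PartialAction.ofBase F.base

theorem rel_action {s : FreeGroup ι} {x y : A} :
    F.action.Rel s x y ↔ (x, y) ∈ (PartialAut.word F.base s.toWord).graph :=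
  PartialAction.rel_ofBase F.base

/-- The pairs of corresponding generators. -/
def pairs : Set (B × F.action.ReducedCrossedProduct) :=
  {p | ∃ (s : FreeGroup ι) (a : F.action.ideal s),
    Φ p.1 = F.op a * F.wordUnit s.toWord ∧ p.2 = F.action.gen s a}

/-- `(a u_s)(a' u_r) = c u_s u_r` with `c = α_s(α_{s⁻¹}(a)a')`. As `c` lies in the range of `α_s ∘
α_r`, the product `u_s u_r` may be replaced by `u_{sr}`. The generators `a m_s` multiply by the same
formula. -/
theorem mul_mem_pairs {p q : B × F.action.ReducedCrossedProduct} (hp : p ∈ F.pairs)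
    (hq : q ∈ F.pairs) : p * q ∈ F.pairs := by
  obtain ⟨b, _⟩ := p
  obtain ⟨b', _⟩ := q
  obtain ⟨s, ⟨a, ha⟩, h1, rfl⟩ := hp
  obtain ⟨r, ⟨a', ha'⟩, h2, rfl⟩ := hq
  obtain ⟨x, hx⟩ := PartialAction.exists_rel_left ha
  obtain ⟨c, hc⟩ := PartialAction.exists_rel (F.action.mul_mem_right _ a' x hx.mem_left)
  obtain ⟨t, ht⟩ := PartialAction.exists_rel_left (F.action.mul_mem_left r x a' ha')
  refine ⟨s * r, _, ?_, PartialAction.gen_mul hx ha' hc⟩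
  change Φ b = F.op a * _ at h1
  change Φ b' = F.op a' * _ at h2
  change Φ (b * b') = F.op c * _
  have h3 := F.op_mul_wordUnit_of_red (PartialAut.red_toWord_mul s r)
    ((PartialAut.mem_word_append F.base).2 ⟨_, F.rel_action.1 ht, F.rel_action.1 hc⟩)
  rw [map_mul, h1, h2, ← h3, F.wordUnit_append, ← F.wordUnit_mul_op (F.rel_action.1 hx),
    ← mul_assoc (F.op c), ← F.wordUnit_mul_op (F.rel_action.1 hc), op_mul]
  simp only [mul_assoc]

theorem star_mem_pairs {p : B × F.action.ReducedCrossedProduct} (hp : p ∈ F.pairs) :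
    star p ∈ F.pairs := by
  obtain ⟨b, _⟩ := p
  obtain ⟨s, ⟨a, ha⟩, h1, rfl⟩ := hp
  obtain ⟨x, hx⟩ := PartialAction.exists_rel_left ha
  refine ⟨s⁻¹, _, ?_, PartialAction.gen_star hx⟩
  change Φ b = F.op a * _ at h1
  change Φ (star b) = F.op (star x) * _
  rw [StarHomClass.map_star, h1, ← F.wordUnit_mul_op (F.rel_action.1 hx), star_mul, op_star,
    FreeGroup.toWord_inv, wordUnit_invRev]

/-- The graph of the isomorphism with the reduced crossed product. -/
def graph : NonUnitalStarSubalgebra ℂ (B × F.action.ReducedCrossedProduct) :=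
  (NonUnitalStarSubalgebra.ofSpan F.pairs
    (fun _ hx _ hy => Submodule.subset_span (F.mul_mem_pairs hx hy))
    fun _ hx => Submodule.subset_span (F.star_mem_pairs hx)).topologicalClosure

theorem isClosed_graph : IsClosed (F.graph : Set (B × F.action.ReducedCrossedProduct)) :=
  NonUnitalStarSubalgebra.isClosed_topologicalClosure _

theorem pairs_subset_graph {p : B × F.action.ReducedCrossedProduct} (hp : p ∈ F.pairs) :
    p ∈ F.graph :=
  NonUnitalStarSubalgebra.le_topologicalClosure _ (Submodule.subset_span hp)

theorem exists_mem_pairs {s : FreeGroup ι} (a : F.action.ideal s) :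
    ∃ b ∈ δ.spectral s, (b, F.action.gen s a) ∈ F.pairs := by
  obtain ⟨x, hx⟩ := PartialAction.exists_rel_left a.2
  obtain ⟨b, hb, h⟩ := F.exists_mem_spectral (F.rel_action.1 hx)
  rw [FreeGroup.mk_toWord] at hb
  exact ⟨b, hb, s, a, h.symm, rfl⟩

theorem mem_spectral {s : FreeGroup ι} {a : F.action.ideal s} {b : B}
    (h : Φ b = F.op a * F.wordUnit s.toWord) : b ∈ δ.spectral s := by
  obtain ⟨x, hx⟩ := PartialAction.exists_rel_left a.2
  obtain ⟨b', hb, h'⟩ := F.exists_mem_spectral (F.rel_action.1 hx)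
  rw [FreeGroup.mk_toWord] at hb
  rwa [universalRep_injective (h.trans h')]

/-- On the span of the pairs the two conditional expectations are the images of one element of `A`
under isometric embeddings. Equality of norms survives the closure, and it is all that is needed to
compare kernels. -/
theorem norm_fourier_eq {p : B × F.action.ReducedCrossedProduct} (hp : p ∈ F.graph) :
    ‖δ.fourier 1 1 p.1‖ = ‖F.action.diag 1 p.2‖ := by
  classical
  refine closure_minimal (t := {p | ‖δ.fourier 1 1 p.1‖ = ‖F.action.diag 1 p.2‖}) ?_
    (isClosed_eq (by fun_prop) (by fun_prop)) hp
  intro p hp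
  have key : ∃ a : A, δ.fourier 1 1 p.1 = F.incl a ∧
      F.action.diag 1 p.2 = (universalRep A).hom a := by
    change p ∈ Submodule.span ℂ F.pairs at hp
    induction hp using Submodule.span_induction with
    | mem p hp =>
      obtain ⟨b, _⟩ := p
      obtain ⟨s, a, h1, rfl⟩ := hp
      change Φ b = F.op a * _ at h1
      have hb := F.mem_spectral h1
      change ∃ c, δ.fourier 1 1 b = _ ∧ F.action.diag 1 (F.action.gen s a) = _
      rw [δ.fourier_of_mem hb, mul_one]
      by_cases hs : s = 1
      · subst hs
        refine ⟨a, ?_, ?_⟩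
        · rw [if_pos rfl]
          rw [FreeGroup.toWord_one, wordUnit_nil, mul_one] at h1
          exact universalRep_injective h1
        · rw [PartialAction.diag_gen_one, PartialAction.ext_one]
      · refine ⟨0, ?_, ?_⟩
        · rw [if_neg hs, map_zero]
        · rw [PartialAction.diag_gen_ne hs, map_zero]
    | zero => exact ⟨0, by simp, by simp⟩
    | add x y _ _ hx hy =>
      obtain ⟨a, h1, h2⟩ := hx
      obtain ⟨b, h3, h4⟩ := hy
      exact ⟨a + b, by rw [Prod.fst_add, map_add, map_add, h1, h3],
        by rw [Prod.snd_add, map_add, map_add, h2, h4]⟩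
    | smul c x _ hx =>
      obtain ⟨a, h1, h2⟩ := hx
      exact ⟨c • a, by rw [Prod.smul_fst, map_smul, map_smul, h1],
        by rw [Prod.smul_snd, map_smul, map_smul, h2]⟩
  obtain ⟨a, h1, h2⟩ := key
  change ‖δ.fourier 1 1 p.1‖ = ‖F.action.diag 1 p.2‖
  rw [h1, h2, NonUnitalStarAlgHom.norm_map _ F.injective, norm_universalRep]

theorem dense_fst_graph {S : Set B} (hS : GeneratesCStar S) (h : ∀ x ∈ S, ∃ y, (x, y) ∈ F.graph) :
    Dense {x | ∃ y, (x, y) ∈ F.graph} := by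
  have h1 : NonUnitalStarAlgebra.adjoin ℂ S ≤
      F.graph.map (NonUnitalStarAlgHom.fst ℂ B F.action.ReducedCrossedProduct) := by
    refine NonUnitalStarAlgebra.adjoin_le fun x hx => ?_
    obtain ⟨y, hy⟩ := h x hx
    exact ⟨(x, y), hy, rfl⟩
  intro x
  have h2 : x ∈ (NonUnitalStarAlgebra.adjoin ℂ S).topologicalClosure := by
    rw [hS]; exact NonUnitalStarAlgebra.mem_top
  refine closure_mono ?_ h2
  intro x hx
  obtain ⟨⟨_, y⟩, hy, rfl⟩ := h1 hx
  exact ⟨y, hy⟩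

theorem dense_snd_graph : Dense {y | ∃ x, (x, y) ∈ F.graph} := by
  refine F.action.dense_span_genSet.mono ?_
  have h1 : Submodule.span ℂ F.action.genSet ≤
      (F.graph.map (NonUnitalStarAlgHom.snd ℂ B F.action.ReducedCrossedProduct)).toSubmodule := by
    rw [Submodule.span_le]
    rintro _ ⟨s, a, rfl⟩
    obtain ⟨b, _, hb⟩ := F.exists_mem_pairs a
    exact ⟨_, F.pairs_subset_graph hb, rfl⟩
  intro y hy
  obtain ⟨⟨x, _⟩, hx, rfl⟩ := h1 hy
  exact ⟨x, hx⟩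

theorem exists_pair_one {x : B} (hx : x ∈ δ.spectral 1) : ∃ y, (x, y) ∈ F.pairs := by
  obtain ⟨a, rfl⟩ := F.mem_spectral_one.1 hx
  refine ⟨_, 1, ⟨a, PartialAction.mem_ideal_one a⟩, ?_, rfl⟩
  rw [FreeGroup.toWord_one, wordUnit_nil, mul_one]
  rfl

/-- `x = du` with `d = xu*` in `D_{g_i}`, so `x` is paired with `d m_s` for `s = g_i`. -/
theorem exists_pair_of {i : ι} {x : B} (hx : x ∈ δ.spectral (FreeGroup.of i)) :
    ∃ y, (x, y) ∈ F.pairs := by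
  obtain ⟨d, hd, h⟩ := (F.isUnitary i).spectral_mul_star hx
  obtain ⟨a, rfl⟩ := F.mem_spectral_one.1 (δ.ideal_le_spectral_one _ hd)
  have ha : a ∈ F.action.ideal (FreeGroup.of i) := by
    obtain ⟨z, hz⟩ := (PartialAut.mem_ran _).1
      ((F.isUnitary i).mem_ran_conj F.incl (hj := F.injective) (hj1 := F.mem_spectral_one) hd)
    have h1 : F.action.Rel (FreeGroup.of i) z a := by
      rw [rel_action, FreeGroup.toWord_of]
      exact (PartialAut.mem_word_singleton F.base).2 hz
    exact h1.mem_right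
  refine ⟨_, FreeGroup.of i, ⟨a, ha⟩, ?_, rfl⟩
  have h1 : F.op a * F.mult i = Φ x := by
    change Φ (F.incl a) * F.mult i = Φ x
    rw [← h, mul_assoc, (F.isUnitary i).adjoint_mul, δ.spectral_mul_proj hx]
  rw [FreeGroup.toWord_of, wordUnit_cons, wordUnit_nil, mul_one]
  exact h1.symm

/-- If `(0, y)` or `(x, 0)` is in the closed graph, then the expectation of `y*y` or of `x*x`
vanishes, so `y` or `x` is zero by faithfulness, which on the side of `B` is normality. The
generation hypothesis makes the first projection dense. -/
theorem exists_equiv (hδ : δ.IsNormal) (hgen : GeneratesCStar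
    ((δ.spectral 1 : Set B) ∪ ⋃ i, (δ.spectral (FreeGroup.of i) : Set B))) :
    ∃ θ : B ≃⋆ₐ[ℂ] F.action.ReducedCrossedProduct, F.action.IsNormalisedDual (δ.transport θ) := by
  have hd : Dense (δ.spectralSpan : Set B) := by
    refine δ.dense_spectralSpan_of_generatesCStar hgen ?_
    rintro x (hx | hx)
    · exact Set.mem_iUnion.2 ⟨1, hx⟩
    · obtain ⟨i, hx⟩ := Set.mem_iUnion.1 hx
      exact Set.mem_iUnion.2 ⟨_, hx⟩
  have hnorm : ∀ {x y}, (x, y) ∈ F.graph →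
      ‖δ.fourier 1 1 (star x * x)‖ = ‖F.action.diag 1 (star y * y)‖ := fun h =>
    F.norm_fourier_eq (mul_mem (star_mem h) h)
  obtain ⟨θ, hθ⟩ := F.graph.exists_starAlgEquiv F.isClosed_graph
    (fun y hy => by
      have h1 := hnorm hy
      rw [mul_zero, map_zero, norm_zero] at h1
      exact PartialAction.eq_zero_of_diag_eq_zero (norm_eq_zero.1 h1.symm))
    (fun x hx => by
      have h1 := hnorm hx
      rw [mul_zero, map_zero, norm_zero] at h1
      exact δ.eq_zero_of_fourier_eq_zero hδ hd (norm_eq_zero.1 h1))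
    (F.dense_fst_graph hgen (by
      rintro x (hx | hx)
      · obtain ⟨y, hy⟩ := F.exists_pair_one hx
        exact ⟨y, F.pairs_subset_graph hy⟩
      · obtain ⟨i, hx⟩ := Set.mem_iUnion.1 hx
        obtain ⟨y, hy⟩ := F.exists_pair_of hx
        exact ⟨y, F.pairs_subset_graph hy⟩))
    F.dense_snd_graph
  -- The dual coaction need not be constructed beforehand: the transport of `δ` is a coaction with
  -- the required values on the generators.
  refine ⟨θ, fun s a => ?_⟩
  obtain ⟨b, hb, h⟩ := F.exists_mem_pairs a
  rw [← hθ b _ (F.pairs_subset_graph h)]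
  exact δ.transport_hom_of_mem_spectral θ hb

end Frame

theorem isMultiplicativeDual_of_generates {n : ℕ} {B : Type u} [NonUnitalCStarAlgebra B]
    {δ : Coaction (FreeGroup (Fin n)) B} (hδ : δ.IsNormal) (hgen : GeneratesCStar
      ((δ.spectral 1 : Set B) ∪ ⋃ i, (δ.spectral (FreeGroup.of i) : Set B)))
    (hm : ∀ i, δ.HasUnitaryMultiplier (FreeGroup.of i)) : δ.IsMultiplicativeDual := by
  choose m hm h1 h2 using hm
  have hcl : IsClosed (δ.fixedAlgebra : Set B) := δ.isClosed_spectral 1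
  let F : δ.Frame δ.fixedAlgebra :=
    { incl := NonUnitalStarSubalgebraClass.subtype δ.fixedAlgebra
      injective := Subtype.val_injective
      mem_spectral_one := fun {b} => ⟨fun hb => ⟨⟨b, hb⟩, rfl⟩, by
        rintro ⟨a, rfl⟩
        exact a.2⟩
      mult := m
      isUnitary := fun i => isUnitaryMultiplier_of_mem (hm i) (h1 i) (h2 i) }
  obtain ⟨θ, hθ⟩ := F.exists_equiv hδ hgen
  exact ⟨_, _, F.action, δ.transport θ, PartialAction.isMultiplicative_ofBase F.base, hθ, θ,
    δ.transport_hom θ⟩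

end Coaction

end

theorem mainTheorem2 {n : ℕ} {B : Type u} [NonUnitalCStarAlgebra B]
    (δ : Coaction (FreeGroup (Fin n)) B) (hδ : δ.IsNormal) :
    (δ.IsMultiplicativeDual ↔
      GeneratesCStar ((δ.spectral 1 : Set B) ∪ ⋃ i, (δ.spectral (FreeGroup.of i) : Set B)) ∧
        ∀ i, δ.HasUnitaryMultiplier (FreeGroup.of i)) ∧
    (δ.IsMultiplicativeDual ↔
      GeneratesCStar ((δ.spectral 1 : Set B) ∪ ⋃ i, (δ.spectral (FreeGroup.of i) : Set B)) ∧
        ∀ i, δ.HasModuleIso (FreeGroup.of i)) ∧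
    ∀ i, δ.HasUnitaryMultiplier (FreeGroup.of i) ↔ δ.HasModuleIso (FreeGroup.of i) :=
  have h : δ.IsMultiplicativeDual ↔
      GeneratesCStar ((δ.spectral 1 : Set B) ∪ ⋃ i, (δ.spectral (FreeGroup.of i) : Set B)) ∧
        ∀ i, δ.HasUnitaryMultiplier (FreeGroup.of i) :=
    -- Necessity produces module isomorphisms, which the equivalence for single group elements turns
    -- into multipliers.
    ⟨fun h => ⟨h.generates_and_hasModuleIso.1, fun i =>
        Coaction.hasUnitaryMultiplier_iff.2 (h.generates_and_hasModuleIso.2 i)⟩,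
      fun h => Coaction.isMultiplicativeDual_of_generates hδ h.1 h.2⟩
  ⟨h, h.trans (and_congr_right fun _ => forall_congr' fun _ => Coaction.hasUnitaryMultiplier_iff),
    fun _ => Coaction.hasUnitaryMultiplier_iff⟩
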